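/- **Conventions.** A *Weil algebra* is a commutative semiring $\mathbb N[x_1,\dots,x_n]/\langle x_ix_j \mid i\sim j\rangle$ with $\sim$ an equivalence relation (in particular $x_i^2=0$); $\mathrm{Weil}$ is the category of Weil algebras and unital semiring homomorphisms, monoidal under the coproduct $\otimes$ with unit $\mathbb N$. Write $W=\mathbb N[x]/(x^2)$ and let $W^k$ be the Weil algebra on $k$ generators all of whose pairwise products vanish. A *tangent category* $\mathbb X$ is described by a left action $T_\bullet:\mathrm{Weil}\times\mathbb X\to\mathbb X$ of the monoidal category $\mathrm{Weil}$ (so $T_{A\otimes B}\cong T_A T_B$, $T_{\mathbb N}\cong 1$), with $T:=T_W$, such that for every object $M$ the action turns the squares exhibiting $W^{k+l}$ as $W^k\times_{\mathbb N}W^l$, and the universality of the vertical lift $$\begin{array}{ccc} W^2 & \xrightarrow{\ x\mapsto x_1x_2,\ y\mapsto x_2\ } & W\otimes W\\ \downarrow & & \downarrow\\ \mathbb N&\longrightarrow& W\end{array}$$ (right-hand map $x_1\mapsto x$, $x_2\mapsto 0$), into pullbacks which are preserved by all powers $T^n$. The natural maps $p:TM\to M$, $0:M\to TM$, $+:T_2M=T_{W^2}M\to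 TM$, $\ell:TM\to T^2M$ are induced by $x\mapsto 0$, $\mathbb N\to W$, $x,y\mapsto x$, $x\mapsto x_1x_2$. A *differential bundle* $E=(E,M,q,\zeta,\sigma,\lambda)$ in $\mathbb X$ consists of $q:E\to M$ having all finite pullback powers $E_n$ over $M$ (so $E_0=M$, $E_1=E$), preserved by all $T^k$; $\zeta:M\to E$ and $\sigma:E_2\to E$ over $M$ making $q$ an associative, commutative, unital additive bundle; and $\lambda:E\to TE$ such that $(\lambda,0)$ is an additive bundle morphism to $(TE,TM,Tq,T\sigma,T\zeta)$, $(\lambda,\zeta)$ is an additive bundle morphism to $(TE,E,p,+,0)$, $\ell_E\circ\lambda=T(\lambda)\circ\lambda$, and the square $$\begin{array}{ccc} E_2 & \xrightarrow{\ T(\sigma)\circ\langle\lambda\circ\pi_0,\,0\circ\pi_1\rangle\ } & TE\\ {\scriptstyle q\circ\pi_0}\downarrow & & \downarrow{\scriptstyle T(q)}\\ M&\xrightarrow{\ 0\ }& TM\end{array}$$ is a pullback preserved by all powers $T^n$. A *morphism* $(f,g):E\to E'$ is a pair $f:E\to E'$, $g:M\to M'$ with $q'f=gq$; it is *additive* if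 $f\sigma=\sigma'f_2$ and $f\zeta=\zeta'g$, and *linear* if $\lambda'f=T(f)\lambda$. $\mathrm{DBun}_{\mathrm{add}}(\mathbb X)$ and $\mathrm{DBun}_{\mathrm{lin}}(\mathbb X)$ are the categories of differential bundles with additive, respectively linear, morphisms. $\mathbb N^\bullet$ is the category with objects $\mathbb N^k$, $k\ge 0$, and morphisms $\mathbb N^m\to\mathbb N^n$ the $n\times m$ matrices over $\mathbb N$; $\mathrm{Weil}$ acts on it by $D_A(\mathbb N^k)=\underline A\otimes\mathbb N^k$, where $\underline A$ is the underlying additive monoid of $A$, free on the nonzero monomials. For a differential bundle $E$ the functor $F_E:\mathbb N^\bullet\to\mathbb X$ is given by $F_E(\mathbb N^k)=E_k$ and $F_E\big((a_{ij})\big)=\big\langle\sum_j a_{ij}\cdot\pi_j\big\rangle_i$, where sums are taken in the commutative monoids of morphisms into $E$ over $M$ defined by $\sigma$ and $\zeta$. A *lax differential functor* $\mathbb N^\bullet\to\mathbb X$ is an oplax $\mathrm{Weil}$-linear functor $(F,\hat\alpha)$, $\hat\alpha_{A,Y}:F(D_AY)\to T_AF(Y)$ (natural in $A$ and $Y$ and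 coherent with $\otimes$ and $\mathbb N$), such that for every Weil algebra $A$ the functor $T_A\circ F$ preserves pullbacks over the terminal object and all naturality squares of $\hat\alpha_{A,-}$ are pullbacks. $\mathrm{DiffFun}(\mathbb N^\bullet,\mathbb X)$ has these as objects and all natural transformations $\varphi:F\Rightarrow F'$ as morphisms; $\mathrm{DiffFun}_{\mathrm{lin}}(\mathbb N^\bullet,\mathbb X)$ has the same objects and the *linear* ones as morphisms, i.e. those with $T_A(\varphi_Y)\circ\hat\alpha_{A,Y}=\hat\alpha'_{A,Y}\circ\varphi_{D_AY}$ for all $A$, $Y$. **Theorem.** Let $\mathbb X$ be a tangent category. Every differential bundle $E$ in $\mathbb X$ has an induced lax differential functor $\mathrm{Ind}(E)=(F_E,\hat\alpha^E):\mathbb N^\bullet\to\mathbb X$ with $\hat\alpha^E_{W,\mathbb N^1}=T(\sigma)\circ\langle 0\circ\pi_0,\lambda\circ\pi_1\rangle:E_2\to TE$ and $\hat\alpha^E_{W,\mathbb N^0}=0:M\to TM$, and the following hold. (a) Every additive morphism $(f,g):E\to E'$ of differential bundles induces a natural transformation $\varphi:F_E\Rightarrow F_{E'}$ with components $\varphi_{\mathbb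 N^0}=g$ and $\varphi_{\mathbb N^k}=f_k:E_k\to E'_k$. (b) Every linear morphism of differential bundles is additive, and the natural transformation that it induces is linear with respect to $\hat\alpha^E$ and $\hat\alpha^{E'}$. (c) The assignments $E\mapsto\mathrm{Ind}(E)$, $(f,g)\mapsto\varphi$ define functors $$\mathrm{Ind}:\mathrm{DBun}_{\mathrm{add}}(\mathbb X)\to\mathrm{DiffFun}(\mathbb N^\bullet,\mathbb X),\qquad \mathrm{Ind}:\mathrm{DBun}_{\mathrm{lin}}(\mathbb X)\to\mathrm{DiffFun}_{\mathrm{lin}}(\mathbb N^\bullet,\mathbb X).$$ -/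

import Mathlib

open CategoryTheory MonoidalCategory MonoidalLeftAction Limits

universe v u v' u'

/-- A Weil algebra `ℕ[x₁, …, xₙ] / ⟨xᵢ xⱼ | i ∼ j⟩`, given by its finite set of generators and the
equivalence relation `∼` on it. As `∼` is reflexive, every generator squares to zero. -/
structure Weil : Type 1 where
  gen : Type
  fin : Finite gen
  rel : Setoid gen

namespace Weil

attribute [instance] Weil.fin

/-- The smallest semiring congruence on `ℕ[x₁, …, xₙ]` with `xᵢ xⱼ ≡ 0` for `i ∼ j`. -/
noncomputable def con (A : Weil) : RingCon (MvPolynomial A.gen ℕ) :=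
  ringConGen fun a b => ∃ i j, A.rel i j ∧ a = MvPolynomial.X i * MvPolynomial.X j ∧ b = 0

/-- The underlying commutative semiring of a Weil algebra. -/
abbrev Carrier (A : Weil) : Type := A.con.Quotient

/-- The generator `xᵢ`. -/
noncomputable def x (A : Weil) (i : A.gen) : A.Carrier := A.con.mk' (MvPolynomial.X i)

theorem x_mul_x (A : Weil) {i j : A.gen} (h : A.rel i j) : A.x i * A.x j = 0 := by
  have : A.con (MvPolynomial.X i * MvPolynomial.X j) 0 :=
    RingConGen.Rel.of _ _ ⟨i, j, h, rfl, rfl⟩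
  have h2 := (RingCon.eq A.con).2 this
  simpa [x] using h2

theorem ringHom_ext {A : Weil} {R : Type*} [Semiring R] {f g : A.Carrier →+* R}
    (h : ∀ i, f (A.x i) = g (A.x i)) : f = g := by
  have key : f.comp A.con.mk' = g.comp A.con.mk' :=
    MvPolynomial.ringHom_ext (fun r => by simp) h
  refine RingHom.ext fun a => ?_
  obtain ⟨p, rfl⟩ := RingCon.mk'_surjective A.con a
  exact DFunLike.congr_fun key p

theorem con_le (A : Weil) {R : Type*} [CommSemiring R] (f : MvPolynomial A.gen ℕ →+* R)
    (hf : ∀ i j, A.rel i j → f (MvPolynomial.X i) * f (MvPolynomial.X j) = 0) :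
    A.con ≤ RingCon.ker f := by
  refine RingCon.ringConGen_le.2 ?_
  rintro a b ⟨i, j, hij, rfl, rfl⟩
  simp [RingCon.ker_apply, hf i j hij]

/-- A semiring homomorphism out of a Weil algebra is given by the images of the generators. -/
noncomputable def liftHom (A : Weil) {R : Type*} [CommSemiring R] (f : A.gen → R)
    (hf : ∀ i j, A.rel i j → f i * f j = 0) : A.Carrier →+* R :=
  A.con.lift (MvPolynomial.eval₂Hom (Nat.castRingHom R) f)
    (A.con_le _ (fun i j h => by simpa using hf i j h))

@[simp] theorem liftHom_x (A : Weil) {R : Type*} [CommSemiring R] (f : A.gen → R)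
    (hf : ∀ i j, A.rel i j → f i * f j = 0) (i : A.gen) : A.liftHom f hf (A.x i) = f i :=
  (RingCon.lift_mk' _ _).trans (by simp)

/-- A morphism of Weil algebras is a unital semiring homomorphism. -/
@[ext] structure Hom (A B : Weil) where
  hom : A.Carrier →+* B.Carrier

noncomputable instance : Category Weil where
  Hom := Hom
  id A := ⟨RingHom.id _⟩
  comp f g := ⟨g.hom.comp f.hom⟩

@[simp] theorem id_hom (A : Weil) : (𝟙 A : A ⟶ A).hom = RingHom.id _ := rfl
@[simp] theorem comp_hom {A B C : Weil} (f : A ⟶ B) (g : B ⟶ C) :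
    (f ≫ g).hom = g.hom.comp f.hom := rfl

theorem hom_ext {A B : Weil} {f g : A ⟶ B} (h : ∀ i, f.hom (A.x i) = g.hom (A.x i)) : f = g :=
  Hom.ext (ringHom_ext h)

/-- The morphism of Weil algebras with prescribed images of the generators. -/
noncomputable def desc {A B : Weil} (f : A.gen → B.Carrier)
    (hf : ∀ i j, A.rel i j → f i * f j = 0) : A ⟶ B := ⟨A.liftHom f hf⟩

@[simp] theorem desc_x {A B : Weil} (f : A.gen → B.Carrier)
    (hf : ∀ i j, A.rel i j → f i * f j = 0) (i : A.gen) : (desc f hf).hom (A.x i) = f i :=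
  liftHom_x A f hf i

/-! ### The coproduct of Weil algebras as a monoidal structure -/

/-- The Weil algebra `ℕ`. -/
def unit : Weil := ⟨Empty, inferInstance, ⊥⟩

/-- The coproduct `A ⊗ B`: generators of `A` and of `B`, with the relations of `A` and of `B`. -/
def tensor (A B : Weil) : Weil where
  gen := A.gen ⊕ B.gen
  fin := inferInstance
  rel :=
    { r := Sum.LiftRel A.rel B.rel
      iseqv :=
        { refl := by rintro (i | i) <;> constructor <;> exact Setoid.refl' _ _
          symm := by rintro _ _ (h | h) <;> constructor <;> exact Setoid.symm' _ h
          trans := by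
            rintro _ _ _ (h | h) h' <;> cases h' <;> constructor <;>
              exact Setoid.trans' _ ‹_› ‹_› } }

noncomputable def inl (A B : Weil) : A ⟶ tensor A B :=
  desc (fun i => (tensor A B).x (Sum.inl i))
    (fun _ _ h => x_mul_x (tensor A B) (Sum.LiftRel.inl h))

noncomputable def inr (A B : Weil) : B ⟶ tensor A B :=
  desc (fun i => (tensor A B).x (Sum.inr i))
    (fun _ _ h => x_mul_x (tensor A B) (Sum.LiftRel.inr h))

@[simp] theorem inl_x (A B : Weil) (i : A.gen) :
    (inl A B).hom (A.x i) = (tensor A B).x (Sum.inl i) := desc_x _ _ _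
@[simp] theorem inr_x (A B : Weil) (i : B.gen) :
    (inr A B).hom (B.x i) = (tensor A B).x (Sum.inr i) := desc_x _ _ _

/-- The universal property of the coproduct. -/
noncomputable def codesc {A B C : Weil} (f : A ⟶ C) (g : B ⟶ C) : tensor A B ⟶ C :=
  desc (Sum.elim (fun i => f.hom (A.x i)) (fun i => g.hom (B.x i))) (by
    rintro _ _ (h | h)
    · simp [← map_mul, x_mul_x _ h]
    · simp [← map_mul, x_mul_x _ h])

@[simp] theorem codesc_inl_x {A B C : Weil} (f : A ⟶ C) (g : B ⟶ C) (i : A.gen) :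
    (codesc f g).hom ((tensor A B).x (Sum.inl i)) = f.hom (A.x i) :=
  desc_x (A := tensor A B) _ _ _
@[simp] theorem codesc_inr_x {A B C : Weil} (f : A ⟶ C) (g : B ⟶ C) (i : B.gen) :
    (codesc f g).hom ((tensor A B).x (Sum.inr i)) = g.hom (B.x i) :=
  desc_x (A := tensor A B) _ _ _

@[simp] theorem inl_codesc {A B C : Weil} (f : A ⟶ C) (g : B ⟶ C) :
    inl A B ≫ codesc f g = f :=
  hom_ext (fun i => by
    rw [comp_hom, RingHom.comp_apply, inl_x]
    exact codesc_inl_x f g i)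
@[simp] theorem inr_codesc {A B C : Weil} (f : A ⟶ C) (g : B ⟶ C) :
    inr A B ≫ codesc f g = g :=
  hom_ext (fun i => by
    rw [comp_hom, RingHom.comp_apply, inr_x]
    exact codesc_inr_x f g i)

@[simp] theorem inl_codesc_assoc {A B C D : Weil} (f : A ⟶ C) (g : B ⟶ C) (h : C ⟶ D) :
    inl A B ≫ codesc f g ≫ h = f ≫ h := by rw [← Category.assoc, inl_codesc]
@[simp] theorem inr_codesc_assoc {A B C D : Weil} (f : A ⟶ C) (g : B ⟶ C) (h : C ⟶ D) :
    inr A B ≫ codesc f g ≫ h = g ≫ h := by rw [← Category.assoc, inr_codesc]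

@[ext] theorem tensor_hom_ext {A B C : Weil} {f g : tensor A B ⟶ C}
    (hl : inl A B ≫ f = inl A B ≫ g) (hr : inr A B ≫ f = inr A B ≫ g) : f = g := by
  refine hom_ext ?_
  rintro (i | i)
  · have h := congrArg (fun k : A ⟶ C => k.hom (A.x i)) hl
    rw [comp_hom, comp_hom, RingHom.comp_apply, RingHom.comp_apply, inl_x] at h
    exact h
  · have h := congrArg (fun k : B ⟶ C => k.hom (B.x i)) hr
    rw [comp_hom, comp_hom, RingHom.comp_apply, RingHom.comp_apply, inr_x] at h
    exact h

/-- The unique morphism from `ℕ`. -/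
noncomputable def fromUnit (A : Weil) : unit ⟶ A := desc (fun i => i.elim) (fun i => i.elim)

@[ext] theorem unit_hom_ext {A : Weil} (f g : unit ⟶ A) : f = g := hom_ext (fun i => i.elim)

noncomputable def tensorMap {A A' B B' : Weil} (f : A ⟶ A') (g : B ⟶ B') :
    tensor A B ⟶ tensor A' B' := codesc (f ≫ inl A' B') (g ≫ inr A' B')

@[simp] theorem inl_tensorMap {A A' B B' : Weil} (f : A ⟶ A') (g : B ⟶ B') :
    inl A B ≫ tensorMap f g = f ≫ inl A' B' := inl_codesc _ _
@[simp] theorem inr_tensorMap {A A' B B' : Weil} (f : A ⟶ A') (g : B ⟶ B') :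
    inr A B ≫ tensorMap f g = g ≫ inr A' B' := inr_codesc _ _

@[simp] theorem inl_tensorMap_assoc {A A' B B' C : Weil} (f : A ⟶ A') (g : B ⟶ B')
    (h : tensor A' B' ⟶ C) : inl A B ≫ tensorMap f g ≫ h = f ≫ inl A' B' ≫ h := by
  rw [← Category.assoc, inl_tensorMap, Category.assoc]
@[simp] theorem inr_tensorMap_assoc {A A' B B' C : Weil} (f : A ⟶ A') (g : B ⟶ B')
    (h : tensor A' B' ⟶ C) : inr A B ≫ tensorMap f g ≫ h = g ≫ inr A' B' ≫ h := by
  rw [← Category.assoc, inr_tensorMap, Category.assoc]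

@[simps] noncomputable def assocIso (A B C : Weil) :
    tensor (tensor A B) C ≅ tensor A (tensor B C) where
  hom := codesc (codesc (inl _ _) (inl _ _ ≫ inr _ _)) (inr _ _ ≫ inr _ _)
  inv := codesc (inl _ _ ≫ inl _ _) (codesc (inr _ _ ≫ inl _ _) (inr _ _))
  hom_inv_id := by ext : 2 <;> simp
  inv_hom_id := by ext : 2 <;> simp

@[simps] noncomputable def leftIso (A : Weil) : tensor unit A ≅ A where
  hom := codesc (fromUnit A) (𝟙 A)
  inv := inr _ _
  hom_inv_id := by
    ext : 1
    · exact unit_hom_ext _ _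
    · simp
  inv_hom_id := by simp

@[simps] noncomputable def rightIso (A : Weil) : tensor A unit ≅ A where
  hom := codesc (𝟙 A) (fromUnit A)
  inv := inl _ _
  hom_inv_id := by
    ext : 1
    · simp
    · exact unit_hom_ext _ _
  inv_hom_id := by simp

theorem tensorMap_id (A B : Weil) : tensorMap (𝟙 A) (𝟙 B) = 𝟙 (tensor A B) := by
  ext : 1 <;> simp
theorem tensorMap_comp {A₁ B₁ C₁ A₂ B₂ C₂ : Weil} (f₁ : A₁ ⟶ B₁) (f₂ : A₂ ⟶ B₂)
    (g₁ : B₁ ⟶ C₁) (g₂ : B₂ ⟶ C₂) :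
    tensorMap f₁ f₂ ≫ tensorMap g₁ g₂ = tensorMap (f₁ ≫ g₁) (f₂ ≫ g₂) := by
  ext : 1 <;> simp
theorem assoc_nat {A₁ A₂ A₃ B₁ B₂ B₃ : Weil} (f₁ : A₁ ⟶ B₁) (f₂ : A₂ ⟶ B₂) (f₃ : A₃ ⟶ B₃) :
    tensorMap (tensorMap f₁ f₂) f₃ ≫ (assocIso B₁ B₂ B₃).hom =
      (assocIso A₁ A₂ A₃).hom ≫ tensorMap f₁ (tensorMap f₂ f₃) := by
  ext : 1
  · ext : 1 <;> simp
  · simp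
theorem left_nat {A B : Weil} (f : A ⟶ B) :
    tensorMap (𝟙 unit) f ≫ (leftIso B).hom = (leftIso A).hom ≫ f := by
  ext : 1
  · exact unit_hom_ext _ _
  · simp
theorem right_nat {A B : Weil} (f : A ⟶ B) :
    tensorMap f (𝟙 unit) ≫ (rightIso B).hom = (rightIso A).hom ≫ f := by
  ext : 1
  · simp
  · exact unit_hom_ext _ _
theorem pentagon_eq (A B C D : Weil) :
    tensorMap (assocIso A B C).hom (𝟙 D) ≫ (assocIso A (tensor B C) D).hom ≫
      tensorMap (𝟙 A) (assocIso B C D).hom =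
    (assocIso (tensor A B) C D).hom ≫ (assocIso A B (tensor C D)).hom := by
  ext : 1
  · ext : 1
    · ext : 1 <;> simp
    · simp
  · simp
theorem triangle_eq (A B : Weil) :
    (assocIso A unit B).hom ≫ tensorMap (𝟙 A) (leftIso B).hom =
      tensorMap (rightIso A).hom (𝟙 B) := by
  ext : 1
  · ext : 1
    · simp
    · exact unit_hom_ext _ _
  · simp

/-- The category of Weil algebras is monoidal under the coproduct. -/
noncomputable instance : MonoidalCategoryStruct Weil where
  tensorObj := tensor
  tensorHom := tensorMap
  whiskerLeft A _ _ f := tensorMap (𝟙 A) f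
  whiskerRight f B := tensorMap f (𝟙 B)
  tensorUnit := unit
  associator := assocIso
  leftUnitor := leftIso
  rightUnitor := rightIso

noncomputable instance : MonoidalCategory Weil :=
  MonoidalCategory.ofTensorHom
    (id_tensorHom_id := tensorMap_id)
    (id_tensorHom := fun _ _ _ _ => rfl)
    (tensorHom_id := fun _ _ => rfl)
    (tensorHom_comp_tensorHom := tensorMap_comp)
    (associator_naturality := assoc_nat)
    (leftUnitor_naturality := left_nat)
    (rightUnitor_naturality := right_nat)
    (pentagon := pentagon_eq)
    (triangle := triangle_eq)

end Weil

namespace Weil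

/-! ### The monomial basis of the underlying additive monoid of a Weil algebra -/

/-- The exponents of the nonzero monomials of a Weil algebra. -/
@[ext] structure Mon (A : Weil) : Type where
  exp : A.gen →₀ ℕ
  indep : ∀ i j, A.rel i j → ¬ (Finsupp.single i 1 + Finsupp.single j 1 ≤ exp)

noncomputable instance (A : Weil) : DecidableEq A.Mon := Classical.decEq _

theorem Mon.le_one {A : Weil} (s : A.Mon) (i : A.gen) : s.1 i ≤ 1 := by
  by_contra h
  refine s.2 i i (Setoid.refl' _ i) ?_
  rw [← Finsupp.single_add, Finsupp.single_le_iff]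
  omega

instance (A : Weil) : Finite A.Mon := by
  refine Finite.of_injective (β := A.gen → Fin 2)
    (fun s i => ⟨s.1 i, Nat.lt_succ_of_le (s.le_one i)⟩) ?_
  intro s t h
  refine Mon.ext (Finsupp.ext fun i => ?_)
  simpa using congrFun h i

noncomputable instance (A : Weil) : Fintype A.Mon := Fintype.ofFinite _

/-- The monomial with the given exponents. -/
noncomputable def mon (A : Weil) (s : A.Mon) : A.Carrier :=
  A.con.mk' (MvPolynomial.monomial s.1 1)

open Classical in
theorem con_coeff (A : Weil) (s : A.Mon) {p q : MvPolynomial A.gen ℕ} (h : A.con p q) :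
    p.coeff s.1 = q.coeff s.1 := by
  induction h generalizing s with
  | of a b hab =>
    obtain ⟨i, j, hij, rfl, rfl⟩ := hab
    have : (MvPolynomial.X i * MvPolynomial.X j : MvPolynomial A.gen ℕ) =
        MvPolynomial.monomial (Finsupp.single i 1 + Finsupp.single j 1) 1 := by
      simp [MvPolynomial.X, MvPolynomial.monomial_mul]
    rw [this, MvPolynomial.coeff_monomial, if_neg, MvPolynomial.coeff_zero]
    intro h
    exact s.2 i j hij h.le
  | refl a => rfl
  | symm _ ih => exact (ih s).symm
  | trans _ _ ih1 ih2 => exact (ih1 s).trans (ih2 s)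
  | add _ _ ih1 ih2 => simp [ih1 s, ih2 s]
  | mul _ _ ih1 ih2 =>
    rw [MvPolynomial.coeff_mul, MvPolynomial.coeff_mul]
    refine Finset.sum_congr rfl fun u hu => ?_
    replace hu := Finset.HasAntidiagonal.mem_antidiagonal.1 hu
    have h1 : ∀ i j, A.rel i j → ¬ (Finsupp.single i 1 + Finsupp.single j 1 ≤ u.1) :=
      fun i j hij hle => s.2 i j hij (hle.trans (hu ▸ le_self_add))
    have h2 : ∀ i j, A.rel i j → ¬ (Finsupp.single i 1 + Finsupp.single j 1 ≤ u.2) :=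
      fun i j hij hle => s.2 i j hij (hle.trans (hu ▸ le_add_self))
    rw [ih1 ⟨u.1, h1⟩, ih2 ⟨u.2, h2⟩]

/-- The coefficient of a monomial. -/
noncomputable def coeff (A : Weil) (s : A.Mon) : A.Carrier →+ ℕ where
  toFun a := Quotient.liftOn' a (fun p => p.coeff s.1) (fun _ _ h => A.con_coeff s h)
  map_zero' := MvPolynomial.coeff_zero _
  map_add' a b := by
    obtain ⟨p, rfl⟩ := RingCon.mk'_surjective A.con a
    obtain ⟨q, rfl⟩ := RingCon.mk'_surjective A.con b
    exact MvPolynomial.coeff_add _ _ _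

theorem coeff_mk (A : Weil) (s : A.Mon) (p : MvPolynomial A.gen ℕ) :
    A.coeff s (A.con.mk' p) = p.coeff s.1 := rfl

theorem coeff_mon (A : Weil) (s t : A.Mon) : A.coeff s (A.mon t) = if s = t then 1 else 0 := by
  classical
  rw [mon, coeff_mk, MvPolynomial.coeff_monomial]
  refine if_congr ?_ rfl rfl
  rw [eq_comm]
  exact (Mon.ext_iff).symm

theorem mk_monomial_eq_zero (A : Weil) {d : A.gen →₀ ℕ} (n : ℕ)
    (h : ¬ ∀ i j, A.rel i j → ¬ (Finsupp.single i 1 + Finsupp.single j 1 ≤ d)) :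
    A.con.mk' (MvPolynomial.monomial d n) = 0 := by
  push Not at h
  obtain ⟨i, j, hij, e, rfl⟩ := by simpa only [le_iff_exists_add] using h
  have : MvPolynomial.monomial (Finsupp.single i 1 + Finsupp.single j 1 + e) n =
      MvPolynomial.X i * MvPolynomial.X j * MvPolynomial.monomial e n := by
    simp [MvPolynomial.X, MvPolynomial.monomial_mul]
  rw [this, map_mul, map_mul]
  have h2 := A.x_mul_x hij
  rw [x, x] at h2
  rw [h2, zero_mul]

theorem sum_coeff_mon (A : Weil) (a : A.Carrier) : ∑ s, A.coeff s a • A.mon s = a := by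
  obtain ⟨p, rfl⟩ := RingCon.mk'_surjective A.con a
  induction p using MvPolynomial.induction_on' with
  | monomial d n =>
    by_cases h : ∀ i j, A.rel i j → ¬ (Finsupp.single i 1 + Finsupp.single j 1 ≤ d)
    · have : A.con.mk' (MvPolynomial.monomial d n) = n • A.mon ⟨d, h⟩ := by
        rw [mon, ← map_nsmul, MvPolynomial.smul_monomial]; simp
      rw [this]
      simp only [map_nsmul, coeff_mon, smul_eq_mul, mul_ite, mul_one, mul_zero, ite_smul, zero_smul]
      simp only [Finset.sum_ite_eq', Finset.mem_univ, if_true]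
    · rw [A.mk_monomial_eq_zero n h]; simp
  | add p q hp hq =>
    rw [map_add]
    simp only [map_add, add_smul, Finset.sum_add_distrib]
    rw [hp, hq]

/-- The matrix of a morphism of Weil algebras in the bases of monomials. -/
noncomputable def mat {A B : Weil} (θ : A ⟶ B) : Matrix B.Mon A.Mon ℕ :=
  Matrix.of fun t s => B.coeff t (θ.hom (A.mon s))

theorem mat_apply {A B : Weil} (θ : A ⟶ B) (t : B.Mon) (s : A.Mon) :
    mat θ t s = B.coeff t (θ.hom (A.mon s)) := rfl

theorem mat_id (A : Weil) : mat (𝟙 A) = 1 := by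
  ext s t
  simp [mat_apply, coeff_mon, Matrix.one_apply]

theorem mat_comp {A B C : Weil} (θ : A ⟶ B) (ψ : B ⟶ C) : mat (θ ≫ ψ) = mat ψ * mat θ := by
  ext u s
  rw [Matrix.mul_apply, mat_apply, comp_hom, RingHom.comp_apply]
  conv_lhs => rw [← B.sum_coeff_mon (θ.hom (A.mon s))]
  rw [map_sum, map_sum]
  refine Finset.sum_congr rfl fun t _ => ?_
  rw [map_nsmul, map_nsmul, smul_eq_mul, mul_comm]
  rfl

theorem single_inl_le {α β : Type} (i j : α) (d : α ⊕ β →₀ ℕ) :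
    Finsupp.single (Sum.inl i) 1 + Finsupp.single (Sum.inl j) 1 ≤ d ↔
      Finsupp.single i 1 + Finsupp.single j 1 ≤ (Finsupp.sumFinsuppEquivProdFinsupp d).1 := by
  classical
  rw [Finsupp.le_def, Finsupp.le_def]
  constructor
  · intro h k
    simpa [Finsupp.single_apply] using h (Sum.inl k)
  · rintro h (k | k)
    · simpa [Finsupp.single_apply] using h k
    · simp

theorem single_inr_le {α β : Type} (i j : β) (d : α ⊕ β →₀ ℕ) :
    Finsupp.single (Sum.inr i) 1 + Finsupp.single (Sum.inr j) 1 ≤ d ↔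
      Finsupp.single i 1 + Finsupp.single j 1 ≤ (Finsupp.sumFinsuppEquivProdFinsupp d).2 := by
  classical
  rw [Finsupp.le_def, Finsupp.le_def]
  constructor
  · intro h k
    simpa [Finsupp.single_apply] using h (Sum.inr k)
  · rintro h (k | k)
    · simp
    · simpa [Finsupp.single_apply] using h k

/-- The monomials of a coproduct are the pairs of monomials. -/
noncomputable def monTensor (A B : Weil) : (A ⊗ B).Mon ≃ A.Mon × B.Mon where
  toFun d :=
    (⟨(Finsupp.sumFinsuppEquivProdFinsupp d.1).1, fun i j h hle =>
        d.2 (Sum.inl i) (Sum.inl j) (Sum.LiftRel.inl h) ((single_inl_le i j d.1).2 hle)⟩,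
      ⟨(Finsupp.sumFinsuppEquivProdFinsupp d.1).2, fun i j h hle =>
        d.2 (Sum.inr i) (Sum.inr j) (Sum.LiftRel.inr h) ((single_inr_le i j d.1).2 hle)⟩)
  invFun p :=
    ⟨Finsupp.sumFinsuppEquivProdFinsupp.symm (p.1.1, p.2.1), by
      have e := Finsupp.sumFinsuppEquivProdFinsupp.apply_symm_apply (p.1.1, p.2.1)
      rintro _ _ (h | h) hle
      · have h2 := (single_inl_le _ _ _).1 hle
        rw [e] at h2
        exact p.1.2 _ _ h h2
      · have h2 := (single_inr_le _ _ _).1 hle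
        rw [e] at h2
        exact p.2.2 _ _ h h2⟩
  left_inv d := Mon.ext (Finsupp.sumFinsuppEquivProdFinsupp.symm_apply_apply d.1)
  right_inv p := by
    have h := Finsupp.sumFinsuppEquivProdFinsupp.apply_symm_apply (p.1.1, p.2.1)
    exact Prod.ext (Mon.ext (congrArg Prod.fst h)) (Mon.ext (congrArg Prod.snd h))

/-- The generators of the coproduct. -/
def genL (A B : Weil) (i : A.gen) : (tensor A B).gen := Sum.inl i
def genR (A B : Weil) (i : B.gen) : (tensor A B).gen := Sum.inr i
theorem genL_injective (A B : Weil) : Function.Injective (genL A B) := Sum.inl_injective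
theorem genR_injective (A B : Weil) : Function.Injective (genR A B) := Sum.inr_injective

theorem inl_mk (A B : Weil) (p : MvPolynomial A.gen ℕ) :
    (inl A B).hom (A.con.mk' p) = (tensor A B).con.mk' (MvPolynomial.rename (genL A B) p) := by
  have : (inl A B).hom.comp A.con.mk' = (tensor A B).con.mk'.comp
      (MvPolynomial.rename (R := ℕ) (genL A B)).toRingHom := by
    refine MvPolynomial.ringHom_ext (fun r => by simp) (fun i => ?_)
    refine (inl_x A B i).trans ?_
    rw [RingHom.comp_apply]
    refine congrArg (tensor A B).con.mk' ?_
    exact (MvPolynomial.rename_X _ _).symm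
  exact DFunLike.congr_fun this p

theorem inr_mk (A B : Weil) (p : MvPolynomial B.gen ℕ) :
    (inr A B).hom (B.con.mk' p) = (tensor A B).con.mk' (MvPolynomial.rename (genR A B) p) := by
  have : (inr A B).hom.comp B.con.mk' = (tensor A B).con.mk'.comp
      (MvPolynomial.rename (R := ℕ) (genR A B)).toRingHom := by
    refine MvPolynomial.ringHom_ext (fun r => by simp) (fun i => ?_)
    refine (inr_x A B i).trans ?_
    rw [RingHom.comp_apply]
    refine congrArg (tensor A B).con.mk' ?_
    exact (MvPolynomial.rename_X _ _).symm
  exact DFunLike.congr_fun this p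

theorem inl_mul_inr (A B : Weil) (s : A.Mon) (t : B.Mon) :
    (inl A B).hom (A.mon s) * (inr A B).hom (B.mon t) =
      (tensor A B).mon ((monTensor A B).symm (s, t)) := by
  have h : MvPolynomial.rename (genL A B) (MvPolynomial.monomial s.exp (1 : ℕ)) *
      MvPolynomial.rename (genR A B) (MvPolynomial.monomial t.exp (1 : ℕ)) =
      MvPolynomial.monomial ((monTensor A B).symm (s, t)).exp 1 := by
    rw [MvPolynomial.rename_monomial, MvPolynomial.rename_monomial, MvPolynomial.monomial_mul,
      one_mul]
    refine congrArg (fun d => MvPolynomial.monomial d 1) (Finsupp.ext ?_)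
    rintro (i | i)
    · refine (Finsupp.add_apply _ _ _).trans ?_
      refine (congrArg₂ (· + ·) (Finsupp.mapDomain_apply (genL_injective A B) s.exp i)
        (Finsupp.mapDomain_of_notMem_range t.exp (Sum.inl i) ?_)).trans rfl
      rintro ⟨j, hj⟩
      cases hj
    · refine (Finsupp.add_apply _ _ _).trans ?_
      refine (congrArg₂ (· + ·) (Finsupp.mapDomain_of_notMem_range s.exp (Sum.inr i) ?_)
        (Finsupp.mapDomain_apply (genR_injective A B) t.exp i)).trans (zero_add _)
      rintro ⟨j, hj⟩
      cases hj
  rw [mon, mon, inl_mk, inr_mk, mon, ← h, map_mul]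

theorem coeff_inl_mul_inr (A B : Weil) (a : A.Carrier) (b : B.Carrier) (d : (tensor A B).Mon) :
    (tensor A B).coeff d ((inl A B).hom a * (inr A B).hom b) =
      A.coeff (monTensor A B d).1 a * B.coeff (monTensor A B d).2 b := by
  conv_lhs => rw [← A.sum_coeff_mon a, ← B.sum_coeff_mon b]
  rw [map_sum, map_sum, Finset.sum_mul_sum, map_sum, Finset.sum_eq_single (monTensor A B d).1]
  · rw [map_sum, Finset.sum_eq_single (monTensor A B d).2]
    · rw [map_nsmul, map_nsmul, smul_mul_smul_comm, map_nsmul, inl_mul_inr, coeff_mon, if_pos]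
      · simp
      · exact ((monTensor A B).symm_apply_apply d).symm
    · intro t _ ht
      rw [map_nsmul, map_nsmul, smul_mul_smul_comm, map_nsmul, inl_mul_inr, coeff_mon, if_neg,
        smul_zero]
      intro h
      rw [Equiv.eq_symm_apply] at h
      exact ht (congrArg Prod.snd h).symm
    · simp
  · intro s _ hs
    rw [map_sum]
    refine Finset.sum_eq_zero fun t _ => ?_
    rw [map_nsmul, map_nsmul, smul_mul_smul_comm, map_nsmul, inl_mul_inr, coeff_mon, if_neg,
      smul_zero]
    intro h
    rw [Equiv.eq_symm_apply] at h
    exact hs (congrArg Prod.fst h).symm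
  · simp

theorem mat_tensorHom {A A' B B' : Weil} (f : A ⟶ A') (g : B ⟶ B') :
    mat (tensorMap f g) =
      (Matrix.kronecker (mat f) (mat g)).submatrix (monTensor A' B') (monTensor A B) := by
  ext d e
  obtain ⟨⟨s, t⟩, rfl⟩ := (monTensor A B).symm.surjective e
  have h1 := congrArg (fun k => k.hom (A.mon s)) (inl_tensorMap f g)
  have h2 := congrArg (fun k => k.hom (B.mon t)) (inr_tensorMap f g)
  simp only [comp_hom, RingHom.comp_apply] at h1 h2
  refine (congrArg (fun z => (tensor A' B').coeff d ((tensorMap f g).hom z))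
    (inl_mul_inr A B s t).symm).trans ?_
  simp only [map_mul, h1, h2, coeff_inl_mul_inr]
  simp [mat_apply, Matrix.kronecker, Matrix.kroneckerMap]

/-- A morphism that permutes monomials has a permutation matrix. -/
theorem mat_of_mon {A B : Weil} (f : A ⟶ B) (e : A.Mon ≃ B.Mon)
    (h : ∀ s, f.hom (A.mon s) = B.mon (e s)) : mat f = (1 : Matrix B.Mon B.Mon ℕ).submatrix id e := by
  ext t s
  simp [mat_apply, h, coeff_mon, Matrix.one_apply]

theorem mat_assoc (A B C : Weil) : mat (assocIso A B C).hom =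
    (1 : Matrix (A ⊗ (B ⊗ C)).Mon (A ⊗ (B ⊗ C)).Mon ℕ).submatrix id
      (((monTensor (A ⊗ B) C).trans ((Equiv.prodCongr (monTensor A B) (Equiv.refl _)).trans
        ((Equiv.prodAssoc _ _ _).trans
          (Equiv.prodCongr (Equiv.refl _) (monTensor B C).symm)))).trans
        (monTensor A (B ⊗ C)).symm) := by
  refine mat_of_mon _ _ fun s => ?_
  obtain ⟨⟨s, c⟩, rfl⟩ := (monTensor (A ⊗ B) C).symm.surjective s
  obtain ⟨⟨a, b⟩, rfl⟩ := (monTensor A B).symm.surjective s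
  simp only [Equiv.trans_apply, Equiv.apply_symm_apply, Equiv.prodCongr_apply, Prod.map,
    Equiv.coe_refl, id, Equiv.prodAssoc_apply]
  have e1 := inl_mul_inr (tensor A B) C ((monTensor A B).symm (a, b)) c
  have e2 := inl_mul_inr A (tensor B C) a ((monTensor B C).symm (b, c))
  refine (congrArg _ e1.symm).trans (Eq.trans ?_ e2)
  rw [← inl_mul_inr, ← inl_mul_inr]
  have h1 : inl A B ≫ inl (tensor A B) C ≫ (assocIso A B C).hom = inl _ _ := by simp
  have h2 : inr A B ≫ inl (tensor A B) C ≫ (assocIso A B C).hom = inl _ _ ≫ inr _ _ := by simp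
  have h3 : inr (tensor A B) C ≫ (assocIso A B C).hom = inr _ _ ≫ inr _ _ := by simp
  have h1' := congrArg (fun k => k.hom (A.mon a)) h1
  have h2' := congrArg (fun k => k.hom (B.mon b)) h2
  have h3' := congrArg (fun k => k.hom (C.mon c)) h3
  simp only [comp_hom, RingHom.comp_apply] at h1' h2' h3'
  simp only [map_mul, h1', h2', h3', mul_assoc]

/-- The unit has the single monomial `1`. -/
noncomputable def monUnit : (𝟙_ Weil).Mon ≃ Unit where
  toFun _ := ()
  invFun _ := ⟨0, fun i => i.elim⟩
  left_inv _ := Mon.ext (Finsupp.ext fun i => i.elim)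
  right_inv _ := rfl

theorem mon_unit (s : unit.Mon) : unit.mon s = 1 := by
  have : s.1 = 0 := Finsupp.ext fun i => i.elim
  rw [mon, this]
  exact map_one _

theorem mat_left (A : Weil) : mat (leftIso A).hom =
    (1 : Matrix A.Mon A.Mon ℕ).submatrix id ((monTensor (𝟙_ Weil) A).trans
      ((Equiv.prodCongr monUnit (Equiv.refl _)).trans (Equiv.punitProd _))) := by
  refine mat_of_mon _ _ fun s => ?_
  obtain ⟨⟨s, a⟩, rfl⟩ := (monTensor (𝟙_ Weil) A).symm.surjective s
  simp only [Equiv.trans_apply, Equiv.apply_symm_apply, Equiv.prodCongr_apply, Prod.map,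
    Equiv.coe_refl, id, Equiv.punitProd_apply]
  refine (congrArg _ (inl_mul_inr unit A s a).symm).trans ?_
  have h := congrArg (fun k => k.hom (A.mon a)) (show inr unit A ≫ (leftIso A).hom = 𝟙 A by simp)
  simp only [comp_hom, RingHom.comp_apply] at h
  rw [map_mul, h, mon_unit, map_one, map_one, one_mul]
  rfl

theorem mat_right (A : Weil) : mat (rightIso A).hom =
    (1 : Matrix A.Mon A.Mon ℕ).submatrix id ((monTensor A (𝟙_ Weil)).trans
      ((Equiv.prodCongr (Equiv.refl _) monUnit).trans (Equiv.prodPUnit _))) := by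
  refine mat_of_mon _ _ fun s => ?_
  obtain ⟨⟨a, s⟩, rfl⟩ := (monTensor A (𝟙_ Weil)).symm.surjective s
  simp only [Equiv.trans_apply, Equiv.apply_symm_apply, Equiv.prodCongr_apply, Prod.map,
    Equiv.coe_refl, id, Equiv.prodPUnit_apply]
  refine (congrArg _ (inl_mul_inr A unit a s).symm).trans ?_
  have h := congrArg (fun k => k.hom (A.mon a)) (show inl A unit ≫ (rightIso A).hom = 𝟙 A by simp)
  simp only [comp_hom, RingHom.comp_apply] at h
  rw [map_mul, h, mon_unit, map_one, map_one, mul_one]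
  rfl

end Weil

/-! ### The category of finitely generated free commutative monoids -/

/-- The category with objects the monoids `ℕᵏ` and with matrices as morphisms. -/
structure NBullet : Type where
  dim : ℕ

namespace NBullet

/-- A morphism `ℕᵐ ⟶ ℕⁿ` is an `n × m` matrix. -/
@[ext] structure Hom (m n : NBullet) where
  mat : Matrix (Fin n.dim) (Fin m.dim) ℕ

instance : Category NBullet where
  Hom := Hom
  id _ := ⟨1⟩
  comp f g := ⟨g.mat * f.mat⟩
  id_comp f := Hom.ext (Matrix.mul_one f.mat)
  comp_id f := Hom.ext (Matrix.one_mul f.mat)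
  assoc f g h := Hom.ext (Matrix.mul_assoc h.mat g.mat f.mat).symm

@[simp] theorem id_mat (m : NBullet) : (𝟙 m : m ⟶ m).mat = 1 := rfl
@[simp] theorem comp_mat {l m n : NBullet} (f : l ⟶ m) (g : m ⟶ n) :
    (f ≫ g).mat = g.mat * f.mat := rfl

theorem hom_ext {m n : NBullet} {f g : m ⟶ n} (h : f.mat = g.mat) : f = g := Hom.ext h

/-- The isomorphism permuting the standard basis. -/
def perm {m n : NBullet} (e : Fin m.dim ≃ Fin n.dim) : m ≅ n where
  hom := ⟨(1 : Matrix _ _ ℕ).submatrix id e⟩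
  inv := ⟨(1 : Matrix _ _ ℕ).submatrix id e.symm⟩
  hom_inv_id := hom_ext (by ext i j; simp [Matrix.mul_apply, Matrix.one_apply])
  inv_hom_id := hom_ext (by ext i j; simp [Matrix.mul_apply, Matrix.one_apply])

theorem perm_hom_mat {m n : NBullet} (e : Fin m.dim ≃ Fin n.dim) :
    (perm e).hom.mat = (1 : Matrix _ _ ℕ).submatrix id e := rfl

theorem comp_perm_mat {l m n : NBullet} (f : l ⟶ m) (e : Fin m.dim ≃ Fin n.dim) :
    (f ≫ (perm e).hom).mat = f.mat.submatrix e.symm id := by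
  ext i j
  rw [comp_mat, perm_hom_mat, Matrix.mul_apply, Finset.sum_eq_single (e.symm i)]
  · rw [Matrix.submatrix_apply, id, e.apply_symm_apply, Matrix.one_apply_eq, one_mul]
    rfl
  · intro k _ hk
    rw [Matrix.submatrix_apply, Matrix.one_apply_ne, zero_mul]
    rintro h
    exact hk (e.injective (by simpa using h.symm))
  · simp

theorem perm_comp_mat {l m n : NBullet} (f : m ⟶ n) (e : Fin l.dim ≃ Fin m.dim) :
    ((perm e).hom ≫ f).mat = f.mat.submatrix id e := by
  ext i j
  rw [comp_mat, perm_hom_mat, Matrix.mul_apply, Finset.sum_eq_single (e j)]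
  · rw [Matrix.submatrix_apply, id, Matrix.one_apply_eq, mul_one]
    rfl
  · intro k _ hk
    rw [Matrix.submatrix_apply, Matrix.one_apply_ne, mul_zero]
    exact hk
  · simp

theorem perm_comp_perm {l m n : NBullet} (e : Fin l.dim ≃ Fin m.dim) (e' : Fin m.dim ≃ Fin n.dim) :
    (perm e).hom ≫ (perm e').hom = (perm (e.trans e')).hom :=
  hom_ext (by rw [perm_comp_mat]; rfl)

/-- The tensor product of the underlying monoid of a Weil algebra with `ℕᵏ`. -/
noncomputable def act (A : Weil) (k : NBullet) : NBullet := ⟨Nat.card A.Mon * k.dim⟩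

/-- The basis of `act A k` consists of the pairs of a monomial of `A` and a basis vector. -/
noncomputable def idx (A : Weil) (k : NBullet) : A.Mon × Fin k.dim ≃ Fin (act A k).dim :=
  (Equiv.prodCongr (Finite.equivFin A.Mon) (Equiv.refl _)).trans finProdFinEquiv

/-- The tensor product of a morphism of Weil algebras with a matrix. -/
noncomputable def actHom {A B : Weil} {k l : NBullet} (θ : A ⟶ B) (f : k ⟶ l) :
    act A k ⟶ act B l :=
  ⟨(Matrix.kronecker (Weil.mat θ) f.mat).submatrix (idx B l).symm (idx A k).symm⟩

theorem actHom_mat {A B : Weil} {k l : NBullet} (θ : A ⟶ B) (f : k ⟶ l) :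
    (actHom θ f).mat =
      (Matrix.kronecker (Weil.mat θ) f.mat).submatrix (idx B l).symm (idx A k).symm := rfl

theorem actHom_id (A : Weil) (k : NBullet) : actHom (𝟙 A) (𝟙 k) = 𝟙 (act A k) := by
  refine hom_ext ?_
  rw [actHom_mat, Weil.mat_id, id_mat]
  exact (congrArg (fun M => Matrix.submatrix M _ _) Matrix.one_kronecker_one).trans
    (Matrix.submatrix_one_equiv _)

theorem actHom_comp {A B C : Weil} {k l m : NBullet} (θ : A ⟶ B) (ψ : B ⟶ C) (f : k ⟶ l)
    (g : l ⟶ m) : actHom (θ ≫ ψ) (f ≫ g) = actHom θ f ≫ actHom ψ g := by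
  refine hom_ext ?_
  rw [comp_mat, actHom_mat, actHom_mat, actHom_mat, Weil.mat_comp, comp_mat,
    Matrix.submatrix_mul_equiv]
  exact congrArg (fun M => Matrix.submatrix M _ _) (Matrix.mul_kronecker_mul _ _ _ _)

/-- The basis of the tensor product with a coproduct of Weil algebras. -/
noncomputable def assocEquiv (A B : Weil) (k : NBullet) :
    Fin (act (A ⊗ B) k).dim ≃ Fin (act A (act B k)).dim :=
  (idx (A ⊗ B) k).symm.trans <| (Equiv.prodCongr (Weil.monTensor A B) (Equiv.refl _)).trans <|
    (Equiv.prodAssoc _ _ _).trans <| (Equiv.prodCongr (Equiv.refl _) (idx B k)).trans <|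
      idx A (act B k)

noncomputable def unitEquiv (k : NBullet) : Fin (act (𝟙_ Weil) k).dim ≃ Fin k.dim :=
  (idx (𝟙_ Weil) k).symm.trans <| (Equiv.prodCongr Weil.monUnit (Equiv.refl _)).trans <|
    Equiv.punitProd _

theorem actHom_perm {A : Weil} {k l : NBullet} (e : Fin k.dim ≃ Fin l.dim) :
    actHom (𝟙 A) (perm e).hom = (perm ((idx A k).symm.trans
      ((Equiv.prodCongr (Equiv.refl _) e).trans (idx A l)))).hom := by
  refine hom_ext ?_
  rw [actHom_mat, Weil.mat_id, perm_hom_mat, perm_hom_mat]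
  ext i j
  obtain ⟨i, rfl⟩ := (idx A l).surjective i
  obtain ⟨j, rfl⟩ := (idx A k).surjective j
  simp [Matrix.kronecker, Matrix.kroneckerMap, Matrix.one_apply, Prod.ext_iff, ← ite_and, and_comm]

theorem actHom_of_mon {A B : Weil} {k : NBullet} (θ : A ⟶ B) (e : A.Mon ≃ B.Mon)
    (h : Weil.mat θ = (1 : Matrix B.Mon B.Mon ℕ).submatrix id e) :
    actHom θ (𝟙 k) = (perm ((idx A k).symm.trans
      ((Equiv.prodCongr e (Equiv.refl _)).trans (idx B k)))).hom := by
  refine hom_ext ?_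
  rw [actHom_mat, h, perm_hom_mat, id_mat]
  ext i j
  obtain ⟨i, rfl⟩ := (idx B k).surjective i
  obtain ⟨j, rfl⟩ := (idx A k).surjective j
  simp [Matrix.kronecker, Matrix.kroneckerMap, Matrix.one_apply, Prod.ext_iff, ← ite_and, and_comm]

theorem mat_tensor {A A' B B' : Weil} (f : A ⟶ A') (g : B ⟶ B') :
    Weil.mat (f ⊗ₘ g) = (Matrix.kronecker (Weil.mat f) (Weil.mat g)).submatrix
      (Weil.monTensor A' B') (Weil.monTensor A B) := Weil.mat_tensorHom f g

theorem assoc_natural {A A' B B' : Weil} {k k' : NBullet} (f : A ⟶ A') (g : B ⟶ B') (h : k ⟶ k') :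
    actHom (f ⊗ₘ g) h ≫ (perm (assocEquiv A' B' k')).hom =
      (perm (assocEquiv A B k)).hom ≫ actHom f (actHom g h) := by
  refine hom_ext ?_
  rw [comp_perm_mat, perm_comp_mat, actHom_mat, actHom_mat, actHom_mat, mat_tensor]
  ext i j
  obtain ⟨⟨a, i⟩, rfl⟩ := (idx A' (act B' k')).surjective i
  obtain ⟨⟨b, i⟩, rfl⟩ := (idx B' k').surjective i
  obtain ⟨⟨j, l⟩, rfl⟩ := (idx (A ⊗ B) k).surjective j
  obtain ⟨⟨c, d⟩, rfl⟩ := (Weil.monTensor A B).symm.surjective j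
  simp [Matrix.kronecker, Matrix.kroneckerMap, assocEquiv, mul_assoc]

theorem unit_natural {k k' : NBullet} (f : k ⟶ k') :
    (perm (unitEquiv k)).hom ≫ f = actHom (𝟙 (𝟙_ Weil)) f ≫ (perm (unitEquiv k')).hom := by
  refine hom_ext ?_
  rw [comp_perm_mat, perm_comp_mat, actHom_mat, Weil.mat_id]
  ext i j
  obtain ⟨⟨j, l⟩, rfl⟩ := (idx (𝟙_ Weil) k).surjective j
  obtain ⟨u, rfl⟩ := Weil.monUnit.symm.surjective j
  simp [Matrix.kronecker, Matrix.kroneckerMap, unitEquiv]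

theorem perm_congr {m n : NBullet} {e e' : Fin m.dim ≃ Fin n.dim} (h : ∀ i, e i = e' i) :
    (perm e).hom = (perm e').hom := by rw [Equiv.ext h]

theorem whiskerLeft_act (A : Weil) {B C : Weil} (f : B ⟶ C) (k : NBullet) :
    actHom (A ◁ f) (𝟙 k) = (perm (assocEquiv A B k)).hom ≫
      actHom (𝟙 A) (actHom f (𝟙 k)) ≫ (perm (assocEquiv A C k)).inv := by
  rw [← Category.assoc, Iso.eq_comp_inv]
  exact assoc_natural (𝟙 A) f (𝟙 k)

theorem whiskerRight_act {A B : Weil} (C : Weil) (f : A ⟶ B) (k : NBullet) :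
    actHom (f ▷ C) (𝟙 k) = (perm (assocEquiv A C k)).hom ≫
      actHom f (𝟙 (act C k)) ≫ (perm (assocEquiv B C k)).inv := by
  rw [← Category.assoc, Iso.eq_comp_inv, ← actHom_id]
  exact assoc_natural f (𝟙 C) (𝟙 k)

theorem associator_act (A B C : Weil) (k : NBullet) :
    actHom (α_ A B C).hom (𝟙 k) ≫ (perm (assocEquiv A (B ⊗ C) k)).hom ≫
        actHom (𝟙 A) (perm (assocEquiv B C k)).hom =
      (perm (assocEquiv (A ⊗ B) C k)).hom ≫ (perm (assocEquiv A B (act C k))).hom := by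
  rw [actHom_of_mon (α_ A B C).hom _ (Weil.mat_assoc A B C), actHom_perm, perm_comp_perm,
    perm_comp_perm, perm_comp_perm]
  refine perm_congr fun i => ?_
  obtain ⟨⟨s, i⟩, rfl⟩ := (idx ((A ⊗ B) ⊗ C) k).surjective i
  obtain ⟨⟨s, c⟩, rfl⟩ := (Weil.monTensor (A ⊗ B) C).symm.surjective s
  obtain ⟨⟨a, b⟩, rfl⟩ := (Weil.monTensor A B).symm.surjective s
  simp [assocEquiv]

theorem leftUnitor_act (A : Weil) (k : NBullet) :
    actHom (λ_ A).hom (𝟙 k) =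
      (perm (assocEquiv (𝟙_ Weil) A k)).hom ≫ (perm (unitEquiv (act A k))).hom := by
  rw [actHom_of_mon (λ_ A).hom _ (Weil.mat_left A), perm_comp_perm]
  refine perm_congr fun i => ?_
  obtain ⟨⟨s, i⟩, rfl⟩ := (idx (𝟙_ Weil ⊗ A) k).surjective i
  obtain ⟨⟨u, a⟩, rfl⟩ := (Weil.monTensor (𝟙_ Weil) A).symm.surjective s
  simp [assocEquiv, unitEquiv]

theorem rightUnitor_act (A : Weil) (k : NBullet) :
    actHom (ρ_ A).hom (𝟙 k) =
      (perm (assocEquiv A (𝟙_ Weil) k)).hom ≫ actHom (𝟙 A) (perm (unitEquiv k)).hom := by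
  rw [actHom_of_mon (ρ_ A).hom _ (Weil.mat_right A), actHom_perm, perm_comp_perm]
  refine perm_congr fun i => ?_
  obtain ⟨⟨s, i⟩, rfl⟩ := (idx (A ⊗ 𝟙_ Weil) k).surjective i
  obtain ⟨⟨a, u⟩, rfl⟩ := (Weil.monTensor A (𝟙_ Weil)).symm.surjective s
  simp [assocEquiv, unitEquiv]

/-- Weil algebras act on the category of finitely generated free commutative monoids by tensoring
with the underlying monoid. -/
noncomputable instance : MonoidalLeftAction Weil NBullet where
  actionObj := act
  actionHom := actHom
  actionHomLeft θ k := actHom θ (𝟙 k)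
  actionHomRight A _ _ f := actHom (𝟙 A) f
  actionAssocIso A B k := perm (assocEquiv A B k)
  actionUnitIso k := perm (unitEquiv k)
  actionHom_def f g := by rw [← actHom_comp, Category.comp_id, Category.id_comp]
  actionHomRight_id := actHom_id
  id_actionHomLeft := actHom_id
  actionHom_comp _ _ _ _ := actHom_comp _ _ _ _
  actionAssocIso_hom_naturality f g h := assoc_natural f g h
  actionUnitIso_hom_naturality f := (unit_natural f)
  whiskerLeft_actionHomLeft := whiskerLeft_act
  whiskerRight_actionHomLeft := whiskerRight_act
  associator_actionHom := associator_act
  leftUnitor_actionHom := leftUnitor_act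
  rightUnitor_actionHom := rightUnitor_act

end NBullet

namespace Weil

/-! ### The structure morphisms of Weil algebras -/

/-- The Weil algebra `W^σ`: all products of two of the generators `xᵢ`, `i ∈ σ`, vanish. -/
def pow (σ : Type) [Finite σ] : Weil := ⟨σ, inferInstance, ⊤⟩

theorem pow_mul (σ : Type) [Finite σ] (i j : σ) : (pow σ).x i * (pow σ).x j = 0 :=
  x_mul_x (pow σ) (i := i) (j := j) trivial

/-- The dual numbers `W = ℕ[x]/(x²)`. -/
abbrev W : Weil := pow Unit

/-- The generator of `W`. -/
noncomputable def ex : W.Carrier := W.x ()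

theorem ex_mul_ex : ex * ex = 0 := pow_mul Unit () ()

/-- The augmentation `A ⟶ ℕ`, which sends the generators to zero. -/
noncomputable def aug (A : Weil) : A ⟶ 𝟙_ Weil := desc (fun _ => 0) (fun _ _ _ => zero_mul _)

/-- The unique morphism `0 : ℕ ⟶ A`. -/
noncomputable def zero (A : Weil) : 𝟙_ Weil ⟶ A := fromUnit A

/-- The projections `W^(σ ⊕ τ) ⟶ W^σ` and `W^(σ ⊕ τ) ⟶ W^τ`. -/
noncomputable def powFst (σ τ : Type) [Finite σ] [Finite τ] : pow (σ ⊕ τ) ⟶ pow σ :=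
  desc (Sum.elim (pow σ).x (fun _ => 0)) (by
    rintro (i | i) (j | j) _ <;>
      first | exact pow_mul _ i j | exact zero_mul _ | exact mul_zero _)
noncomputable def powSnd (σ τ : Type) [Finite σ] [Finite τ] : pow (σ ⊕ τ) ⟶ pow τ :=
  desc (Sum.elim (fun _ => 0) (pow τ).x) (by
    rintro (i | i) (j | j) _ <;>
      first | exact pow_mul _ i j | exact zero_mul _ | exact mul_zero _)

/-- The addition `W² ⟶ W`. -/
noncomputable def add : pow (Unit ⊕ Unit) ⟶ W :=
  desc (fun _ => ex) (fun _ _ _ => ex_mul_ex)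

/-- The two generators of `W ⊗ W`. -/
noncomputable def ex₁ : (W ⊗ W : Weil).Carrier := (inl W W).hom ex
noncomputable def ex₂ : (W ⊗ W : Weil).Carrier := (inr W W).hom ex

theorem ex₁_mul : ex₁ * ex₁ = 0 := by
  unfold ex₁; rw [← map_mul, ex_mul_ex, map_zero]
theorem ex₂_mul : ex₂ * ex₂ = 0 := by
  unfold ex₂; rw [← map_mul, ex_mul_ex, map_zero]

/-- The vertical lift `W ⟶ W ⊗ W`, `x ↦ x₁ x₂`. -/
noncomputable def ell : W ⟶ W ⊗ W :=
  desc (fun _ => ex₁ * ex₂) (fun _ _ _ => by rw [mul_mul_mul_comm, ex₁_mul, zero_mul])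

/-- The morphism `W² ⟶ W ⊗ W` with `x ↦ x₁ x₂` and `y ↦ x₂`. -/
noncomputable def nu : pow (Unit ⊕ Unit) ⟶ W ⊗ W :=
  desc (Sum.elim (fun _ => ex₁ * ex₂) (fun _ => ex₂)) (by
    rintro (i | i) (j | j) _
    · show ex₁ * ex₂ * (ex₁ * ex₂) = 0
      rw [mul_mul_mul_comm, ex₁_mul, zero_mul]
    · show ex₁ * ex₂ * ex₂ = 0
      rw [mul_assoc, ex₂_mul, mul_zero]
    · show ex₂ * (ex₁ * ex₂) = 0
      rw [mul_left_comm, ex₂_mul, mul_zero]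
    · exact ex₂_mul)

end Weil

/-! ### Tangent categories as actegories of Weil algebras -/

section Tangent

variable (X : Type u) [Category.{v} X] [MonoidalLeftAction Weil X]

/-- The tangent functor. -/
noncomputable abbrev Tan : X ⥤ X := actionLeft X Weil.W

/-- The powers of the tangent functor. -/
noncomputable def TanPow : ℕ → (X ⥤ X)
  | 0 => 𝟭 X
  | n + 1 => TanPow n ⋙ Tan X

/-- A category with an action of the Weil algebras is a tangent category if the action turns the
foundational pullbacks of Weil algebras and the universality of the vertical lift into pullbacks
that are preserved by the powers of the tangent functor. -/
class IsTangentActegory : Prop where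
  foundational (n : ℕ) (σ τ : Type) [Finite σ] [Finite τ] (M : X) :
    IsPullback ((TanPow X n).map (Weil.powFst σ τ ⊵ₗ M)) ((TanPow X n).map (Weil.powSnd σ τ ⊵ₗ M))
      ((TanPow X n).map (Weil.aug (Weil.pow σ) ⊵ₗ M))
      ((TanPow X n).map (Weil.aug (Weil.pow τ) ⊵ₗ M))
  verticalLift (n : ℕ) (M : X) :
    IsPullback ((TanPow X n).map (Weil.nu ⊵ₗ M))
      ((TanPow X n).map (Weil.aug (Weil.pow (Unit ⊕ Unit)) ⊵ₗ M))
      ((TanPow X n).map ((Weil.W ◁ Weil.aug Weil.W) ⊵ₗ M))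
      ((TanPow X n).map (Weil.zero (Weil.W ⊗ 𝟙_ Weil) ⊵ₗ M))

variable {X}

/-- The projection `p_M : T M ⟶ M`. -/
noncomputable def tanProj (M : X) : (Tan X).obj M ⟶ M := (Weil.aug Weil.W ⊵ₗ M) ≫ (λₗ M).hom

/-- The zero section `0_M : M ⟶ T M`. -/
noncomputable def tanZero (M : X) : M ⟶ (Tan X).obj M := (λₗ M).inv ≫ (Weil.zero Weil.W ⊵ₗ M)

/-- The vertical lift `ℓ_M : T M ⟶ T (T M)`. -/
noncomputable def tanLift (M : X) : (Tan X).obj M ⟶ (Tan X).obj ((Tan X).obj M) :=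
  (Weil.ell ⊵ₗ M) ≫ (αₗ Weil.W Weil.W M).hom

/-- The object `T₂ M`, the pullback of `p_M` along itself. -/
noncomputable abbrev tanTwo (M : X) : X := Weil.pow (Unit ⊕ Unit) ⊙ₗ M

/-- The addition `+_M : T₂ M ⟶ T M`. -/
noncomputable def tanAdd (M : X) : tanTwo M ⟶ (Tan X).obj M := Weil.add ⊵ₗ M

theorem tanZero_naturality {M N : X} (f : M ⟶ N) :
    f ≫ tanZero N = tanZero M ≫ (Tan X).map f := by
  refine ((actionUnitIso_inv_naturality_assoc f _).symm.trans ?_).trans (Category.assoc _ _ _).symm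
  exact congrArg ((λₗ M).inv ≫ ·) (action_exchange (Weil.zero Weil.W) f)

/-- The morphism `⟨a, b⟩` into `T₂ M`. -/
noncomputable def tanPair [IsTangentActegory X] {Y M : X} (a b : Y ⟶ (Tan X).obj M)
    (h : a ≫ tanProj M = b ≫ tanProj M) : Y ⟶ tanTwo M :=
  IsPullback.lift (IsTangentActegory.foundational 0 Unit Unit M) a b (by
    exact (cancel_mono (λₗ M).hom).1
      ((Category.assoc _ _ _).trans (h.trans (Category.assoc _ _ _).symm)))

end Tangent

/-! ### Additive bundles -/

section Bundles

variable (X : Type u) [Category.{v} X]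

/-- A morphism that admits all finite pullback powers. -/
structure PowBundle where
  /-- The total space. -/
  E : X
  /-- The base space. -/
  M : X
  /-- The projection. -/
  q : E ⟶ M
  hasPow (n : ℕ) : HasWidePullback M (fun _ : Fin n => E) (fun _ => q)

variable {X}

namespace PowBundle

attribute [instance] PowBundle.hasPow

variable (B : PowBundle X)

/-- The diagram whose limit is the pullback power `Eₙ`. -/
abbrev diagram (n : ℕ) : WidePullbackShape (Fin n) ⥤ X :=
  WidePullbackShape.wideCospan B.M (fun _ : Fin n => B.E) (fun _ => B.q)

/-- The pullback power `Eₙ` of `q` over `M`; `E₀` is `M` and `E₁` is `E` up to isomorphism. -/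
noncomputable abbrev pow (n : ℕ) : X := widePullback B.M (fun _ : Fin n => B.E) (fun _ => B.q)

/-- The projection `πᵢ : Eₙ ⟶ E`. -/
noncomputable abbrev proj (n : ℕ) (i : Fin n) : B.pow n ⟶ B.E :=
  WidePullback.π (fun _ : Fin n => B.q) i

/-- The projection `Eₙ ⟶ M`. -/
noncomputable abbrev base (n : ℕ) : B.pow n ⟶ B.M := WidePullback.base (fun _ : Fin n => B.q)

/-- The morphism `⟨a₀, …, aₙ₋₁⟩ : Y ⟶ Eₙ`. -/
noncomputable abbrev lift {n : ℕ} {Y : X} (m : Y ⟶ B.M) (a : Fin n → (Y ⟶ B.E))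
    (h : ∀ i, a i ≫ B.q = m) : Y ⟶ B.pow n := WidePullback.lift m a h

/-- The morphism `⟨a, b⟩ : Y ⟶ E₂`. -/
noncomputable def pair {Y : X} (a b : Y ⟶ B.E) (h : a ≫ B.q = b ≫ B.q) : Y ⟶ B.pow 2 :=
  B.lift (n := 2) (a ≫ B.q) ![a, b] (by
    intro i; fin_cases i
    · rfl
    · exact h.symm)

@[simp] theorem pair_proj_zero {Y : X} (a b : Y ⟶ B.E) (h : a ≫ B.q = b ≫ B.q) :
    B.pair a b h ≫ B.proj 2 0 = a := WidePullback.lift_π _ _ _ _ _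
@[simp] theorem pair_proj_one {Y : X} (a b : Y ⟶ B.E) (h : a ≫ B.q = b ≫ B.q) :
    B.pair a b h ≫ B.proj 2 1 = b := WidePullback.lift_π _ _ _ _ _
@[simp] theorem pair_base {Y : X} (a b : Y ⟶ B.E) (h : a ≫ B.q = b ≫ B.q) :
    B.pair a b h ≫ B.base 2 = a ≫ B.q := WidePullback.lift_base _ _ _ _

theorem proj_q (n : ℕ) (i : Fin n) : B.proj n i ≫ B.q = B.base n := WidePullback.π_arrow _ _

theorem proj_q' (n : ℕ) (i j : Fin n) : B.proj n i ≫ B.q = B.proj n j ≫ B.q :=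
  (B.proj_q n i).trans (B.proj_q n j).symm

theorem pow_hom_ext {n : ℕ} {Y : X} {f g : Y ⟶ B.pow n} (hb : f ≫ B.base n = g ≫ B.base n)
    (h : ∀ i, f ≫ B.proj n i = g ≫ B.proj n i) : f = g := WidePullback.hom_ext _ _ _ h hb

/-- The morphism `⟨a₀, …, aₙ₋₁⟩ : Y ⟶ F Eₙ` for a functor `F` that preserves the pullback power. -/
noncomputable def mapLift {Z : Type u'} [Category.{v'} Z] (F : X ⥤ Z) {n : ℕ}
    [PreservesLimit (B.diagram n) F] {Y : Z} (m : Y ⟶ F.obj B.M) (a : Fin n → (Y ⟶ F.obj B.E))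
    (h : ∀ i, a i ≫ F.map B.q = m) : Y ⟶ F.obj (B.pow n) :=
  (isLimitOfPreserves F (limit.isLimit (B.diagram n))).lift
    (WidePullbackShape.mkCone (F := B.diagram n ⋙ F) m a h)

/-- The morphism `⟨a, b⟩ : Y ⟶ F E₂` for a functor `F` that preserves the pullback power. -/
noncomputable def mapPair {Z : Type u'} [Category.{v'} Z] (F : X ⥤ Z)
    [PreservesLimit (B.diagram 2) F] {Y : Z} (a b : Y ⟶ F.obj B.E)
    (h : a ≫ F.map B.q = b ≫ F.map B.q) : Y ⟶ F.obj (B.pow 2) :=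
  B.mapLift F (n := 2) (a ≫ F.map B.q) ![a, b] (by
    intro i; fin_cases i
    · rfl
    · exact h.symm)

theorem mapLift_proj {Z : Type u'} [Category.{v'} Z] (F : X ⥤ Z) {n : ℕ}
    [PreservesLimit (B.diagram n) F] {Y : Z} (m : Y ⟶ F.obj B.M) (a : Fin n → (Y ⟶ F.obj B.E))
    (h : ∀ i, a i ≫ F.map B.q = m) (i : Fin n) :
    B.mapLift F m a h ≫ F.map (B.proj n i) = a i :=
  (isLimitOfPreserves F (limit.isLimit (B.diagram n))).fac
    (WidePullbackShape.mkCone (F := B.diagram n ⋙ F) m a h) (some i)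

end PowBundle

variable (X)

/-- An additive bundle. -/
structure AddBundle extends PowBundle X where
  /-- The zero section. -/
  ζ : M ⟶ E
  /-- The addition. -/
  σ : toPowBundle.pow 2 ⟶ E
  ζ_q : ζ ≫ q = 𝟙 M
  σ_q : σ ≫ q = toPowBundle.base 2
  add_assoc :
    toPowBundle.pair
        (toPowBundle.pair (toPowBundle.proj 3 0) (toPowBundle.proj 3 1)
          (toPowBundle.proj_q' 3 0 1) ≫ σ)
        (toPowBundle.proj 3 2)
        (by rw [Category.assoc, σ_q, PowBundle.pair_base]; exact toPowBundle.proj_q' 3 0 2) ≫ σ =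
      toPowBundle.pair (toPowBundle.proj 3 0)
        (toPowBundle.pair (toPowBundle.proj 3 1) (toPowBundle.proj 3 2)
          (toPowBundle.proj_q' 3 1 2) ≫ σ)
        (by rw [Category.assoc, σ_q, PowBundle.pair_base]; exact toPowBundle.proj_q' 3 0 1) ≫ σ
  add_comm : toPowBundle.pair (toPowBundle.proj 2 1) (toPowBundle.proj 2 0)
    (toPowBundle.proj_q' 2 1 0) ≫ σ = σ
  zero_add : toPowBundle.pair (q ≫ ζ) (𝟙 E)
    (by rw [Category.assoc, ζ_q, Category.comp_id, Category.id_comp]) ≫ σ = 𝟙 E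

variable {X}

namespace AddBundle

variable (B : AddBundle X)

theorem comp_pair {Y Z : X} (f : Z ⟶ Y) (a b : Y ⟶ B.E) (h : a ≫ B.q = b ≫ B.q) :
    f ≫ B.pair a b h = B.pair (f ≫ a) (f ≫ b) (by rw [Category.assoc, h, Category.assoc]) := by
  refine B.pow_hom_ext (by simp) ?_
  intro i; fin_cases i
  · simp [Category.assoc]
  · simp [Category.assoc]

/-- The morphisms `Y ⟶ E` over a given morphism `m : Y ⟶ M`. -/
structure Over {Y : X} (m : Y ⟶ B.M) where
  hom : Y ⟶ B.E
  w : hom ≫ B.q = m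

variable {B}

@[ext] theorem Over.ext' {Y : X} {m : Y ⟶ B.M} {a b : B.Over m} (h : a.hom = b.hom) : a = b := by
  cases a; cases b; cases h; rfl

/-- The sum of two morphisms over the base. -/
noncomputable def Over.add {Y : X} {m : Y ⟶ B.M} (a b : B.Over m) : B.Over m where
  hom := B.pair a.hom b.hom (a.w.trans b.w.symm) ≫ B.σ
  w := by rw [Category.assoc, B.σ_q, PowBundle.pair_base, a.w]

theorem pair_congr {Y : X} {a b a' b' : Y ⟶ B.E} (h : a ≫ B.q = b ≫ B.q) (ha : a = a')
    (hb : b = b') : B.pair a b h = B.pair a' b' (by rw [← ha, ← hb, h]) := by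
  subst ha hb; rfl

noncomputable instance {Y : X} (m : Y ⟶ B.M) : Add (B.Over m) := ⟨Over.add⟩
noncomputable instance {Y : X} (m : Y ⟶ B.M) : Zero (B.Over m) :=
  ⟨⟨m ≫ B.ζ, by rw [Category.assoc, B.ζ_q, Category.comp_id]⟩⟩

theorem Over.zero_hom {Y : X} (m : Y ⟶ B.M) : (0 : B.Over m).hom = m ≫ B.ζ := rfl
theorem Over.add_hom {Y : X} {m : Y ⟶ B.M} (a b : B.Over m) :
    (a + b).hom = B.pair a.hom b.hom (a.w.trans b.w.symm) ≫ B.σ := rfl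

theorem Over.add_comm' {Y : X} {m : Y ⟶ B.M} (a b : B.Over m) : a + b = b + a := by
  refine Over.ext' ?_
  have key := congrArg (B.pair b.hom a.hom (b.w.trans a.w.symm) ≫ ·) B.add_comm
  simp only [← Category.assoc, comp_pair] at key
  refine Eq.trans ?_ key
  exact congrArg (· ≫ B.σ) (pair_congr _ (by simp) (by simp))

theorem Over.zero_add' {Y : X} {m : Y ⟶ B.M} (a : B.Over m) : 0 + a = a := by
  refine Over.ext' ?_
  have key := congrArg (a.hom ≫ ·) B.zero_add
  simp only [← Category.assoc, comp_pair] at key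
  refine Eq.trans ?_ (key.trans (Category.comp_id _))
  exact congrArg (· ≫ B.σ) (pair_congr _ (by rw [a.w]; rfl) (Category.comp_id _).symm)

/-- The morphisms over `m` form a commutative monoid. -/
noncomputable instance {Y : X} (m : Y ⟶ B.M) : AddCommMonoid (B.Over m) where
  nsmul := nsmulRec
  add_assoc a b c := by
    refine Over.ext' ?_
    have h : ∀ i, ![a.hom, b.hom, c.hom] i ≫ B.q = m := by
      intro i; fin_cases i
      · exact a.w
      · exact b.w
      · exact c.w
    have h0 : B.lift (n := 3) m ![a.hom, b.hom, c.hom] h ≫ B.proj 3 0 = a.hom :=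
      WidePullback.lift_π _ _ _ _ _
    have h1 : B.lift (n := 3) m ![a.hom, b.hom, c.hom] h ≫ B.proj 3 1 = b.hom :=
      WidePullback.lift_π _ _ _ _ _
    have h2 : B.lift (n := 3) m ![a.hom, b.hom, c.hom] h ≫ B.proj 3 2 = c.hom :=
      WidePullback.lift_π _ _ _ _ _
    have key := congrArg (B.lift (n := 3) m ![a.hom, b.hom, c.hom] h ≫ ·) B.add_assoc
    simp only [← Category.assoc, comp_pair] at key
    have e1 : B.pair _ _ _ = B.pair a.hom b.hom (a.w.trans b.w.symm) :=
      pair_congr ((by rw [h0, h1, a.w, b.w])) h0 h1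
    have e2 : B.pair _ _ _ = B.pair b.hom c.hom (b.w.trans c.w.symm) :=
      pair_congr ((by rw [h1, h2, b.w, c.w])) h1 h2
    refine Eq.trans ?_ (key.trans ?_)
    · refine congrArg (· ≫ B.σ) (pair_congr _ (congrArg (· ≫ B.σ) e1.symm) h2.symm)
    · refine congrArg (· ≫ B.σ) (pair_congr _ h0 (congrArg (· ≫ B.σ) e2))
  add_comm := Over.add_comm'
  zero_add := Over.zero_add'
  add_zero a := (Over.add_comm' a 0).trans (Over.zero_add' a)

end AddBundle
end Bundles

section Functor

variable {X : Type u} [Category.{v} X]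

namespace AddBundle

variable (B : AddBundle X)

/-- Precomposition of morphisms over the base. -/
noncomputable def precomp {Y Z : X} {m : Y ⟶ B.M} {m' : Z ⟶ B.M} (f : Z ⟶ Y) (hf : f ≫ m = m') :
    B.Over m →+ B.Over m' where
  toFun a := ⟨f ≫ a.hom, by rw [Category.assoc, a.w, hf]⟩
  map_zero' := Over.ext' (((Category.assoc f m B.ζ).symm).trans (congrArg (· ≫ B.ζ) hf))
  map_add' a b := Over.ext' (by
    refine (Category.assoc f (B.pair a.hom b.hom _) B.σ).symm.trans ?_
    rw [comp_pair]
    rfl)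

theorem precomp_hom {Y Z : X} {m : Y ⟶ B.M} {m' : Z ⟶ B.M} (f : Z ⟶ Y) (hf : f ≫ m = m')
    (a : B.Over m) : (B.precomp f hf a).hom = f ≫ a.hom := rfl

/-- The projections `Eₙ ⟶ E` as morphisms over the base. -/
noncomputable def projOver (n : ℕ) (i : Fin n) : B.Over (B.base n) := ⟨B.proj n i, B.proj_q n i⟩

/-- The linear combination `∑ⱼ aⱼ • πⱼ`. -/
noncomputable def linComb {n : ℕ} (a : Fin n → ℕ) : B.Over (B.base n) := ∑ j, a j • B.projOver n j

/-- The morphism `Eₘ ⟶ Eₙ` with the components `∑ⱼ aᵢⱼ • πⱼ`. -/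
noncomputable def powMap {m n : ℕ} (A : Matrix (Fin n) (Fin m) ℕ) : B.pow m ⟶ B.pow n :=
  B.lift (B.base m) (fun i => (B.linComb (A i)).hom) (fun i => (B.linComb (A i)).w)

theorem powMap_base {m n : ℕ} (A : Matrix (Fin n) (Fin m) ℕ) :
    B.powMap A ≫ B.base n = B.base m := WidePullback.lift_base _ _ _ _
theorem powMap_proj {m n : ℕ} (A : Matrix (Fin n) (Fin m) ℕ) (i : Fin n) :
    B.powMap A ≫ B.proj n i = (B.linComb (A i)).hom := WidePullback.lift_π _ _ _ _ _

theorem precomp_projOver {m n : ℕ} (A : Matrix (Fin n) (Fin m) ℕ) (i : Fin n) :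
    B.precomp (B.powMap A) (B.powMap_base A) (B.projOver n i) = B.linComb (A i) :=
  Over.ext' (B.powMap_proj A i)

theorem powMap_one (n : ℕ) : B.powMap (1 : Matrix (Fin n) (Fin n) ℕ) = 𝟙 (B.pow n) := by
  refine B.pow_hom_ext ((B.powMap_base _).trans (Category.id_comp _).symm) fun i => ?_
  rw [powMap_proj, Category.id_comp]
  have : B.linComb ((1 : Matrix (Fin n) (Fin n) ℕ) i) = B.projOver n i := by
    rw [linComb, Finset.sum_eq_single i]
    · simp
    · intro j _ hj
      rw [Matrix.one_apply_ne hj.symm, zero_smul]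
    · simp
  rw [this]
  rfl

theorem powMap_mul {l m n : ℕ} (A : Matrix (Fin m) (Fin l) ℕ) (A' : Matrix (Fin n) (Fin m) ℕ) :
    B.powMap (A' * A) = B.powMap A ≫ B.powMap A' := by
  refine B.pow_hom_ext ?_ fun h => ?_
  · rw [Category.assoc, powMap_base, powMap_base, powMap_base]
  · rw [Category.assoc, powMap_proj, powMap_proj, ← B.precomp_hom (B.powMap A) (B.powMap_base A)]
    refine congrArg Over.hom ?_
    conv_rhs => rw [linComb, map_sum]
    simp only [map_nsmul, precomp_projOver, linComb, Finset.smul_sum, smul_smul, Matrix.mul_apply,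
      Finset.sum_smul]
    exact Finset.sum_comm

/-- The functor `F_E` with `F_E(ℕᵏ) = Eₖ`. -/
noncomputable def toFunctor : NBullet ⥤ X where
  obj k := B.pow k.dim
  map f := B.powMap f.mat
  map_id k := B.powMap_one k.dim
  map_comp f g := B.powMap_mul f.mat g.mat

end AddBundle

end Functor

/-! ### Differential bundles -/

section Differential

variable (X : Type u) [Category.{v} X] [MonoidalLeftAction Weil X] [IsTangentActegory X]

/-- The morphism `⟨a, b⟩ : Y ⟶ T E₂`, if the powers of `T` preserve the pullback powers. -/
noncomputable def PowBundle.tanMapPair {X : Type u} [Category.{v} X] [MonoidalLeftAction Weil X]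
    (B : PowBundle X) (hB : ∀ n k, PreservesLimit (B.diagram n) (TanPow X k)) {Y : X}
    (a b : Y ⟶ (Tan X).obj B.E) (h : a ≫ (Tan X).map B.q = b ≫ (Tan X).map B.q) :
    Y ⟶ (Tan X).obj (B.pow 2) :=
  haveI : PreservesLimit (B.diagram 2) (Tan X) := hB 2 1
  B.mapPair (Tan X) a b h

/-- A differential bundle. The pullback powers of the projection and the universality of the
vertical lift are preserved by the powers of the tangent functor. -/
structure DiffBundle extends AddBundle X where
  preserves (n k : ℕ) : PreservesLimit (toPowBundle.diagram n) (TanPow X k)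
  /-- The lift. -/
  lam : E ⟶ (Tan X).obj E
  /-- `(λ, 0)` is an additive morphism to `(TE, TM, Tq, Tσ, Tζ)`. -/
  lam_q : lam ≫ (Tan X).map q = q ≫ tanZero M
  σ_lam : σ ≫ lam =
    toPowBundle.tanMapPair preserves (toPowBundle.proj 2 0 ≫ lam) (toPowBundle.proj 2 1 ≫ lam)
      (by rw [Category.assoc, Category.assoc, lam_q, ← Category.assoc, ← Category.assoc,
        toPowBundle.proj_q' 2 0 1]) ≫ (Tan X).map σ
  ζ_lam : ζ ≫ lam = tanZero M ≫ (Tan X).map ζ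
  /-- `(λ, ζ)` is an additive morphism to `(TE, E, p, +, 0)`. -/
  lam_p : lam ≫ tanProj E = q ≫ ζ
  σ_lam' : σ ≫ lam =
    tanPair (toPowBundle.proj 2 0 ≫ lam) (toPowBundle.proj 2 1 ≫ lam)
      (by rw [Category.assoc, Category.assoc, lam_p, ← Category.assoc, ← Category.assoc,
        toPowBundle.proj_q' 2 0 1]) ≫ tanAdd E
  ζ_lam' : ζ ≫ lam = ζ ≫ tanZero E
  lam_lam : lam ≫ tanLift E = lam ≫ (Tan X).map lam
  /-- The universality of the vertical lift. -/
  universal (k : ℕ) : IsPullback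
    ((TanPow X k).map (toPowBundle.tanMapPair preserves
      (toPowBundle.proj 2 0 ≫ lam) (toPowBundle.proj 2 1 ≫ tanZero E)
        (by rw [Category.assoc, Category.assoc, lam_q, ← tanZero_naturality, ← Category.assoc,
          ← Category.assoc, toPowBundle.proj_q' 2 0 1]) ≫ (Tan X).map σ))
    ((TanPow X k).map (toPowBundle.proj 2 0 ≫ q))
    ((TanPow X k).map ((Tan X).map q))
    ((TanPow X k).map (tanZero M))

variable {X}

/-- A morphism of differential bundles. -/
@[ext] structure BundleHom (B B' : DiffBundle X) where
  /-- The morphism of the total spaces. -/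
  f : B.E ⟶ B'.E
  /-- The morphism of the base spaces. -/
  g : B.M ⟶ B'.M
  w : f ≫ B'.q = B.q ≫ g

namespace BundleHom

/-- The identity. -/
def id (B : DiffBundle X) : BundleHom B B := ⟨𝟙 _, 𝟙 _, by simp⟩

/-- The composite. -/
def comp {B B' B'' : DiffBundle X} (h : BundleHom B B') (h' : BundleHom B' B'') :
    BundleHom B B'' :=
  ⟨h.f ≫ h'.f, h.g ≫ h'.g, by
    rw [Category.assoc, h'.w, ← Category.assoc, h.w, Category.assoc]⟩

/-- The induced morphism `f₂ : E₂ ⟶ E'₂`. -/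
noncomputable def two {B B' : DiffBundle X} (h : BundleHom B B') : B.pow 2 ⟶ B'.pow 2 :=
  B'.pair (B.proj 2 0 ≫ h.f) (B.proj 2 1 ≫ h.f) (by
    rw [Category.assoc, Category.assoc, h.w, ← Category.assoc, ← Category.assoc,
      B.proj_q' 2 0 1])

/-- A morphism is additive if it is compatible with the additions and the zero sections. -/
structure IsAdditive {B B' : DiffBundle X} (h : BundleHom B B') : Prop where
  add : h.two ≫ B'.σ = B.σ ≫ h.f
  zero : h.g ≫ B'.ζ = B.ζ ≫ h.f

/-- A morphism is linear if it is compatible with the lifts. -/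
def IsLinear {B B' : DiffBundle X} (h : BundleHom B B') : Prop :=
  h.f ≫ B'.lam = B.lam ≫ (Tan X).map h.f

theorem two_comp {B B' B'' : DiffBundle X} (h : BundleHom B B') (h' : BundleHom B' B'') :
    (h.comp h').two = h.two ≫ h'.two := by
  rw [two, two, two, AddBundle.comp_pair]
  exact AddBundle.pair_congr _
    (by rw [← Category.assoc (B'.pair _ _ _), PowBundle.pair_proj_zero]
        exact (Category.assoc _ _ _).symm)
    (by rw [← Category.assoc (B'.pair _ _ _), PowBundle.pair_proj_one]
        exact (Category.assoc _ _ _).symm)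

theorem two_id (B : DiffBundle X) : (id B).two = 𝟙 _ := by
  refine B.pow_hom_ext ?_ fun i => ?_
  · rw [two, PowBundle.pair_base, Category.assoc, (id B).w, ← Category.assoc, B.proj_q]
    exact (Category.comp_id _).trans (Category.id_comp _).symm
  · fin_cases i
    · exact (B.pair_proj_zero _ _ _).trans ((Category.comp_id _).trans (Category.id_comp _).symm)
    · exact (B.pair_proj_one _ _ _).trans ((Category.comp_id _).trans (Category.id_comp _).symm)

theorem IsAdditive.id (B : DiffBundle X) : (BundleHom.id B).IsAdditive where
  add := by
    rw [two_id, Category.id_comp]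
    exact (Category.comp_id _).symm
  zero := (Category.id_comp _).trans (Category.comp_id _).symm

theorem IsAdditive.comp {B B' B'' : DiffBundle X} {h : BundleHom B B'} {h' : BundleHom B' B''}
    (H : h.IsAdditive) (H' : h'.IsAdditive) : (h.comp h').IsAdditive where
  add := by
    rw [two_comp, Category.assoc, H'.add, ← Category.assoc, H.add]
    exact Category.assoc _ _ _
  zero := by
    refine (Category.assoc _ _ _).trans ?_
    rw [H'.zero, ← Category.assoc, H.zero]
    exact Category.assoc _ _ _

theorem IsLinear.id (B : DiffBundle X) : (BundleHom.id B).IsLinear := by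
  refine (Category.id_comp _).trans ?_
  refine Eq.trans ?_ (congrArg (B.lam ≫ ·) ((Tan X).map_id _).symm)
  exact (Category.comp_id _).symm

theorem IsLinear.comp {B B' B'' : DiffBundle X} {h : BundleHom B B'} {h' : BundleHom B' B''}
    (H : h.IsLinear) (H' : h'.IsLinear) : (h.comp h').IsLinear := by
  unfold IsLinear at *
  refine (Category.assoc _ _ _).trans ?_
  rw [H', ← Category.assoc, H, Category.assoc]
  exact congrArg (B.lam ≫ ·) ((Tan X).map_comp _ _).symm

end BundleHom

variable (X)

/-- The category of differential bundles and additive morphisms. -/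
structure DBunAdd where
  bundle : DiffBundle X

/-- The category of differential bundles and linear morphisms. -/
structure DBunLin where
  bundle : DiffBundle X

variable {X}

/-- An additive morphism of differential bundles. -/
@[ext] structure DBunAdd.Hom (B B' : DBunAdd X) where
  hom : BundleHom B.bundle B'.bundle
  additive : hom.IsAdditive

/-- A linear morphism of differential bundles. -/
@[ext] structure DBunLin.Hom (B B' : DBunLin X) where
  hom : BundleHom B.bundle B'.bundle
  linear : hom.IsLinear

noncomputable instance : Category (DBunAdd X) where
  Hom := DBunAdd.Hom
  id B := ⟨BundleHom.id B.bundle, .id _⟩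
  comp h h' := ⟨h.hom.comp h'.hom, h.additive.comp h'.additive⟩
  id_comp _ := DBunAdd.Hom.ext (BundleHom.ext (Category.id_comp _) (Category.id_comp _))
  comp_id _ := DBunAdd.Hom.ext (BundleHom.ext (Category.comp_id _) (Category.comp_id _))
  assoc _ _ _ := DBunAdd.Hom.ext (BundleHom.ext (Category.assoc _ _ _) (Category.assoc _ _ _))

noncomputable instance : Category (DBunLin X) where
  Hom := DBunLin.Hom
  id B := ⟨BundleHom.id B.bundle, .id _⟩
  comp h h' := ⟨h.hom.comp h'.hom, h.linear.comp h'.linear⟩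
  id_comp _ := DBunLin.Hom.ext (BundleHom.ext (Category.id_comp _) (Category.id_comp _))
  comp_id _ := DBunLin.Hom.ext (BundleHom.ext (Category.comp_id _) (Category.comp_id _))
  assoc _ _ _ := DBunLin.Hom.ext (BundleHom.ext (Category.assoc _ _ _) (Category.assoc _ _ _))

end Differential

/-! ### Differential functors -/

section DiffFun

open Functor.OplaxLeftLinear

variable {X : Type u} [Category.{v} X] [MonoidalLeftAction Weil X]
variable {Y : Type u'} [Category.{v'} Y] [MonoidalLeftAction Weil Y]

/-- The conditions for an oplax linear functor to be a lax differential functor. -/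
structure IsLaxDifferential (F : X ⥤ Y) [F.OplaxLeftLinear Weil] : Prop where
  /-- `T_A ∘ F` preserves pullbacks over the terminal object. -/
  preserves (A : Weil) {P Q R Z : X} (_ : IsTerminal Z) (fst : P ⟶ Q) (snd : P ⟶ R) (f : Q ⟶ Z)
    (g : R ⟶ Z) (_ : IsPullback fst snd f g) :
    IsPullback (A ⊴ₗ F.map fst) (A ⊴ₗ F.map snd) (A ⊴ₗ F.map f) (A ⊴ₗ F.map g)
  /-- The lineator is Cartesian. -/
  cartesian (A : Weil) {Q R : X} (f : Q ⟶ R) :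
    IsPullback (δₗ F A Q) (F.map (A ⊴ₗ f)) (A ⊴ₗ F.map f) (δₗ F A R)

/-- A natural transformation between oplax linear functors is linear if it is compatible with the
lineators. -/
def IsLinearTrans {F G : X ⥤ Y} [F.OplaxLeftLinear Weil] [G.OplaxLeftLinear Weil]
    (φ : F ⟶ G) : Prop :=
  ∀ (A : Weil) (Q : X), δₗ F A Q ≫ A ⊴ₗ φ.app Q = φ.app (A ⊙ₗ Q) ≫ δₗ G A Q

variable (X Y)

/-- A lax differential functor. -/
structure LaxDiffFunctor where
  functor : X ⥤ Y
  oplax : functor.OplaxLeftLinear Weil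
  isLax : IsLaxDifferential functor

attribute [instance] LaxDiffFunctor.oplax

/-- The category of lax differential functors and natural transformations. -/
structure DiffFun where
  fn : LaxDiffFunctor X Y

/-- The category of lax differential functors and linear natural transformations. -/
structure DiffFunLin where
  fn : LaxDiffFunctor X Y

variable {X Y}

/-- A natural transformation of the underlying functors. -/
@[ext] structure DiffFun.Hom (F G : DiffFun X Y) where
  trans : F.fn.functor ⟶ G.fn.functor

/-- A linear natural transformation of the underlying functors. -/
@[ext] structure DiffFunLin.Hom (F G : DiffFunLin X Y) where
  trans : F.fn.functor ⟶ G.fn.functor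
  linear : IsLinearTrans trans

instance : Category (DiffFun X Y) where
  Hom := DiffFun.Hom
  id _ := ⟨𝟙 _⟩
  comp φ ψ := ⟨φ.trans ≫ ψ.trans⟩
  id_comp _ := DiffFun.Hom.ext (Category.id_comp _)
  comp_id _ := DiffFun.Hom.ext (Category.comp_id _)
  assoc _ _ _ := DiffFun.Hom.ext (Category.assoc _ _ _)

instance : Category (DiffFunLin X Y) where
  Hom := DiffFunLin.Hom
  id _ := ⟨𝟙 _, fun A Q => by simp⟩
  comp φ ψ := ⟨φ.trans ≫ ψ.trans, fun A Q => by
    have h1 := φ.linear A Q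
    have h2 := ψ.linear A Q
    rw [NatTrans.comp_app, NatTrans.comp_app, Category.assoc, ← h2, ← Category.assoc, ← h1,
      Category.assoc, actionHomRight_comp]⟩
  id_comp _ := DiffFunLin.Hom.ext (Category.id_comp _)
  comp_id _ := DiffFunLin.Hom.ext (Category.comp_id _)
  assoc _ _ _ := DiffFunLin.Hom.ext (Category.assoc _ _ _)

end DiffFun

/-! ### The induced lineator and the induced natural transformations -/

namespace Weil

/-- The monomial `1`. -/
noncomputable def monOne (A : Weil) : A.Mon :=
  ⟨0, fun i j _ h => by
    have := Finsupp.le_def.1 h i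
    simp at this⟩

theorem not_le_single :
    ¬ (Finsupp.single () 1 + Finsupp.single () 1 ≤ (Finsupp.single () 1 : Unit →₀ ℕ)) := by
  rw [← Finsupp.single_add]
  intro h
  have := Finsupp.le_def.1 h ()
  simp at this

/-- The monomial `x` of the dual numbers. -/
noncomputable def monX : W.Mon := ⟨Finsupp.single () 1, fun _ _ _ => not_le_single⟩

end Weil

section Induced

open Functor.OplaxLeftLinear

variable {X : Type u} [Category.{v} X] [MonoidalLeftAction Weil X] [IsTangentActegory X]

namespace DiffBundle

/-- The functor `F_E : ℕ^• ⥤ X`. -/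
noncomputable abbrev indFunctor (B : DiffBundle X) : NBullet ⥤ X := B.toAddBundle.toFunctor

/-- The coordinate of a basis vector of `D_W(ℕ¹)`. -/
noncomputable abbrev coord (s : Weil.W.Mon) : Fin (Weil.W ⊙ₗ (⟨1⟩ : NBullet)).dim :=
  NBullet.idx Weil.W ⟨1⟩ (s, 0)

/-- The morphism `T(σ) ∘ ⟨0 ∘ a, λ ∘ b⟩`. -/
noncomputable def nuPair (B : DiffBundle X) {Y : X} (a b : Y ⟶ B.E) (h : a ≫ B.q = b ≫ B.q) :
    Y ⟶ (Tan X).obj B.E :=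
  B.tanMapPair B.preserves (a ≫ tanZero B.E) (b ≫ B.lam)
    (by rw [Category.assoc, Category.assoc, B.lam_q, ← tanZero_naturality, ← Category.assoc,
      ← Category.assoc, h]) ≫ (Tan X).map B.σ

/-- The morphism `T(σ) ∘ ⟨0 ∘ π₀, λ ∘ π₁⟩` on `F_E(D_W(ℕ¹)) = E₂`, where `π₀` and `π₁` belong to
the basis vectors `1` and `x` of `W`. -/
noncomputable def gen (B : DiffBundle X) :
    B.indFunctor.obj (Weil.W ⊙ₗ (⟨1⟩ : NBullet)) ⟶ (Tan X).obj B.E :=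
  B.nuPair (B.proj _ (coord (Weil.monOne Weil.W))) (B.proj _ (coord Weil.monX))
    (B.proj_q' _ _ _)

/-- The defining values at `(W, ℕ¹)` and `(W, ℕ⁰)` of the lineator of the induced functor, up to the
isomorphisms `E₁ ≅ E` and `E₀ ≅ M`. -/
structure IsInducedLineator (B : DiffBundle X) [B.indFunctor.OplaxLeftLinear Weil] : Prop where
  one : δₗ B.indFunctor Weil.W (⟨1⟩ : NBullet) ≫ (Tan X).map (B.proj 1 0) = B.gen
  zero : δₗ B.indFunctor Weil.W (⟨0⟩ : NBullet) ≫ (Tan X).map (B.base 0) = B.base _ ≫ tanZero B.M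

end DiffBundle

/-- The natural transformation `φ` has the components `φ_{ℕᵏ} = fₖ : Eₖ ⟶ E'ₖ` (so that
`φ_{ℕ⁰} = g` up to the isomorphisms `E₀ ≅ M` and `E'₀ ≅ M'`). -/
def BundleHom.IsInduced {B B' : DiffBundle X} (h : BundleHom B B') (φ : B.indFunctor ⟶ B'.indFunctor) : Prop :=
  ∀ k : NBullet, φ.app k ≫ B'.base k.dim = B.base k.dim ≫ h.g ∧
    ∀ i : Fin k.dim, φ.app k ≫ B'.proj k.dim i = B.proj k.dim i ≫ h.f

end Induced

/-! The underlying monoid of a Weil algebra `A` is free on its nonzero monomials, so a suitable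
morphism into `T_A E` should amount to a family of morphisms into `E` indexed by those monomials.
The lift `λ` is the morphism that belongs to the monomial `x` of `W`. A monomial `s ≠ 1` of `A`
squares to zero, hence defines `W ⟶ A`, `x ↦ s`, and `λ` followed by the induced map `TE ⟶ T_A E` is
a morphism `λ_s : E ⟶ T_A E`. For `s = 1` the zero section is taken. Each `λ_s` is additive over the
zero section of `M`. The `j`-th component of the lineator at `(A, ℕᵏ)` is `∑ₛ λ_s ∘ π_(s,j)`, a sum
in the bundle `T_A E ⟶ T_A M`.

Naturality in `A` requires `T_θ ∘ λ_s = ∑ₜ θ_ts λ_t`. The same recipe makes sense for every element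
of square zero and is additive in that element (`lamOver_zero`, `lamOver_add`): additivity is
checked in the universal case `W²`, where `T_{W²} E` is a pullback of two copies of `TE`. Since
coefficients are natural numbers, all partial sums of an element of square zero have square zero, so
the expansion into monomials is legitimate (`lamOver_eq_sum`). Coherence with `⊗` is the identity
`λ_{st} = T_A(λ_t) ∘ λ_s` (`lamMon_tensor`), a consequence of `ℓ ∘ λ = T(λ) ∘ λ`.

The Cartesian condition reduces to `isUniversal`: for `G` isomorphic to some `T_C`, every morphism
into `G(T_A E)` whose base part is a zero section is a unique linear combination of the `λ_s`. Every
Weil algebra is a tensor product of algebras `W^σ`, which are iterated products of copies of `W`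
over `ℕ`. So this follows by induction from the universality of the lift (for `W`), the foundational
pullbacks (for products) and composition of functors (for `⊗`, where the freedom in `G` is used).
The same induction shows that all `T_A` preserve the limits which the powers of `T` preserve
(`IsStableLimit.action`).

An additive morphism commutes with linear combinations, hence induces a natural transformation. For
a linear `f`, the lift of the target is monic (`mono_lam`) and compatible with the natural addition
of the tangent bundle, so `f` is additive. It also commutes with every `λ_s`, hence with the
lineators. -/

namespace Weil

/-! ### Induction on Weil algebras -/

/-- A bijection of the generators that respects the relations is an isomorphism. -/
noncomputable def isoOfEquiv {A B : Weil} (e : A.gen ≃ B.gen)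
    (h : ∀ i j, A.rel i j ↔ B.rel (e i) (e j)) : A ≅ B where
  hom := desc (fun i => B.x (e i)) (fun i j hij => B.x_mul_x ((h i j).1 hij))
  inv := desc (fun i => A.x (e.symm i))
    (fun i j hij => A.x_mul_x ((h _ _).2 (by simpa using hij)))
  hom_inv_id := hom_ext fun i => by simp
  inv_hom_id := hom_ext fun i => by simp

/-- The Weil algebra on a subset of the generators. -/
def restrict (A : Weil) (p : A.gen → Prop) : Weil where
  gen := {i // p i}
  fin := inferInstance
  rel := A.rel.comap Subtype.val

/-- The class of a generator splits off as a tensor factor. -/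
noncomputable def splitIso (A : Weil) (i : A.gen) :
    pow {j // A.rel i j} ⊗ A.restrict (fun j => ¬ A.rel i j) ≅ A := by
  classical
  refine isoOfEquiv (Equiv.sumCompl (fun j => A.rel i j)) ?_
  rintro (⟨a, ha⟩ | ⟨a, ha⟩) (⟨b, hb⟩ | ⟨b, hb⟩)
  · exact ⟨fun _ => Setoid.trans' _ (Setoid.symm' _ ha) hb, fun _ => Sum.LiftRel.inl trivial⟩
  · exact ⟨(fun h => by cases h), fun h => (hb (Setoid.trans' _ ha h)).elim⟩
  · exact ⟨(fun h => by cases h), fun h => (ha (Setoid.trans' _ hb (Setoid.symm' _ h))).elim⟩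
  · refine ⟨fun h => ?_, fun h => Sum.LiftRel.inr h⟩
    cases h with
    | inr h => exact h

/-- Every Weil algebra is obtained from `ℕ` and `W` by products over `ℕ` of the algebras `W^σ` and
by coproducts. -/
theorem induction {P : Weil → Prop} (iso : ∀ {A B : Weil}, (A ≅ B) → P A → P B)
    (unit : P (𝟙_ Weil)) (dual : P W)
    (sum : ∀ (σ τ : Type) [Finite σ] [Finite τ], P (pow σ) → P (pow τ) → P (pow (σ ⊕ τ)))
    (tensor : ∀ A B : Weil, P A → P B → P (A ⊗ B)) (A : Weil) : P A := by
  have empty (A : Weil) [IsEmpty A.gen] : P A :=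
    iso (isoOfEquiv (A := 𝟙_ Weil) (Equiv.equivOfIsEmpty Empty A.gen) (fun i => i.elim)) unit
  have pow_equiv {σ τ : Type} [Finite σ] [Finite τ] (e : σ ≃ τ) (h : P (pow σ)) : P (pow τ) :=
    iso (isoOfEquiv (A := pow σ) (B := pow τ) e fun _ _ => Iff.rfl) h
  have hpow (σ : Type) [Finite σ] : P (pow σ) := by
    have := Fintype.ofFinite σ
    refine Fintype.induction_empty_option (P := fun σ _ => P (pow σ)) ?_ ?_ ?_ σ
    · intro α β _ e ih
      have : Finite α := Finite.of_equiv β e.symm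
      exact pow_equiv e ih
    · have : IsEmpty (pow PEmpty).gen := inferInstanceAs (IsEmpty PEmpty)
      exact empty _
    -- One more generator is one more factor `W` in the product over `ℕ`.
    · exact fun α _ ih => pow_equiv (Equiv.optionEquivSumPUnit α).symm (sum _ _ ih dual)
  obtain ⟨n, hn⟩ : ∃ n, Nat.card A.gen = n := ⟨_, rfl⟩
  induction n using Nat.strong_induction_on generalizing A with
  | _ n ih =>
    rcases isEmpty_or_nonempty A.gen with _ | ⟨⟨i⟩⟩
    · exact empty A
    -- The complement of the class of `i` has fewer generators, because `i` lies in its own class.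
    · refine iso (A.splitIso i) (tensor _ _ (hpow _) (ih _ ?_ _ rfl))
      rw [← hn]
      exact Finite.card_subtype_lt (p := fun j => ¬ A.rel i j) (x := i)
        (not_not.2 (Setoid.refl' _ i))

/-! ### Elements of square zero -/

theorem ext_coeff {A : Weil} {a b : A.Carrier} (h : ∀ s, A.coeff s a = A.coeff s b) : a = b := by
  rw [← A.sum_coeff_mon a, ← A.sum_coeff_mon b]
  simp only [h]

/-- Coefficients are natural numbers, so nothing can cancel. -/
theorem eq_zero_of_add {A : Weil} {a b : A.Carrier} (h : a + b = 0) : a = 0 := by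
  refine ext_coeff fun s => ?_
  have := congrArg (A.coeff s) h
  simp only [map_add, map_zero] at this ⊢
  omega

theorem sq_zero_of_add {A : Weil} {a b : A.Carrier} (h : (a + b) * (a + b) = 0) :
    a * a = 0 ∧ a * b = 0 ∧ b * b = 0 := by
  have h1 : a * a + (a * b + (b * a + b * b)) = 0 := by rw [← h]; ring
  have h2 : a * b + (a * a + (b * a + b * b)) = 0 := by rw [← h]; ring
  have h3 : b * b + (a * a + (b * a + a * b)) = 0 := by rw [← h]; ring
  exact ⟨eq_zero_of_add h1, eq_zero_of_add h2, eq_zero_of_add h3⟩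

/-- The morphism `W ⟶ A` that corresponds to an element of square zero. -/
noncomputable def sqHom {A : Weil} (a : A.Carrier) (h : a * a = 0) : W ⟶ A :=
  desc (fun _ => a) (fun _ _ _ => h)

theorem sqHom_x {A : Weil} (a : A.Carrier) (h : a * a = 0) (i : W.gen) :
    (sqHom a h).hom (W.x i) = a := desc_x (A := W) _ _ _

theorem sqHom_comp {A B : Weil} (a : A.Carrier) (h : a * a = 0) (f : A ⟶ B) :
    sqHom a h ≫ f = sqHom (f.hom a) (by rw [← map_mul, h, map_zero]) :=
  hom_ext fun i => by
    rw [comp_hom, RingHom.comp_apply, sqHom_x]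
    exact (sqHom_x _ _ i).symm

theorem sqHom_ex : sqHom ex ex_mul_ex = 𝟙 W := hom_ext fun i => (sqHom_x _ _ i).trans rfl

theorem sqHom_zero (A : Weil) : sqHom (0 : A.Carrier) (zero_mul _) = aug W ≫ zero A :=
  hom_ext fun i => by
    rw [comp_hom, RingHom.comp_apply, sqHom_x, aug]
    refine Eq.trans ?_ (congrArg _ (desc_x (A := W) _ _ _).symm)
    exact (map_zero _).symm

theorem mon_monOne (A : Weil) : A.mon A.monOne = 1 := map_one A.con.mk'

theorem monOne_or_exists {A : Weil} (s : A.Mon) : s = A.monOne ∨ ∃ i, s.exp i ≠ 0 := by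
  by_cases h : s.exp = 0
  · exact Or.inl (Mon.ext h)
  · exact Or.inr (Finsupp.ne_iff.1 h)

theorem mon_mul_self {A : Weil} {s : A.Mon} (h : s ≠ A.monOne) : A.mon s * A.mon s = 0 := by
  obtain ⟨i, hi⟩ := (monOne_or_exists s).resolve_left h
  rw [mon, ← map_mul, MvPolynomial.monomial_mul, one_mul]
  refine A.mk_monomial_eq_zero _ fun H => H i i (Setoid.refl' _ i) ?_
  have : Finsupp.single i 1 ≤ s.exp := Finsupp.single_le_iff.2 (Nat.one_le_iff_ne_zero.2 hi)
  exact add_le_add this this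

/-- Makes `1` fall under the default branch of `lamEl`, where the zero section is prescribed. -/
theorem one_mul_one_ne_zero (A : Weil) : (1 : A.Carrier) * 1 ≠ 0 := by
  rw [one_mul, ← mon_monOne]
  intro h
  have := congrArg (A.coeff A.monOne) h
  rw [coeff_mon, if_pos rfl, map_zero] at this
  exact one_ne_zero this

/-! ### The monomials of `W^σ` -/

theorem not_single_add_single_le {σ : Type*} (a b i : σ) :
    ¬ (Finsupp.single a 1 + Finsupp.single b 1 ≤ (Finsupp.single i 1 : σ →₀ ℕ)) := by
  intro h
  have := Finsupp.degree_mono h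
  rw [map_add, Finsupp.degree_single, Finsupp.degree_single, Finsupp.degree_single] at this
  omega

theorem single_add_single_le {σ : Type*} {i j : σ} (h : i ≠ j) {f : σ →₀ ℕ} (hi : f i ≠ 0)
    (hj : f j ≠ 0) : Finsupp.single i 1 + Finsupp.single j 1 ≤ f := by
  classical
  refine Finsupp.le_def.2 fun k => ?_
  rw [Finsupp.add_apply, Finsupp.single_apply, Finsupp.single_apply]
  split_ifs with h1 h2 h2
  · exact (h (h1.trans h2.symm)).elim
  · subst h1; omega
  · subst h2; omega
  · omega

/-- The monomials of `W^σ` are `1` and the generators. -/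
noncomputable def monPow (σ : Type) [Finite σ] : Option σ ≃ (pow σ).Mon := by
  refine Equiv.ofBijective (fun o => o.elim (pow σ).monOne fun i =>
    ⟨Finsupp.single i 1, fun a b _ => not_single_add_single_le a b i⟩) ⟨?_, ?_⟩
  · rintro (_ | i) (_ | j) h
    · rfl
    · exact absurd (congrArg Mon.exp h).symm (Finsupp.single_ne_zero.2 one_ne_zero)
    · exact absurd (congrArg Mon.exp h) (Finsupp.single_ne_zero.2 one_ne_zero)
    · exact congrArg some (Finsupp.single_left_injective one_ne_zero (congrArg Mon.exp h))
  · intro s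
    rcases monOne_or_exists s with rfl | ⟨i, hi⟩
    · exact ⟨none, rfl⟩
    · refine ⟨some i, Mon.ext (Finsupp.ext fun (j : σ) => ?_)⟩
      change Finsupp.single i 1 j = s.exp j
      by_cases hj : i = j
      · subst hj
        rw [Finsupp.single_eq_same]
        exact le_antisymm (Nat.one_le_iff_ne_zero.2 hi) (s.le_one i)
      · rw [Finsupp.single_eq_of_ne' hj]
        by_contra h0
        -- Two distinct generators in one monomial of `W^σ` would make it zero, as all pairs are
        -- related.
        exact s.2 i j trivial (single_add_single_le hj hi (Ne.symm h0))

theorem mon_monPow_none (σ : Type) [Finite σ] : (pow σ).mon (monPow σ none) = 1 :=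
  mon_monOne _

theorem mon_monPow_some (σ : Type) [Finite σ] (i : σ) :
    (pow σ).mon (monPow σ (some i)) = (pow σ).x i := rfl

theorem mat_monPow_none {σ : Type} [Finite σ] {A : Weil} (f : pow σ ⟶ A) (t : A.Mon) :
    mat f t (monPow σ none) = if t = A.monOne then 1 else 0 := by
  rw [mat_apply, mon_monPow_none, map_one, ← mon_monOne, coeff_mon]

theorem mat_monPow_some {σ : Type} [Finite σ] {A : Weil} (f : pow σ ⟶ A) (t : A.Mon) (i : σ) :
    mat f t (monPow σ (some i)) = A.coeff t (f.hom ((pow σ).x i)) := rfl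

theorem powFst_inl (σ τ : Type) [Finite σ] [Finite τ] (i : σ) :
    (powFst σ τ).hom ((pow (σ ⊕ τ)).x (Sum.inl i)) = (pow σ).x i := desc_x (A := pow (σ ⊕ τ)) _ _ _
theorem powFst_inr (σ τ : Type) [Finite σ] [Finite τ] (i : τ) :
    (powFst σ τ).hom ((pow (σ ⊕ τ)).x (Sum.inr i)) = 0 := desc_x (A := pow (σ ⊕ τ)) _ _ _
theorem powSnd_inl (σ τ : Type) [Finite σ] [Finite τ] (i : σ) :
    (powSnd σ τ).hom ((pow (σ ⊕ τ)).x (Sum.inl i)) = 0 := desc_x (A := pow (σ ⊕ τ)) _ _ _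
theorem powSnd_inr (σ τ : Type) [Finite σ] [Finite τ] (i : τ) :
    (powSnd σ τ).hom ((pow (σ ⊕ τ)).x (Sum.inr i)) = (pow τ).x i := desc_x (A := pow (σ ⊕ τ)) _ _ _

end Weil

/-! ### Limits preserved by the powers of `T` are preserved by every `T_A` -/

section StableLimits

/-- If four functors form a square of natural transformations that is pointwise a pullback, then the
first one preserves the limit cones that the others preserve. -/
theorem isLimit_mapCone_of_isPullback {J : Type} [SmallCategory J] {X : Type u} [Category.{v} X]
    {Z : Type u'} [Category.{v'} Z] {K : J ⥤ X} {c : Cone K} {F₀ F₁ F₂ F₃ : X ⥤ Z}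
    (f : F₀ ⟶ F₁) (g : F₀ ⟶ F₂) (h : F₁ ⟶ F₃) (k : F₂ ⟶ F₃)
    (sq : ∀ x, IsPullback (f.app x) (g.app x) (h.app x) (k.app x))
    (h₁ : Nonempty (IsLimit (F₁.mapCone c))) (h₂ : Nonempty (IsLimit (F₂.mapCone c)))
    (h₃ : Nonempty (IsLimit (F₃.mapCone c))) : Nonempty (IsLimit (F₀.mapCone c)) := by
  obtain ⟨h₁⟩ := h₁
  obtain ⟨h₂⟩ := h₂
  obtain ⟨h₃⟩ := h₃
  have e₁ (s : Cone (K ⋙ F₀)) (j : J) :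
      h₁.lift ((Cone.postcompose (Functor.whiskerLeft K f)).obj s) ≫ F₁.map (c.π.app j) =
        s.π.app j ≫ f.app (K.obj j) := h₁.fac _ j
  have e₂ (s : Cone (K ⋙ F₀)) (j : J) :
      h₂.lift ((Cone.postcompose (Functor.whiskerLeft K g)).obj s) ≫ F₂.map (c.π.app j) =
        s.π.app j ≫ g.app (K.obj j) := h₂.fac _ j
  have w (s : Cone (K ⋙ F₀)) :
      h₁.lift ((Cone.postcompose (Functor.whiskerLeft K f)).obj s) ≫ h.app c.pt =
        h₂.lift ((Cone.postcompose (Functor.whiskerLeft K g)).obj s) ≫ k.app c.pt := by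
    -- Of the limit cone under `F₃` only joint monicity is used: the two lifts are compared on each
    -- leg.
    refine h₃.hom_ext fun j => ?_
    change (_ ≫ _) ≫ F₃.map (c.π.app j) = (_ ≫ _) ≫ F₃.map (c.π.app j)
    rw [Category.assoc, Category.assoc, ← h.naturality, ← k.naturality, ← Category.assoc,
      ← Category.assoc, e₁, e₂, Category.assoc, Category.assoc, (sq _).w]
  refine ⟨⟨fun s => (sq c.pt).lift _ _ (w s), fun s j => ?_, fun s m hm => ?_⟩⟩
  · refine (sq (K.obj j)).hom_ext ?_ ?_
    · change (_ ≫ F₀.map (c.π.app j)) ≫ _ = _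
      rw [Category.assoc, f.naturality, ← Category.assoc]
      change (_ ≫ f.app c.pt) ≫ _ = _
      rw [IsPullback.lift_fst, e₁]
    · change (_ ≫ F₀.map (c.π.app j)) ≫ _ = _
      rw [Category.assoc, g.naturality, ← Category.assoc]
      change (_ ≫ g.app c.pt) ≫ _ = _
      rw [IsPullback.lift_snd, e₂]
  · have hm' (j : J) : m ≫ F₀.map (c.π.app j) = s.π.app j := hm j
    refine (sq c.pt).hom_ext ?_ ?_
    · rw [IsPullback.lift_fst]
      refine h₁.hom_ext fun j => ?_
      change (_ ≫ _) ≫ F₁.map (c.π.app j) = _ ≫ F₁.map (c.π.app j)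
      rw [e₁, Category.assoc, ← f.naturality, ← Category.assoc, hm']
    · rw [IsPullback.lift_snd]
      refine h₂.hom_ext fun j => ?_
      change (_ ≫ _) ≫ F₂.map (c.π.app j) = _ ≫ F₂.map (c.π.app j)
      rw [e₂, Category.assoc, ← g.naturality, ← Category.assoc, hm']

variable {X : Type u} [Category.{v} X] [MonoidalLeftAction Weil X]

variable (X) in
/-- The action of a Weil algebra. -/
noncomputable abbrev actFun (A : Weil) : X ⥤ X where
  obj M := A ⊙ₗ M
  map f := A ⊴ₗ f

/-- The action of a morphism of Weil algebras. -/
noncomputable abbrev actNat {A B : Weil} (θ : A ⟶ B) : actFun X A ⟶ actFun X B where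
  app M := θ ⊵ₗ M
  naturality _ _ f := action_exchange θ f

/-- Isomorphic Weil algebras act by isomorphic functors. -/
noncomputable def actionIso {A B : Weil} (e : A ≅ B) : actFun X A ≅ actFun X B :=
  NatIso.ofComponents (fun M => ⟨e.hom ⊵ₗ M, e.inv ⊵ₗ M, by simp, by simp⟩)
    (fun f => action_exchange e.hom f)

/-- The coproduct of Weil algebras acts by the composite. -/
noncomputable def actionTensorIso (A B : Weil) :
    actFun X (A ⊗ B) ≅ actFun X B ⋙ actFun X A :=
  NatIso.ofComponents (fun M => αₗ A B M) (fun f => by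
    change (A ⊗ B) ⊴ₗ f ≫ _ = _ ≫ A ⊴ₗ (B ⊴ₗ f)
    simp)

/-- The unit acts by the identity. -/
noncomputable def actionUnitIdIso : actFun X (𝟙_ Weil) ≅ 𝟭 X :=
  NatIso.ofComponents (fun M => λₗ M) (fun f => by
    change 𝟙_ Weil ⊴ₗ f ≫ _ = _ ≫ f
    simp)

/-- `TanPow` adds the new factor on the outside, while the induction over Weil algebras produces it
on the inside. -/
theorem tan_comp_tanPow (n : ℕ) : Tan X ⋙ TanPow X n = TanPow X (n + 1) := by
  induction n with
  | zero => rfl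
  | succ n ih => exact congrArg (· ⋙ Tan X) ih

/-- A limit cone is stable if it is preserved by the powers of the tangent functor. -/
def IsStableLimit {J : Type} [SmallCategory J] {K : J ⥤ X} (c : Cone K) : Prop :=
  ∀ n, Nonempty (IsLimit ((TanPow X n).mapCone c))

theorem IsStableLimit.action [IsTangentActegory X] (A : Weil) {J : Type} [SmallCategory J]
    {K : J ⥤ X} {c : Cone K} (hc : IsStableLimit c) :
    IsStableLimit ((actFun X A).mapCone c) := by
  induction A using Weil.induction generalizing K c with
  | iso e ih =>
    exact fun n => (ih hc n).map
      (IsLimit.mapConeEquiv (Functor.isoWhiskerRight (actionIso e) (TanPow X n)))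
  | unit =>
    exact fun n => (hc n).map
      (IsLimit.mapConeEquiv (Functor.isoWhiskerRight (actionUnitIdIso).symm (TanPow X n)))
  | dual =>
    exact fun n => (hc (n + 1)).map (IsLimit.mapConeEquiv (eqToIso (tan_comp_tanPow n).symm))
  | sum σ τ hσ hτ =>
    intro n
    let w {A B : Weil} (f : A ⟶ B) :
      actFun X A ⋙ TanPow X n ⟶ actFun X B ⋙ TanPow X n :=
      Functor.whiskerRight (actNat f) (TanPow X n)
    -- The foundational pullbacks exhibit `Tⁿ ∘ T_{W^(σ ⊕ τ)}` as a pointwise pullback of functors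
    -- that are known to preserve the cone. The corner of the square is `Tⁿ ∘ T_ℕ ≅ Tⁿ`.
    refine isLimit_mapCone_of_isPullback (F₀ := actFun X _ ⋙ TanPow X n)
      (w (Weil.powFst σ τ)) (w (Weil.powSnd σ τ)) (w (Weil.aug _)) (w (Weil.aug _))
      (fun M => IsTangentActegory.foundational n σ τ M) (hσ hc n) (hτ hc n) ?_
    exact (hc n).map
      (IsLimit.mapConeEquiv (Functor.isoWhiskerRight (actionUnitIdIso).symm (TanPow X n)))
  | tensor A B hA hB =>
    exact fun n => (hA (hB hc) n).map
      (IsLimit.mapConeEquiv (Functor.isoWhiskerRight (actionTensorIso A B).symm (TanPow X n)))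

/-- The functors that are isomorphic to the action of a Weil algebra. -/
def IsAction (G : X ⥤ X) : Prop := ∃ A : Weil, Nonempty (actFun X A ≅ G)

theorem IsAction.action (A : Weil) : IsAction (actFun X A) := ⟨A, ⟨Iso.refl _⟩⟩

theorem IsAction.id : IsAction (𝟭 X) := ⟨𝟙_ Weil, ⟨actionUnitIdIso⟩⟩

theorem IsAction.comp (A : Weil) {G : X ⥤ X} (hG : IsAction G) :
    IsAction (actFun X A ⋙ G) := by
  obtain ⟨C, ⟨e⟩⟩ := hG
  exact ⟨C ⊗ A, ⟨actionTensorIso C A ≪≫ Functor.isoWhiskerLeft (actFun X A) e⟩⟩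

theorem IsStableLimit.isLimit [IsTangentActegory X] {G : X ⥤ X} (hG : IsAction G) {J : Type}
    [SmallCategory J] {K : J ⥤ X} {c : Cone K} (hc : IsStableLimit c) :
    Nonempty (IsLimit (G.mapCone c)) := by
  obtain ⟨A, ⟨e⟩⟩ := hG
  exact (hc.action A 0).map (IsLimit.mapConeEquiv e)

/-- The axioms only speak of the powers of `T`. This transfers each of their pullbacks to all `T_A`.
-/
theorem isPullback_map_of_isAction [IsTangentActegory X] {P Q R S : X} {f : P ⟶ Q} {g : P ⟶ R}
    {h : Q ⟶ S} {k : R ⟶ S} (sq : ∀ n, IsPullback ((TanPow X n).map f) ((TanPow X n).map g)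
      ((TanPow X n).map h) ((TanPow X n).map k)) {G : X ⥤ X} (hG : IsAction G) :
    IsPullback (G.map f) (G.map g) (G.map h) (G.map k) := by
  have w : f ≫ h = g ≫ k := (sq 0).w
  have hc : IsStableLimit (PullbackCone.mk f g w) := fun n =>
    ⟨(isLimitMapConePullbackConeEquiv (TanPow X n) w).symm (sq n).isLimit⟩
  obtain ⟨hl⟩ := hc.isLimit hG
  exact ⟨⟨by rw [← G.map_comp, w, G.map_comp]⟩, ⟨isLimitMapConePullbackConeEquiv G w hl⟩⟩

theorem foundational_isAction [IsTangentActegory X] {G : X ⥤ X} (hG : IsAction G) (σ τ : Type)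
    [Finite σ] [Finite τ] (M : X) :
    IsPullback (G.map (Weil.powFst σ τ ⊵ₗ M)) (G.map (Weil.powSnd σ τ ⊵ₗ M))
      (G.map (Weil.aug (Weil.pow σ) ⊵ₗ M)) (G.map (Weil.aug (Weil.pow τ) ⊵ₗ M)) :=
  isPullback_map_of_isAction (fun n => IsTangentActegory.foundational n σ τ M) hG

end StableLimits

/-! ### Images of additive bundles under functors, and additive morphisms -/

section Image

variable {X : Type u} [Category.{v} X] {Z : Type u'} [Category.{v'} Z]

namespace PowBundle

/-- A functor that preserves the pullback powers of a bundle. -/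
abbrev PreservedBy (B : PowBundle X) (G : X ⥤ Z) : Prop := ∀ n, PreservesLimit (B.diagram n) G

theorem map_hom_ext (B : PowBundle X) {G : X ⥤ Z} (hG : B.PreservedBy G) {n : ℕ} {Y : Z}
    {f g : Y ⟶ G.obj (B.pow n)} (hb : f ≫ G.map (B.base n) = g ≫ G.map (B.base n))
    (h : ∀ i, f ≫ G.map (B.proj n i) = g ≫ G.map (B.proj n i)) : f = g := by
  have := hG n
  refine (isLimitOfPreserves G (limit.isLimit (B.diagram n))).hom_ext ?_
  rintro (_ | i)
  · exact hb
  · exact h i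

theorem mapLift_base (B : PowBundle X) (G : X ⥤ Z) {n : ℕ}
    [PreservesLimit (B.diagram n) G] {Y : Z} (m : Y ⟶ G.obj B.M) (a : Fin n → (Y ⟶ G.obj B.E))
    (h : ∀ i, a i ≫ G.map B.q = m) : B.mapLift G m a h ≫ G.map (B.base n) = m :=
  (isLimitOfPreserves G (limit.isLimit (B.diagram n))).fac
    (WidePullbackShape.mkCone (F := B.diagram n ⋙ G) m a h) none

/-- The image of a bundle under a functor that preserves its pullback powers. -/
abbrev image (B : PowBundle X) (G : X ⥤ Z) (hG : B.PreservedBy G) : PowBundle Z where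
  E := G.obj B.E
  M := G.obj B.M
  q := G.map B.q
  hasPow n := by
    have := hG n
    exact hasLimit_of_iso (WidePullbackShape.diagramIsoWideCospan (B.diagram n ⋙ G))

section MapPair

variable (B : PowBundle X) {G : X ⥤ Z} (hG : B.PreservedBy G)

/-- The morphism `⟨a, b⟩ : Y ⟶ G E₂`. -/
noncomputable def gPair {Y : Z} (a b : Y ⟶ G.obj B.E) (h : a ≫ G.map B.q = b ≫ G.map B.q) :
    Y ⟶ G.obj (B.pow 2) :=
  haveI := hG 2
  B.mapPair G a b h

theorem gPair_proj_zero {Y : Z} (a b : Y ⟶ G.obj B.E) (h : a ≫ G.map B.q = b ≫ G.map B.q) :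
    B.gPair hG a b h ≫ G.map (B.proj 2 0) = a :=
  haveI := hG 2
  B.mapLift_proj G _ _ _ 0

theorem gPair_proj_one {Y : Z} (a b : Y ⟶ G.obj B.E) (h : a ≫ G.map B.q = b ≫ G.map B.q) :
    B.gPair hG a b h ≫ G.map (B.proj 2 1) = b :=
  haveI := hG 2
  B.mapLift_proj G _ _ _ 1

theorem gPair_base {Y : Z} (a b : Y ⟶ G.obj B.E) (h : a ≫ G.map B.q = b ≫ G.map B.q) :
    B.gPair hG a b h ≫ G.map (B.base 2) = a ≫ G.map B.q :=
  haveI := hG 2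
  B.mapLift_base G _ _ _

theorem eq_gPair {Y : Z} {a b : Y ⟶ G.obj B.E} (h : a ≫ G.map B.q = b ≫ G.map B.q)
    {f : Y ⟶ G.obj (B.pow 2)} (h₀ : f ≫ G.map (B.proj 2 0) = a)
    (h₁ : f ≫ G.map (B.proj 2 1) = b) : f = B.gPair hG a b h := by
  refine B.map_hom_ext hG ?_ fun i => ?_
  · rw [gPair_base, ← B.proj_q 2 0, G.map_comp, ← Category.assoc, h₀]
  · fin_cases i
    · exact h₀.trans (B.gPair_proj_zero hG a b h).symm
    · exact h₁.trans (B.gPair_proj_one hG a b h).symm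

theorem comp_gPair {Y Y' : Z} (f : Y' ⟶ Y) (a b : Y ⟶ G.obj B.E)
    (h : a ≫ G.map B.q = b ≫ G.map B.q) :
    f ≫ B.gPair hG a b h =
      B.gPair hG (f ≫ a) (f ≫ b) (by rw [Category.assoc, h, Category.assoc]) :=
  B.eq_gPair hG _ (by rw [Category.assoc, gPair_proj_zero])
    (by rw [Category.assoc, gPair_proj_one])

theorem map_pair {Y : X} (a b : Y ⟶ B.E) (h : a ≫ B.q = b ≫ B.q) :
    G.map (B.pair a b h) =
      B.gPair hG (G.map a) (G.map b) (by rw [← G.map_comp, h, G.map_comp]) :=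
  B.eq_gPair hG _ (by rw [← G.map_comp, pair_proj_zero]) (by rw [← G.map_comp, pair_proj_one])

theorem gPair_congr {Y : Z} {a b a' b' : Y ⟶ G.obj B.E} (h : a ≫ G.map B.q = b ≫ G.map B.q)
    (ha : a = a') (hb : b = b') :
    B.gPair hG a b h = B.gPair hG a' b' (by rw [← ha, ← hb, h]) := by
  subst ha hb; rfl

theorem comp_map_pair_comp {Y : X} {Y' : Z} (f : Y' ⟶ G.obj Y) (a b : Y ⟶ B.E)
    (h : a ≫ B.q = b ≫ B.q) {E' : X} (s : B.pow 2 ⟶ E') :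
    f ≫ G.map (B.pair a b h ≫ s) = B.gPair hG (f ≫ G.map a) (f ≫ G.map b)
      (by rw [Category.assoc, Category.assoc, ← G.map_comp, h, G.map_comp]) ≫ G.map s := by
  rw [G.map_comp, B.map_pair hG, ← Category.assoc, B.comp_gPair]

end MapPair

end PowBundle

namespace AddBundle

/-- The image of an additive bundle under a functor that preserves its pullback powers. -/
noncomputable abbrev image (B : AddBundle X) (G : X ⥤ Z) (hG : B.PreservedBy G) : AddBundle Z :=
  -- The chosen pullback powers of the image are only isomorphic to `G Eₙ`, so its addition passes
  -- through a comparison map. On generalized elements the comparison disappears, and each axiom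
  -- becomes the image under `G` of the corresponding axiom of `B`.
  have key {Y : Z} (a b : Y ⟶ G.obj B.E) (h : a ≫ G.map B.q = b ≫ G.map B.q) :
      (B.toPowBundle.image G hG).pair a b h ≫
        B.gPair hG ((B.toPowBundle.image G hG).proj 2 0) ((B.toPowBundle.image G hG).proj 2 1)
          ((B.toPowBundle.image G hG).proj_q' 2 0 1) ≫ G.map B.σ =
        B.gPair hG a b h ≫ G.map B.σ := by
    rw [← Category.assoc, PowBundle.comp_gPair]
    exact congrArg (· ≫ G.map B.σ) (B.gPair_congr hG _
      ((B.toPowBundle.image G hG).pair_proj_zero a b h)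
      ((B.toPowBundle.image G hG).pair_proj_one a b h))
  { B.toPowBundle.image G hG with
    ζ := G.map B.ζ
    σ := B.gPair hG ((B.toPowBundle.image G hG).proj 2 0) ((B.toPowBundle.image G hG).proj 2 1)
      ((B.toPowBundle.image G hG).proj_q' 2 0 1) ≫ G.map B.σ
    ζ_q := by rw [← G.map_comp, B.ζ_q, G.map_id]
    σ_q := by
      rw [Category.assoc, ← G.map_comp, B.σ_q, PowBundle.gPair_base]
      exact (B.toPowBundle.image G hG).proj_q 2 0
    add_assoc := by
      have := hG 3
      -- The comparison from the chosen third pullback power to `G E₃`, along which associativity in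
      -- `B` is pulled back.
      let u := B.mapLift G (n := 3) ((B.toPowBundle.image G hG).base 3)
        ((B.toPowBundle.image G hG).proj 3) ((B.toPowBundle.image G hG).proj_q 3)
      have hu (i : Fin 3) : u ≫ G.map (B.proj 3 i) = (B.toPowBundle.image G hG).proj 3 i :=
        B.mapLift_proj G _ _ _ i
      refine (key _ _ _).trans (Eq.trans ?_ (((B.comp_map_pair_comp hG u _ _ _ B.σ).symm.trans
        ((congrArg (fun f => u ≫ G.map f) B.add_assoc).trans
          (B.comp_map_pair_comp hG u _ _ _ B.σ))).trans (Eq.trans ?_ (key _ _ _).symm)))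
      · refine congrArg (· ≫ G.map B.σ) (B.gPair_congr hG _ ?_ (hu 2).symm)
        refine (key _ _ _).trans (Eq.trans ?_ (B.comp_map_pair_comp hG u _ _ _ B.σ).symm)
        exact congrArg (· ≫ G.map B.σ) (B.gPair_congr hG _ (hu 0).symm (hu 1).symm)
      · refine congrArg (· ≫ G.map B.σ) (B.gPair_congr hG _ (hu 0) ?_)
        refine (B.comp_map_pair_comp hG u _ _ _ B.σ).trans (Eq.trans ?_ (key _ _ _).symm)
        exact congrArg (· ≫ G.map B.σ) (B.gPair_congr hG _ (hu 1) (hu 2))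
    add_comm := by
      refine (key _ _ _).trans ?_
      refine Eq.trans ?_ (congrArg (_ ≫ G.map ·) B.add_comm)
      rw [B.comp_map_pair_comp hG]
      exact congrArg (· ≫ G.map B.σ) (B.gPair_congr hG _ (B.gPair_proj_one hG _ _ _).symm
        (B.gPair_proj_zero hG _ _ _).symm)
    zero_add := by
      refine (key _ _ _).trans ?_
      refine Eq.trans ?_ ((congrArg (𝟙 _ ≫ G.map ·) B.zero_add).trans
        ((Category.id_comp _).trans (G.map_id _)))
      rw [B.comp_map_pair_comp hG]
      refine congrArg (· ≫ G.map B.σ) (B.gPair_congr hG _ ?_ ?_)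
      · exact (G.map_comp _ _).symm.trans (Category.id_comp _).symm
      · exact (G.map_id _).symm.trans (Category.id_comp _).symm }

/-- Computes sums in the image without mentioning its chosen pullback powers. All later calculations
with sums go through this formula. -/
theorem image_add_hom (B : AddBundle X) {G : X ⥤ Z} (hG : B.PreservedBy G) {Y : Z}
    {m : Y ⟶ G.obj B.M} (a b : (B.image G hG).Over m) :
    (a + b).hom = B.gPair hG a.hom b.hom (a.w.trans b.w.symm) ≫ G.map B.σ := by
  refine (Category.assoc _ _ _).symm.trans ?_
  rw [PowBundle.comp_gPair]
  exact congrArg (· ≫ G.map B.σ) (B.gPair_congr hG _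
    ((B.image G hG).pair_proj_zero _ _ _) ((B.image G hG).pair_proj_one _ _ _))

/-- A functor that preserves the pullback powers maps the morphisms over the base. -/
noncomputable def mapOver (B : AddBundle X) {G : X ⥤ Z} (hG : B.PreservedBy G) {Y : X}
    {m : Y ⟶ B.M} {m' : G.obj Y ⟶ G.obj B.M} (h : G.map m = m') :
    B.Over m →+ (B.image G hG).Over m' where
  toFun a := ⟨G.map a.hom, (G.map_comp _ _).symm.trans ((congrArg G.map a.w).trans h)⟩
  map_zero' := Over.ext' (by
    refine (G.map_comp _ _).trans ?_
    rw [h]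
    rfl)
  map_add' a b := Over.ext' (by
    rw [image_add_hom]
    refine (G.map_comp _ _).trans ?_
    rw [B.map_pair hG])

/-- A functor maps the morphisms into the image of a bundle. -/
noncomputable def mapImageOver (B : AddBundle X) {G : X ⥤ X} {G' : X ⥤ X} (hG : B.PreservedBy G)
    (hGG' : B.PreservedBy (G ⋙ G')) {Y : X} {m : Y ⟶ G.obj B.M} {Y' : X} (f : Y' ⟶ G'.obj Y)
    {m' : Y' ⟶ G'.obj (G.obj B.M)} (h : f ≫ G'.map m = m') :
    (B.image G hG).Over m →+ (B.image (G ⋙ G') hGG').Over m' where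
  toFun a := ⟨f ≫ G'.map a.hom, (Category.assoc _ _ _).trans
    ((congrArg (f ≫ ·) ((G'.map_comp _ _).symm.trans (congrArg G'.map a.w))).trans h)⟩
  map_zero' := Over.ext' ((congrArg (f ≫ ·) (G'.map_comp _ _)).trans
    ((Category.assoc _ _ _).symm.trans (congrArg (· ≫ G'.map (G.map B.ζ)) h)))
  map_add' a b := Over.ext' (by
    refine ((congrArg (fun g => f ≫ G'.map g) (B.image_add_hom hG a b)).trans ?_).trans
      (B.image_add_hom hGG' _ _).symm
    rw [G'.map_comp, ← Category.assoc]
    refine congrArg (· ≫ G'.map (G.map B.σ)) (B.eq_gPair hGG' _ ?_ ?_)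
    · refine (Category.assoc _ _ _).trans ?_
      refine congrArg (f ≫ ·) ((G'.map_comp _ _).symm.trans ?_)
      rw [PowBundle.gPair_proj_zero]
    · refine (Category.assoc _ _ _).trans ?_
      refine congrArg (f ≫ ·) ((G'.map_comp _ _).symm.trans ?_)
      rw [PowBundle.gPair_proj_one])

theorem mapImageOver_hom (B : AddBundle X) {G : X ⥤ X} {G' : X ⥤ X} (hG : B.PreservedBy G)
    (hGG' : B.PreservedBy (G ⋙ G')) {Y : X} {m : Y ⟶ G.obj B.M} {Y' : X} (f : Y' ⟶ G'.obj Y)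
    {m' : Y' ⟶ G'.obj (G.obj B.M)} (h : f ≫ G'.map m = m') (a : (B.image G hG).Over m) :
    (B.mapImageOver hG hGG' f h a).hom = f ≫ G'.map a.hom := rfl

/-- Additive morphisms of additive bundles. -/
structure IsAddMap (B B' : AddBundle X) (f : B.E ⟶ B'.E) (g : B.M ⟶ B'.M) : Prop where
  w : f ≫ B'.q = B.q ≫ g
  zero : B.ζ ≫ f = g ≫ B'.ζ
  add : B.σ ≫ f = B'.pair (B.proj 2 0 ≫ f) (B.proj 2 1 ≫ f) (by
    rw [Category.assoc, Category.assoc, w, ← Category.assoc, ← Category.assoc,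
      B.proj_q' 2 0 1]) ≫ B'.σ

/-- The addition is the universal sum, so identities for `σ` can be read off from generalized
elements. -/
theorem projOver_add_hom (B : AddBundle X) :
    (B.projOver 2 0 + B.projOver 2 1).hom = B.σ := by
  rw [Over.add_hom]
  refine Eq.trans (congrArg (· ≫ B.σ) ?_) (Category.id_comp _)
  refine B.pow_hom_ext ?_ fun i => ?_
  · rw [PowBundle.pair_base, Category.id_comp]
    exact B.proj_q 2 0
  · rw [Category.id_comp]
    fin_cases i
    · exact B.pair_proj_zero _ _ _
    · exact B.pair_proj_one _ _ _

namespace IsAddMap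

variable {B B' B'' : AddBundle X} {f : B.E ⟶ B'.E} {g : B.M ⟶ B'.M}

/-- Postcomposition with an additive morphism. -/
noncomputable def push (h : IsAddMap B B' f g) {Y : X} {m : Y ⟶ B.M} {m' : Y ⟶ B'.M}
    (hm : m ≫ g = m') : B.Over m →+ B'.Over m' where
  toFun a := ⟨a.hom ≫ f, by rw [Category.assoc, h.w, ← Category.assoc, a.w, hm]⟩
  map_zero' := Over.ext' (by
    refine (Category.assoc _ _ _).trans ?_
    rw [Over.zero_hom, h.zero, ← Category.assoc, hm])
  map_add' a b := Over.ext' (by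
    refine (Category.assoc _ _ _).trans ?_
    rw [Over.add_hom, h.add, ← Category.assoc, comp_pair]
    refine congrArg (· ≫ B'.σ) (pair_congr _ ?_ ?_)
    · rw [← Category.assoc, PowBundle.pair_proj_zero]
    · rw [← Category.assoc, PowBundle.pair_proj_one])

theorem push_hom (h : IsAddMap B B' f g) {Y : X} {m : Y ⟶ B.M} {m' : Y ⟶ B'.M}
    (hm : m ≫ g = m') (a : B.Over m) : (h.push hm a).hom = a.hom ≫ f := rfl

/-- A morphism is additive if it respects the sums of all morphisms over the base. -/
theorem of_over (w : f ≫ B'.q = B.q ≫ g) (zero : B.ζ ≫ f = g ≫ B'.ζ)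
    (add : ∀ {Y : X} {m : Y ⟶ B.M} (a b : B.Over m) (a' b' : B'.Over (m ≫ g)),
      a.hom ≫ f = a'.hom → b.hom ≫ f = b'.hom → (a + b).hom ≫ f = (a' + b').hom) :
    IsAddMap B B' f g where
  w := w
  zero := zero
  add := by
    have hw (i : Fin 2) : (B.proj 2 i ≫ f) ≫ B'.q = B.base 2 ≫ g := by
      rw [Category.assoc, w, ← Category.assoc, B.proj_q]
    refine Eq.trans ?_ (add (B.projOver 2 0) (B.projOver 2 1) ⟨_, hw 0⟩ ⟨_, hw 1⟩ rfl rfl)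
    rw [projOver_add_hom]

theorem comp (h : IsAddMap B B' f g) {f' : B'.E ⟶ B''.E} {g' : B'.M ⟶ B''.M}
    (h' : IsAddMap B' B'' f' g') : IsAddMap B B'' (f ≫ f') (g ≫ g') := by
  refine of_over ?_ ?_ ?_
  · rw [Category.assoc, h'.w, ← Category.assoc, h.w, Category.assoc]
  · rw [← Category.assoc, h.zero, Category.assoc, h'.zero, Category.assoc]
  · intro Y m a b a' b' ha hb
    have ea : a' = h'.push (Category.assoc m g g') (h.push rfl a) :=
      Over.ext' (ha.symm.trans (Category.assoc _ _ _).symm)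
    have eb : b' = h'.push (Category.assoc m g g') (h.push rfl b) :=
      Over.ext' (hb.symm.trans (Category.assoc _ _ _).symm)
    rw [ea, eb, ← map_add, ← map_add, push_hom, push_hom, Category.assoc]

theorem congr (h : IsAddMap B B' f g) {f' : B.E ⟶ B'.E} {g' : B.M ⟶ B'.M} (hf : f = f')
    (hg : g = g') : IsAddMap B B' f' g' := hf ▸ hg ▸ h

/-- Postcomposition with an isomorphism of additive bundles. -/
theorem push_bijective (h : IsAddMap B B' f g) {f' : B'.E ⟶ B.E} {g' : B'.M ⟶ B.M}
    (h' : IsAddMap B' B f' g') (e : f ≫ f' = 𝟙 _) (e' : f' ≫ f = 𝟙 _) (eg : g ≫ g' = 𝟙 _)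
    {Y : X} {m : Y ⟶ B.M} {m' : Y ⟶ B'.M} (hm : m ≫ g = m') :
    Function.Bijective (h.push hm) := by
  refine Function.bijective_iff_has_inverse.2
    ⟨h'.push (by rw [← hm, Category.assoc, eg, Category.comp_id]), fun a => ?_, fun a => ?_⟩
  · exact Over.ext' (by rw [push_hom, push_hom, Category.assoc, e, Category.comp_id])
  · exact Over.ext' (by rw [push_hom, push_hom, Category.assoc, e', Category.comp_id])

/-- The image of an additive morphism into an image. -/
theorem map {B B' : AddBundle X} {G G' : X ⥤ X} {hG : B'.PreservedBy G} {f : B.E ⟶ G.obj B'.E}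
    {g : B.M ⟶ G.obj B'.M} (h : IsAddMap B (B'.image G hG) f g) (hG' : B.PreservedBy G')
    (hGG' : B'.PreservedBy (G ⋙ G')) :
    IsAddMap (B.image G' hG') (B'.image (G ⋙ G') hGG') (G'.map f) (G'.map g) := by
  refine of_over ?_ ?_ ?_
  · exact (G'.map_comp _ _).symm.trans ((congrArg G'.map h.w).trans (G'.map_comp _ _))
  · exact (G'.map_comp _ _).symm.trans ((congrArg G'.map h.zero).trans (G'.map_comp _ _))
  · intro Y m a b a' b' ha hb
    -- Both `a` and `b` factor through the pair `Y ⟶ G' E₂`, followed by the two projections. Hence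
    -- `a'` and `b'` are values of one homomorphism `mapImageOver` on the composites of the
    -- projections with `f`, and the claim reduces to additivity of `f` on the universal pair.
    have hp : B.gPair hG' a.hom b.hom (a.w.trans b.w.symm) ≫ G'.map (B.base 2 ≫ g) =
        m ≫ G'.map g := by
      rw [G'.map_comp, ← Category.assoc, PowBundle.gPair_base]
      exact congrArg (· ≫ G'.map g) a.w
    have ea : a' = B'.mapImageOver hG hGG' _ hp (h.push rfl (B.projOver 2 0)) := Over.ext' (by
      rw [mapImageOver_hom, push_hom, G'.map_comp, ← Category.assoc]
      exact ha.symm.trans (congrArg (· ≫ G'.map f) (B.gPair_proj_zero hG' _ _ _).symm))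
    have eb : b' = B'.mapImageOver hG hGG' _ hp (h.push rfl (B.projOver 2 1)) := Over.ext' (by
      rw [mapImageOver_hom, push_hom, G'.map_comp, ← Category.assoc]
      exact hb.symm.trans (congrArg (· ≫ G'.map f) (B.gPair_proj_one hG' _ _ _).symm))
    rw [ea, eb, ← map_add, ← map_add, mapImageOver_hom, push_hom, projOver_add_hom, image_add_hom,
      Category.assoc, ← G'.map_comp]

end IsAddMap

variable (B : AddBundle X)

theorem preservedBy_id : B.PreservedBy (𝟭 X) := fun _ => inferInstance

/-- The image under the identity functor has the same objects, but its addition contains the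
comparison map. The two bundles are thus identified by additive identities rather than by
definition. -/
theorem isAddMap_to_id : IsAddMap B (B.image (𝟭 X) B.preservedBy_id) (𝟙 B.E) (𝟙 B.M) := by
  refine .of_over ?_ ?_ ?_
  · exact (Category.id_comp _).trans (Category.comp_id _).symm
  · exact (Category.comp_id _).trans (Category.id_comp _).symm
  · intro Y m a b a' b' ha hb
    rw [image_add_hom, Over.add_hom, Category.comp_id]
    refine congrArg (· ≫ B.σ) (B.eq_gPair B.preservedBy_id _ ?_ ?_)
    · exact (B.pair_proj_zero _ _ _).trans ((Category.comp_id _).symm.trans ha)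
    · exact (B.pair_proj_one _ _ _).trans ((Category.comp_id _).symm.trans hb)

theorem isAddMap_of_id : IsAddMap (B.image (𝟭 X) B.preservedBy_id) B (𝟙 B.E) (𝟙 B.M) := by
  refine .of_over ?_ ?_ ?_
  · exact (Category.id_comp _).trans (Category.comp_id _).symm
  · exact (Category.comp_id _).trans (Category.id_comp _).symm
  · intro Y m a b a' b' ha hb
    rw [image_add_hom, Over.add_hom]
    refine (Category.comp_id _).trans ?_
    refine congrArg (· ≫ B.σ) (B.eq_gPair B.preservedBy_id _ ?_ ?_).symm
    · exact (B.pair_proj_zero _ _ _).trans (ha.symm.trans (Category.comp_id _))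
    · exact (B.pair_proj_one _ _ _).trans (hb.symm.trans (Category.comp_id _))

/-- Natural transformations are additive. -/
theorem isAddMap_natTrans {G G' : X ⥤ X} (hG : B.PreservedBy G) (hG' : B.PreservedBy G')
    (τ : G ⟶ G') : IsAddMap (B.image G hG) (B.image G' hG') (τ.app B.E) (τ.app B.M) := by
  refine .of_over (τ.naturality _).symm (τ.naturality _) ?_
  intro Y m a b a' b' ha hb
  rw [image_add_hom, image_add_hom, Category.assoc, τ.naturality, ← Category.assoc]
  refine congrArg (· ≫ G'.map B.σ) (B.eq_gPair hG' _ ?_ ?_)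
  · rw [Category.assoc, ← τ.naturality, ← Category.assoc, PowBundle.gPair_proj_zero, ha]
  · rw [Category.assoc, ← τ.naturality, ← Category.assoc, PowBundle.gPair_proj_one, hb]

end AddBundle

end Image

/-! ### Zero sections of the functors `T_A` -/

section Zero

variable {X : Type u} [Category.{v} X] [MonoidalLeftAction Weil X]

/-- The zero section `M ⟶ T_A M`. -/
noncomputable def zeroAct (A : Weil) (M : X) : M ⟶ A ⊙ₗ M := (λₗ M).inv ≫ Weil.zero A ⊵ₗ M

theorem zeroAct_naturality (A : Weil) {M N : X} (f : M ⟶ N) :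
    f ≫ zeroAct A N = zeroAct A M ≫ A ⊴ₗ f := by
  refine ((actionUnitIso_inv_naturality_assoc f _).symm.trans ?_).trans (Category.assoc _ _ _).symm
  exact congrArg ((λₗ M).inv ≫ ·) (action_exchange (Weil.zero A) f)

theorem zeroAct_map {A B : Weil} (θ : A ⟶ B) (M : X) : zeroAct A M ≫ θ ⊵ₗ M = zeroAct B M := by
  rw [zeroAct, Category.assoc, ← comp_actionHomLeft]
  exact congrArg (fun f => (λₗ M).inv ≫ f ⊵ₗ M) (Weil.unit_hom_ext _ _)

theorem zeroAct_unit (M : X) : zeroAct (𝟙_ Weil) M = (λₗ M).inv := by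
  rw [zeroAct, show Weil.zero (𝟙_ Weil) = 𝟙 _ from Weil.unit_hom_ext _ _, id_actionHomLeft]
  exact Category.comp_id _

/-- Both sides are induced by the same composite `B ≅ ℕ ⊗ B ⟶ A ⊗ B`. -/
theorem zeroAct_inr (A B : Weil) (M : X) :
    zeroAct A (B ⊙ₗ M) = Weil.inr A B ⊵ₗ M ≫ (αₗ A B M).hom := by
  rw [zeroAct, actionHomLeft_action, ← Category.assoc, ← Category.assoc]
  refine congrArg (· ≫ (αₗ A B M).hom) ?_
  have h : (λₗ (B ⊙ₗ M)).inv ≫ (αₗ (𝟙_ Weil) B M).inv = (λ_ B).inv ⊵ₗ M := by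
    rw [← cancel_mono ((λ_ B).hom ⊵ₗ M), inv_hom_actionHomLeft, leftUnitor_actionHom]
    simp
  rw [h, ← comp_actionHomLeft]
  refine congrArg (fun f : B ⟶ A ⊗ B => f ⊵ₗ M) ?_
  refine (Weil.inr_tensorMap _ _).trans (Category.id_comp _)

/-- Mirror image of `zeroAct_inr`, through `A ≅ A ⊗ ℕ`. The zero section now sits inside `T_A`. -/
theorem zeroAct_inl (A B : Weil) (M : X) :
    Weil.inl A B ⊵ₗ M ≫ (αₗ A B M).hom = A ⊴ₗ zeroAct B M := by
  have h : (ρ_ A).inv ⊵ₗ M ≫ (αₗ A (𝟙_ Weil) M).hom = A ⊴ₗ (λₗ M).inv := by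
    rw [← cancel_mono (A ⊴ₗ (λₗ M).hom), Category.assoc, ← rightUnitor_actionHom]
    simp only [actionHomRight_inv_hom, inv_hom_actionHomLeft]
  have e : Weil.inl A B = (ρ_ A).inv ≫ A ◁ Weil.zero B :=
    ((Weil.inl_tensorMap (𝟙 A) (Weil.zero B)).trans (Category.id_comp _)).symm
  rw [e, comp_actionHomLeft, whiskerLeft_actionHomLeft, zeroAct, actionHomRight_comp, ← h]
  simp

theorem zeroAct_tensor (A B : Weil) (M : X) :
    zeroAct (A ⊗ B) M ≫ (αₗ A B M).hom = zeroAct A M ≫ A ⊴ₗ zeroAct B M := by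
  rw [← zeroAct_inl, ← Category.assoc]
  exact congrArg (· ≫ _) (zeroAct_map _ _).symm

/-- The zero sections as a natural transformation. -/
noncomputable def zeroNat (A : Weil) : 𝟭 X ⟶ actFun X A where
  app M := zeroAct A M
  naturality _ _ f := zeroAct_naturality A f

end Zero

/-! ### The lift extended to elements of Weil algebras -/

namespace DiffBundle

open AddBundle

variable {X : Type u} [Category.{v} X] [MonoidalLeftAction Weil X] [IsTangentActegory X]

/-- The pullback powers are stable limits by the definition of a differential bundle. -/
theorem preservedBy (B : DiffBundle X) {G : X ⥤ X} (hG : IsAction G) : B.PreservedBy G := by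
  intro n
  have h : IsStableLimit (limit.cone (B.diagram n)) := fun k =>
    have := B.preserves n k
    ⟨isLimitOfPreserves _ (limit.isLimit _)⟩
  obtain ⟨hl⟩ := h.isLimit hG
  exact preservesLimit_of_preserves_limit_cone (limit.isLimit _) hl

/-- The image of a differential bundle under the action of a Weil algebra. -/
noncomputable abbrev act (B : DiffBundle X) (A : Weil) : AddBundle X :=
  B.toAddBundle.image (actFun X A) (B.preservedBy (IsAction.action A))

variable (B : DiffBundle X)

theorem isAddMap_act {A A' : Weil} (θ : A ⟶ A') :
    IsAddMap (B.act A) (B.act A') (θ ⊵ₗ B.E) (θ ⊵ₗ B.M) :=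
  B.isAddMap_natTrans _ _ (actNat θ)

theorem isAddMap_zeroAct (A : Weil) :
    IsAddMap B.toAddBundle (B.act A) (zeroAct A B.E) (zeroAct A B.M) :=
  (B.isAddMap_to_id.comp (B.isAddMap_natTrans B.preservedBy_id
    (B.preservedBy (IsAction.action A)) (zeroNat A))).congr
      (Category.id_comp _) (Category.id_comp _)

/-- The lift of the bundle. -/
noncomputable def liftW : B.E ⟶ Weil.W ⊙ₗ B.E := B.lam

theorem isAddMap_liftW :
    IsAddMap B.toAddBundle (B.act Weil.W) B.liftW (zeroAct Weil.W B.M) where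
  w := B.lam_q
  zero := B.ζ_lam
  add := by
    have hw (i : Fin 2) : (B.proj 2 i ≫ B.lam) ≫ (Tan X).map B.q = B.base 2 ≫ tanZero B.M := by
      rw [Category.assoc, B.lam_q, ← Category.assoc, B.proj_q]
    exact B.σ_lam.trans (B.image_add_hom (B.preservedBy (IsAction.action Weil.W))
      ⟨_, hw 0⟩ ⟨_, hw 1⟩).symm

open Classical in
/-- The morphism `E ⟶ T_A E` that corresponds to an element of `A`: it is induced by the lift if the
element has square zero. Otherwise it is the zero section. -/
noncomputable def lamEl {A : Weil} (a : A.Carrier) : B.E ⟶ A ⊙ₗ B.E :=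
  if h : a * a = 0 then B.liftW ≫ Weil.sqHom a h ⊵ₗ B.E else zeroAct A B.E

theorem lamEl_sq {A : Weil} {a : A.Carrier} (h : a * a = 0) :
    B.lamEl a = B.liftW ≫ Weil.sqHom a h ⊵ₗ B.E := dif_pos h

theorem lamEl_one (A : Weil) : B.lamEl (1 : A.Carrier) = zeroAct A B.E :=
  dif_neg A.one_mul_one_ne_zero

theorem isAddMap_lamEl {A : Weil} (a : A.Carrier) :
    IsAddMap B.toAddBundle (B.act A) (B.lamEl a) (zeroAct A B.M) := by
  by_cases h : a * a = 0
  · rw [B.lamEl_sq h]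
    exact (B.isAddMap_liftW.comp (B.isAddMap_act _)).congr rfl (zeroAct_map _ _)
  · rw [lamEl, dif_neg h]
    exact B.isAddMap_zeroAct A

theorem lamEl_comp {A A' : Weil} {a : A.Carrier} (h : a * a = 0) (θ : A ⟶ A') :
    B.lamEl a ≫ θ ⊵ₗ B.E = B.lamEl (θ.hom a) := by
  rw [B.lamEl_sq h, B.lamEl_sq (by rw [← map_mul, h, map_zero] : θ.hom a * θ.hom a = 0),
    Category.assoc, ← comp_actionHomLeft, Weil.sqHom_comp]

/-- For `s = 1` the default value of `lamEl` is the right one, since morphisms of Weil algebras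
preserve `1` and the induced maps preserve zero sections. -/
theorem lamEl_mon_comp {A A' : Weil} (s : A.Mon) (θ : A ⟶ A') :
    B.lamEl (A.mon s) ≫ θ ⊵ₗ B.E = B.lamEl (θ.hom (A.mon s)) := by
  by_cases h : s = A.monOne
  · rw [h, Weil.mon_monOne, map_one, lamEl_one, lamEl_one, zeroAct_map]
  · exact B.lamEl_comp (Weil.mon_mul_self h) θ

/-- The morphism `lamEl a` as a morphism over `T_A M`. -/
noncomputable def lamOver {A : Weil} (a : A.Carrier) : (B.act A).Over (B.q ≫ zeroAct A B.M) :=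
  ⟨B.lamEl a, (B.isAddMap_lamEl a).w⟩

theorem lamOver_hom {A : Weil} (a : A.Carrier) : (B.lamOver a).hom = B.lamEl a := rfl

theorem q_zeroAct {A A' : Weil} (θ : A ⟶ A') :
    (B.q ≫ zeroAct A B.M) ≫ θ ⊵ₗ B.M = B.q ≫ zeroAct A' B.M := by
  rw [Category.assoc, zeroAct_map]

theorem push_lamOver {A A' : Weil} {a : A.Carrier} (h : a * a = 0) (θ : A ⟶ A') :
    (B.isAddMap_act θ).push (B.q_zeroAct θ) (B.lamOver a) = B.lamOver (θ.hom a) :=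
  Over.ext' (B.lamEl_comp h θ)

/-- The morphism `x ↦ 0` factors through `ℕ`, so the lift is hit by the projection `p`, and `p ∘ λ =
ζ ∘ q`. Naturality of the zero section then turns the result into the zero of the bundle `T_A E`. -/
theorem lamOver_zero (A : Weil) : B.lamOver (0 : A.Carrier) = 0 := by
  refine Over.ext' ?_
  rw [lamOver_hom, B.lamEl_sq (zero_mul _), Weil.sqHom_zero, comp_actionHomLeft, ← Category.assoc]
  have h : B.liftW ≫ Weil.aug Weil.W ⊵ₗ B.E = B.q ≫ B.ζ ≫ (λₗ B.E).inv := by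
    rw [← cancel_mono (λₗ B.E).hom, Category.assoc, Category.assoc, Category.assoc, Iso.inv_hom_id,
      Category.comp_id]
    exact B.lam_p
  rw [h, Category.assoc, Category.assoc]
  refine (congrArg (B.q ≫ ·) (zeroAct_naturality A B.ζ)).trans ?_
  exact (Category.assoc _ _ _).symm

/-- The universal case of additivity. `T_{W²} E` is a pullback of two copies of `TE`, and each
projection of `W²` kills one of the two generators, so on each leg the claim is that adding zero
changes nothing. -/
theorem lamOver_add_pow :
    B.lamOver ((Weil.pow (Unit ⊕ Unit)).x (Sum.inl ()) + (Weil.pow (Unit ⊕ Unit)).x (Sum.inr ())) =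
      B.lamOver ((Weil.pow (Unit ⊕ Unit)).x (Sum.inl ())) +
        B.lamOver ((Weil.pow (Unit ⊕ Unit)).x (Sum.inr ())) := by
  have hx (i j : Unit ⊕ Unit) :
      (Weil.pow (Unit ⊕ Unit)).x i * (Weil.pow (Unit ⊕ Unit)).x j = 0 := Weil.pow_mul _ i j
  have hs : ((Weil.pow (Unit ⊕ Unit)).x (Sum.inl ()) + (Weil.pow (Unit ⊕ Unit)).x (Sum.inr ())) *
      ((Weil.pow (Unit ⊕ Unit)).x (Sum.inl ()) + (Weil.pow (Unit ⊕ Unit)).x (Sum.inr ())) = 0 := by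
    simp only [add_mul, mul_add, hx, add_zero]
  refine Over.ext' ((IsTangentActegory.foundational 0 Unit Unit B.E).hom_ext ?_ ?_)
  · refine congrArg Over.hom (a₁ := (B.isAddMap_act (Weil.powFst Unit Unit)).push
      (B.q_zeroAct _) _) (a₂ := (B.isAddMap_act (Weil.powFst Unit Unit)).push
      (B.q_zeroAct _) _) ?_
    rw [map_add, push_lamOver _ hs, push_lamOver _ (hx _ _), push_lamOver _ (hx _ _), map_add,
      Weil.powFst_inl, Weil.powFst_inr, lamOver_zero, add_zero, add_zero]
  · refine congrArg Over.hom (a₁ := (B.isAddMap_act (Weil.powSnd Unit Unit)).push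
      (B.q_zeroAct _) _) (a₂ := (B.isAddMap_act (Weil.powSnd Unit Unit)).push
      (B.q_zeroAct _) _) ?_
    rw [map_add, push_lamOver _ hs, push_lamOver _ (hx _ _), push_lamOver _ (hx _ _), map_add,
      Weil.powSnd_inl, Weil.powSnd_inr, lamOver_zero, _root_.zero_add, _root_.zero_add]

/-- If `(a + b)² = 0`, then `a²`, `ab` and `b²` vanish because nothing cancels. So `x ↦ a`, `y ↦ b`
defines a morphism from `W²`, along which the universal case is transported. -/
theorem lamOver_add {A : Weil} {a b : A.Carrier} (h : (a + b) * (a + b) = 0) :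
    B.lamOver (a + b) = B.lamOver a + B.lamOver b := by
  obtain ⟨haa, hab, hbb⟩ := Weil.sq_zero_of_add h
  let ρ : Weil.pow (Unit ⊕ Unit) ⟶ A := Weil.desc (Sum.elim (fun _ => a) (fun _ => b)) (by
    rintro (i | i) (j | j) _
    · exact haa
    · exact hab
    · exact (mul_comm b a).trans hab
    · exact hbb)
  have hl : ρ.hom ((Weil.pow (Unit ⊕ Unit)).x (Sum.inl ())) = a :=
    Weil.desc_x (A := Weil.pow (Unit ⊕ Unit)) _ _ _
  have hr : ρ.hom ((Weil.pow (Unit ⊕ Unit)).x (Sum.inr ())) = b :=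
    Weil.desc_x (A := Weil.pow (Unit ⊕ Unit)) _ _ _
  have hx (i j : Unit ⊕ Unit) :
      (Weil.pow (Unit ⊕ Unit)).x i * (Weil.pow (Unit ⊕ Unit)).x j = 0 := Weil.pow_mul _ i j
  have key := congrArg ((B.isAddMap_act ρ).push (B.q_zeroAct ρ)) B.lamOver_add_pow
  rw [map_add, push_lamOver, push_lamOver _ (hx _ _), push_lamOver _ (hx _ _), map_add, hl, hr]
    at key
  · exact key
  · simp only [add_mul, mul_add, hx, add_zero]

theorem lamOver_nsmul {A : Weil} {a : A.Carrier} (n : ℕ) (h : (n • a) * (n • a) = 0) :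
    B.lamOver (n • a) = n • B.lamOver a := by
  induction n with
  | zero => rw [zero_smul, zero_smul, lamOver_zero]
  | succ n ih =>
    rw [succ_nsmul] at h
    rw [succ_nsmul, succ_nsmul, lamOver_add _ h, ih (Weil.sq_zero_of_add h).1]

theorem lamOver_sum {A : Weil} {ι : Type*} (S : Finset ι) (f : ι → A.Carrier)
    (h : (∑ i ∈ S, f i) * (∑ i ∈ S, f i) = 0) :
    B.lamOver (∑ i ∈ S, f i) = ∑ i ∈ S, B.lamOver (f i) := by
  classical
  induction S using Finset.induction_on with
  | empty => rw [Finset.sum_empty, Finset.sum_empty, lamOver_zero]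
  | insert a S ha ih =>
    rw [Finset.sum_insert ha] at h
    rw [Finset.sum_insert ha, Finset.sum_insert ha, lamOver_add _ h,
      ih (Weil.sq_zero_of_add h).2.2]

theorem sq_zero_of_sum {A : Weil} {ι : Type*} (S : Finset ι) (f : ι → A.Carrier)
    (h : (∑ i ∈ S, f i) * (∑ i ∈ S, f i) = 0) {i : ι} (hi : i ∈ S) : f i * f i = 0 := by
  classical
  rw [← Finset.add_sum_erase _ _ hi] at h
  exact (Weil.sq_zero_of_add h).1

/-- The expansion of an element of square zero. -/
theorem lamOver_eq_sum {A : Weil} {a : A.Carrier} (h : a * a = 0) :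
    B.lamOver a = ∑ t, A.coeff t a • B.lamOver (A.mon t) := by
  have h' : (∑ t, A.coeff t a • A.mon t) * (∑ t, A.coeff t a • A.mon t) = 0 := by
    rw [A.sum_coeff_mon, h]
  conv_lhs => rw [← A.sum_coeff_mon a]
  rw [lamOver_sum _ _ _ h']
  exact Finset.sum_congr rfl fun t ht => B.lamOver_nsmul _ (sq_zero_of_sum _ _ h' ht)

theorem lamOver_map_mon {A A' : Weil} (θ : A ⟶ A') (s : A.Mon) :
    B.lamOver (θ.hom (A.mon s)) = ∑ t, Weil.mat θ t s • B.lamOver (A'.mon t) := by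
  -- The monomial `1` has no square zero and is treated apart: it is fixed by `θ`, so its column of
  -- the matrix is a unit vector. Any other monomial has an image of square zero, which can be
  -- expanded.
  by_cases h : s = A.monOne
  · rw [h, Weil.mon_monOne, map_one, Finset.sum_eq_single A'.monOne]
    · rw [Weil.mat_apply, Weil.mon_monOne, map_one, ← Weil.mon_monOne, Weil.coeff_mon, if_pos rfl,
        one_smul]
    · intro t _ ht
      rw [Weil.mat_apply, Weil.mon_monOne, map_one, ← Weil.mon_monOne, Weil.coeff_mon, if_neg ht,
        zero_smul]
    · exact fun h => (h (Finset.mem_univ _)).elim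
  · refine B.lamOver_eq_sum ?_
    rw [← map_mul, Weil.mon_mul_self h, map_zero]

/-- The morphism `E ⟶ T_A E` of a monomial of `A`. -/
noncomputable abbrev lamMon (A : Weil) (s : A.Mon) : B.E ⟶ A ⊙ₗ B.E := B.lamEl (A.mon s)

theorem lamMon_unit (s : (𝟙_ Weil).Mon) : B.lamMon (𝟙_ Weil) s = (λₗ B.E).inv := by
  rw [← zeroAct_unit, ← B.lamEl_one]
  exact congrArg B.lamEl (Weil.mon_unit s)

/-- The source of the coherence of the lineator with `⊗`. If one factor is `1`, naturality of zero
sections suffices. Otherwise `x ↦ s t` is the vertical lift `W ⟶ W ⊗ W` followed by `s ⊗ t`, and `ℓ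
∘ λ = T(λ) ∘ λ` separates the two factors. -/
theorem lamMon_tensor (A A' : Weil) (d : (A ⊗ A').Mon) :
    B.lamMon (A ⊗ A') d ≫ (αₗ A A' B.E).hom =
      B.lamMon A (Weil.monTensor A A' d).1 ≫ A ⊴ₗ B.lamMon A' (Weil.monTensor A A' d).2 := by
  obtain ⟨⟨s, t⟩, rfl⟩ := (Weil.monTensor A A').symm.surjective d
  rw [Equiv.apply_symm_apply]
  have hd : (A ⊗ A').mon ((Weil.monTensor A A').symm (s, t)) =
      (Weil.inl A A').hom (A.mon s) * (Weil.inr A A').hom (A'.mon t) :=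
    (Weil.inl_mul_inr A A' s t).symm
  simp only [lamMon, hd]
  by_cases hs : s = A.monOne
  · rw [hs, Weil.mon_monOne, map_one, one_mul, lamEl_one, ← zeroAct_naturality, zeroAct_inr,
      ← Category.assoc]
    exact congrArg (· ≫ (αₗ A A' B.E).hom) (B.lamEl_mon_comp t _).symm
  · by_cases ht : t = A'.monOne
    · rw [ht, Weil.mon_monOne, map_one, mul_one, lamEl_one, ← zeroAct_inl, ← Category.assoc]
      exact congrArg (· ≫ (αₗ A A' B.E).hom) (B.lamEl_mon_comp s _).symm
    · have h₁ := Weil.mon_mul_self hs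
      have h₂ := Weil.mon_mul_self ht
      have h₃ : (Weil.inl A A').hom (A.mon s) * (Weil.inr A A').hom (A'.mon t) *
          ((Weil.inl A A').hom (A.mon s) * (Weil.inr A A').hom (A'.mon t)) = 0 := by
        rw [mul_mul_mul_comm, ← map_mul, h₁, map_zero, zero_mul]
      have e : Weil.sqHom _ h₃ = Weil.ell ≫ (Weil.sqHom _ h₁ ⊗ₘ Weil.sqHom _ h₂) := by
        refine Weil.hom_ext fun i => ?_
        rw [Weil.sqHom_x, Weil.comp_hom, RingHom.comp_apply]
        have hl := congrArg (fun k => k.hom (Weil.W.x i))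
          (Weil.inl_tensorMap (Weil.sqHom _ h₁) (Weil.sqHom _ h₂))
        have hr := congrArg (fun k => k.hom (Weil.W.x i))
          (Weil.inr_tensorMap (Weil.sqHom _ h₁) (Weil.sqHom _ h₂))
        simp only [Weil.comp_hom, RingHom.comp_apply, Weil.sqHom_x] at hl hr
        refine (congrArg₂ (· * ·) hl.symm hr.symm).trans ?_
        refine (map_mul (Weil.tensorMap (Weil.sqHom _ h₁) (Weil.sqHom _ h₂)).hom _ _).symm.trans ?_
        exact congrArg (Weil.tensorMap (Weil.sqHom _ h₁) (Weil.sqHom _ h₂)).hom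
          (Weil.desc_x (A := Weil.W) (fun _ => Weil.ex₁ * Weil.ex₂) _ i).symm
      rw [B.lamEl_sq h₃, B.lamEl_sq h₁, B.lamEl_sq h₂, e, comp_actionHomLeft, Category.assoc,
        Category.assoc, ← actionHom_id, ← actionHom_id, actionAssocIso_hom_naturality]
      have hl : B.liftW ≫ Weil.ell ⊵ₗ B.E ≫ (αₗ Weil.W Weil.W B.E).hom =
          B.liftW ≫ Weil.W ⊴ₗ B.liftW := B.lam_lam
      rw [actionHom_id, reassoc_of% hl, actionHom_id, actionHom_def, actionHomRight_comp,
        action_exchange_assoc, Category.assoc]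

end DiffBundle

/-! ### Matrices acting on families indexed by monomials -/

section MatAct

variable {V : Type*} [AddCommMonoid V] {R S T : Type*} [Fintype R] [Fintype S]

/-- The action of a matrix on a family in a commutative monoid. -/
def matAct (N : Matrix T S ℕ) (e : S → V) (t : T) : V := ∑ s, N t s • e s

theorem matAct_one [DecidableEq S] (e : S → V) : matAct (1 : Matrix S S ℕ) e = e := by
  funext s
  rw [matAct, Finset.sum_eq_single s]
  · rw [Matrix.one_apply_eq, one_smul]
  · intro t _ h
    rw [Matrix.one_apply_ne h.symm, zero_smul]
  · exact fun h => (h (Finset.mem_univ _)).elim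

theorem matAct_mul (N : Matrix T S ℕ) (P : Matrix S R ℕ) (e : R → V) :
    matAct (N * P) e = matAct N (matAct P e) := by
  funext t
  simp only [matAct, Matrix.mul_apply, Finset.sum_smul, Finset.smul_sum, mul_smul]
  exact Finset.sum_comm

variable {σ τ : Type} [Finite σ] [Finite τ]

/-- Splits off the column of the monomial `1`, which is a unit vector because morphisms preserve
`1`. -/
theorem matAct_monPow [Fintype σ] {A : Weil} (f : Weil.pow σ ⟶ A)
    (e : (Weil.pow σ).Mon → V) (t : A.Mon) :
    matAct (Weil.mat f) e t = (if t = A.monOne then 1 else 0) • e (Weil.monPow σ none) +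
      ∑ i : σ, A.coeff t (f.hom ((Weil.pow σ).x i)) • e (Weil.monPow σ (some i)) := by
  rw [matAct, ← (Weil.monPow σ).sum_comp, Fintype.sum_option, Weil.mat_monPow_none]
  simp only [Weil.mat_monPow_some]

theorem Weil.monPow_none : Weil.monPow σ none = (Weil.pow σ).monOne := rfl

theorem Weil.coeff_monPow_none (i : σ) :
    (Weil.pow σ).coeff (Weil.monPow σ none) ((Weil.pow σ).x i) = 0 := by
  rw [← Weil.mon_monPow_some, Weil.coeff_mon, if_neg]
  simp

theorem Weil.coeff_monPow_some [DecidableEq σ] (i j : σ) :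
    (Weil.pow σ).coeff (Weil.monPow σ (some i)) ((Weil.pow σ).x j) = if i = j then 1 else 0 := by
  rw [← Weil.mon_monPow_some, Weil.coeff_mon]
  simp

variable (e : (Weil.pow (σ ⊕ τ)).Mon → V)

theorem matAct_powFst_none : matAct (Weil.mat (Weil.powFst σ τ)) e (Weil.monPow σ none) =
    e (Weil.monPow (σ ⊕ τ) none) := by
  have := Fintype.ofFinite σ
  have := Fintype.ofFinite τ
  rw [matAct_monPow, Fintype.sum_sum_type, ← Weil.monPow_none]
  simp [Weil.powFst_inl, Weil.powFst_inr, Weil.coeff_monPow_none]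

theorem matAct_powSnd_none : matAct (Weil.mat (Weil.powSnd σ τ)) e (Weil.monPow τ none) =
    e (Weil.monPow (σ ⊕ τ) none) := by
  have := Fintype.ofFinite σ
  have := Fintype.ofFinite τ
  rw [matAct_monPow, Fintype.sum_sum_type, ← Weil.monPow_none]
  simp [Weil.powSnd_inl, Weil.powSnd_inr, Weil.coeff_monPow_none]

theorem matAct_powFst_some (i : σ) :
    matAct (Weil.mat (Weil.powFst σ τ)) e (Weil.monPow σ (some i)) =
      e (Weil.monPow (σ ⊕ τ) (some (Sum.inl i))) := by
  classical
  have := Fintype.ofFinite σ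
  have := Fintype.ofFinite τ
  rw [matAct_monPow, Fintype.sum_sum_type, ← Weil.monPow_none]
  simp [Weil.powFst_inl, Weil.powFst_inr, Weil.coeff_monPow_some]

theorem matAct_powSnd_some (i : τ) :
    matAct (Weil.mat (Weil.powSnd σ τ)) e (Weil.monPow τ (some i)) =
      e (Weil.monPow (σ ⊕ τ) (some (Sum.inr i))) := by
  classical
  have := Fintype.ofFinite σ
  have := Fintype.ofFinite τ
  rw [matAct_monPow, Fintype.sum_sum_type, ← Weil.monPow_none]
  simp [Weil.powSnd_inl, Weil.powSnd_inr, Weil.coeff_monPow_some]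

/-- Used to match the constant terms of two families that are glued over `ℕ`. -/
theorem matAct_aug (e : (Weil.pow σ).Mon → V) :
    matAct (Weil.mat (Weil.aug (Weil.pow σ))) e (𝟙_ Weil).monOne = e (Weil.monPow σ none) := by
  have := Fintype.ofFinite σ
  have h (i : σ) : (Weil.aug (Weil.pow σ)).hom ((Weil.pow σ).x i) = 0 :=
    Weil.desc_x (A := Weil.pow σ) _ _ _
  rw [matAct_monPow]
  simp [h]

end MatAct

/-! ### Universality of the linear combinations of the `λ_s` -/

namespace DiffBundle

open AddBundle

variable {X : Type u} [Category.{v} X] [MonoidalLeftAction Weil X] [IsTangentActegory X]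
variable (B : DiffBundle X)

/-- The image of a differential bundle under the action of a Weil algebra. -/
noncomputable abbrev im {G : X ⥤ X} (hG : IsAction G) : AddBundle X :=
  B.toAddBundle.image G (B.preservedBy hG)

theorem isAddMap_map_lamMon {G : X ⥤ X} (hG : IsAction G) (A : Weil) (s : A.Mon) :
    IsAddMap (B.im hG) (B.im (hG.comp A)) (G.map (B.lamMon A s)) (G.map (zeroAct A B.M)) :=
  (B.isAddMap_lamEl (A.mon s)).map (B.preservedBy hG) (B.preservedBy (hG.comp A))

theorem isAddMap_map_act {G : X ⥤ X} (hG : IsAction G) {A A' : Weil} (θ : A ⟶ A') :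
    IsAddMap (B.im (hG.comp A)) (B.im (hG.comp A')) (G.map (θ ⊵ₗ B.E)) (G.map (θ ⊵ₗ B.M)) :=
  B.isAddMap_natTrans _ _ (Functor.whiskerRight (actNat θ) G)

theorem isAddMap_map_assoc {G : X ⥤ X} (hG : IsAction G) (A A' : Weil) :
    IsAddMap (B.im (hG.comp (A ⊗ A'))) (B.im ((hG.comp A).comp A'))
      (G.map (αₗ A A' B.E).hom) (G.map (αₗ A A' B.M).hom) :=
  B.isAddMap_natTrans _ _ (Functor.whiskerRight (actionTensorIso A A').hom G)

theorem isAddMap_map_assoc_inv {G : X ⥤ X} (hG : IsAction G) (A A' : Weil) :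
    IsAddMap (B.im ((hG.comp A).comp A')) (B.im (hG.comp (A ⊗ A')))
      (G.map (αₗ A A' B.E).inv) (G.map (αₗ A A' B.M).inv) :=
  B.isAddMap_natTrans (G := actFun X A' ⋙ actFun X A ⋙ G) (G' := actFun X (A ⊗ A') ⋙ G) _ _
    (Functor.whiskerRight (actionTensorIso A A').inv G)

theorem isAddMap_map_unit {G : X ⥤ X} (hG : IsAction G) :
    IsAddMap (B.im (hG.comp (𝟙_ Weil))) (B.im hG) (G.map (λₗ B.E).hom) (G.map (λₗ B.M).hom) :=
  B.isAddMap_natTrans (G := actFun X (𝟙_ Weil) ⋙ G) (G' := G) _ _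
    (Functor.whiskerRight actionUnitIdIso.hom G)

/-- The linear combination of the morphisms `E ⟶ T_A E` of the monomials of `A`. -/
noncomputable def comb {G : X ⥤ X} (hG : IsAction G) (A : Weil) {Y : X} {m : Y ⟶ G.obj B.M}
    {m' : Y ⟶ G.obj (A ⊙ₗ B.M)} (hm : m ≫ G.map (zeroAct A B.M) = m')
    (e : A.Mon → (B.im hG).Over m) : (B.im (hG.comp A)).Over m' :=
  ∑ s, (B.isAddMap_map_lamMon hG A s).push hm (e s)

theorem zeroAct_comp_map {G : X ⥤ X} {A A' : Weil} (θ : A ⟶ A') {Y : X} {m : Y ⟶ G.obj B.M}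
    {m' : Y ⟶ G.obj (A ⊙ₗ B.M)} (hm : m ≫ G.map (zeroAct A B.M) = m')
    {m'' : Y ⟶ G.obj (A' ⊙ₗ B.M)} (hm' : m ≫ G.map (zeroAct A' B.M) = m'') :
    m' ≫ G.map (θ ⊵ₗ B.M) = m'' := by
  rw [← hm, ← hm', Category.assoc, ← G.map_comp, zeroAct_map]

/-- Naturality in the Weil algebra. The morphism `θ` acts on each `λ_s` by its matrix, and
interchanging the two sums moves the matrix onto the coefficients. -/
theorem push_comb {G : X ⥤ X} (hG : IsAction G) {A A' : Weil} (θ : A ⟶ A') {Y : X}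
    {m : Y ⟶ G.obj B.M} {m' : Y ⟶ G.obj (A ⊙ₗ B.M)} (hm : m ≫ G.map (zeroAct A B.M) = m')
    {m'' : Y ⟶ G.obj (A' ⊙ₗ B.M)} (hm' : m ≫ G.map (zeroAct A' B.M) = m'')
    (e : A.Mon → (B.im hG).Over m) :
    (B.isAddMap_map_act hG θ).push (B.zeroAct_comp_map θ hm hm') (B.comb hG A hm e) =
      B.comb hG A' hm' (matAct (Weil.mat θ) e) := by
  have key (s : A.Mon) :
      (B.isAddMap_map_act hG θ).push (B.zeroAct_comp_map θ hm hm')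
          ((B.isAddMap_map_lamMon hG A s).push hm (e s)) =
        ∑ t, Weil.mat θ t s • (B.isAddMap_map_lamMon hG A' t).push hm' (e s) := by
    have hq : (e s).hom ≫ G.map (B.q ≫ zeroAct A' B.M) = m'' := by
      rw [G.map_comp, ← Category.assoc, ← hm']
      exact congrArg (· ≫ G.map (zeroAct A' B.M)) (e s).w
    -- The expansion of `θ(s)` lives over `E`. Applying `G` and precomposing with `e s` is a
    -- homomorphism, so the expansion survives.
    have h := congrArg (B.toAddBundle.mapImageOver (B.preservedBy (IsAction.action A'))
      (B.preservedBy (hG.comp A')) (e s).hom hq) (B.lamOver_map_mon θ s)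
    rw [map_sum] at h
    simp only [map_nsmul] at h
    refine Eq.trans (Over.ext' ?_) h
    rw [IsAddMap.push_hom, IsAddMap.push_hom, mapImageOver_hom, lamOver_hom, Category.assoc, ← G.map_comp,
      B.lamEl_mon_comp]
  rw [comb, map_sum, Finset.sum_congr rfl fun s _ => key s, Finset.sum_comm, comb]
  refine Finset.sum_congr rfl fun t _ => ?_
  simp only [matAct, map_sum, map_nsmul]

/-- By `lamMon_tensor`, a combination over the monomials of `A ⊗ A'` is an iterated one: inside for
`A` with the functor `G`, outside for `A'` with the functor `G ∘ T_A`. -/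
theorem push_assoc_comb {G : X ⥤ X} (hG : IsAction G) (A A' : Weil) {Y : X}
    {m : Y ⟶ G.obj B.M} {m₁ : Y ⟶ G.obj (A ⊙ₗ B.M)} (h₁ : m ≫ G.map (zeroAct A B.M) = m₁)
    {m₂ : Y ⟶ G.obj (A ⊙ₗ A' ⊙ₗ B.M)} (h₂ : m₁ ≫ (actFun X A ⋙ G).map (zeroAct A' B.M) = m₂)
    {m₃ : Y ⟶ G.obj ((A ⊗ A') ⊙ₗ B.M)} (h₃ : m ≫ G.map (zeroAct (A ⊗ A') B.M) = m₃)
    (h : m₃ ≫ G.map (αₗ A A' B.M).hom = m₂) (e : (A ⊗ A').Mon → (B.im hG).Over m) :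
    (B.isAddMap_map_assoc hG A A').push h (B.comb hG (A ⊗ A') h₃ e) =
      B.comb (hG.comp A) A' h₂ fun t => B.comb hG A h₁ fun s =>
        e ((Weil.monTensor A A').symm (s, t)) := by
  rw [comb, map_sum, ← (Weil.monTensor A A').symm.sum_comp, Fintype.sum_prod_type_right, comb]
  refine Finset.sum_congr rfl fun t _ => ?_
  rw [comb, map_sum]
  refine Finset.sum_congr rfl fun s _ => Over.ext' ?_
  rw [IsAddMap.push_hom, IsAddMap.push_hom, IsAddMap.push_hom, IsAddMap.push_hom, Category.assoc, Category.assoc, ← G.map_comp,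
    lamMon_tensor, Equiv.apply_symm_apply, G.map_comp]
  rfl

/-- The universality of the linear combinations of the morphisms `E ⟶ T_A E`. -/
def IsUniversal (A : Weil) : Prop :=
  ∀ {G : X ⥤ X} (hG : IsAction G) {Y : X} {m : Y ⟶ G.obj B.M} {m' : Y ⟶ G.obj (A ⊙ₗ B.M)}
    (hm : m ≫ G.map (zeroAct A B.M) = m'), Function.Bijective (B.comb hG A hm)

variable {B}

/-- By naturality, the two combination maps differ by composition with an isomorphism of bundles and
by the action of an invertible matrix on families. -/
theorem IsUniversal.of_iso {A A' : Weil} (i : A ≅ A') (h : B.IsUniversal A) :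
    B.IsUniversal A' := by
  intro G hG Y m m' hm
  have hp : Function.Bijective ((B.isAddMap_map_act hG i.inv).push
      (B.zeroAct_comp_map (G := G) i.inv hm rfl)) :=
    (B.isAddMap_map_act hG i.inv).push_bijective (B.isAddMap_map_act hG i.hom)
      (by rw [← G.map_comp]; simp) (by rw [← G.map_comp]; simp) (by rw [← G.map_comp]; simp) _
  have hmat : Function.Bijective
      (matAct (Weil.mat i.inv) : (A'.Mon → (B.im hG).Over m) → (A.Mon → (B.im hG).Over m)) := by
    refine Function.bijective_iff_has_inverse.2 ⟨matAct (Weil.mat i.hom), fun e => ?_, fun e => ?_⟩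
    · rw [← matAct_mul, ← Weil.mat_comp, i.inv_hom_id, Weil.mat_id, matAct_one]
    · rw [← matAct_mul, ← Weil.mat_comp, i.hom_inv_id, Weil.mat_id, matAct_one]
  rw [← Function.Bijective.of_comp_iff' hp]
  have e : ((B.isAddMap_map_act hG i.inv).push (B.zeroAct_comp_map (G := G) i.inv hm rfl)) ∘
      B.comb hG A' hm = B.comb hG A rfl ∘ matAct (Weil.mat i.inv) :=
    funext fun e => B.push_comb hG i.inv hm rfl e
  rw [e]
  exact (h hG rfl).comp hmat

/-- There is a single monomial, and its `λ_1` is the inverse of the unit isomorphism. -/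
theorem isUniversal_unit : B.IsUniversal (𝟙_ Weil) := by
  intro G hG Y m m' hm
  have hm' : m' ≫ G.map (λₗ B.M).hom = m := by
    rw [← hm, zeroAct_unit, Category.assoc, ← G.map_comp]
    simp
  have := Weil.monUnit.unique
  have e (e : (𝟙_ Weil).Mon → (B.im hG).Over m) :
      (B.comb hG (𝟙_ Weil) hm e).hom ≫ G.map (λₗ B.E).hom = (e default).hom := by
    rw [comb, Fintype.sum_unique, IsAddMap.push_hom, lamMon_unit, Category.assoc, ← G.map_comp]
    simp
  have hcancel {a b : (B.im (hG.comp (𝟙_ Weil))).Over m'}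
      (h : a.hom ≫ G.map (λₗ B.E).hom = b.hom ≫ G.map (λₗ B.E).hom) : a = b :=
    Over.ext' ((cancel_mono (G.map (λₗ B.E).hom)).1 h)
  refine ⟨fun e₁ e₂ h => funext fun s => Over.ext' ?_, fun a => ?_⟩
  · rw [Unique.eq_default s, ← e, ← e, h]
  · refine ⟨fun _ => (B.isAddMap_map_unit hG).push hm' a, hcancel ?_⟩
    rw [e, IsAddMap.push_hom]

theorem comb_monPow {G : X ⥤ X} (hG : IsAction G) {σ : Type} [Finite σ] [Fintype σ] {Y : X}
    {m : Y ⟶ G.obj B.M} {m' : Y ⟶ G.obj (Weil.pow σ ⊙ₗ B.M)}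
    (hm : m ≫ G.map (zeroAct (Weil.pow σ) B.M) = m')
    (e : (Weil.pow σ).Mon → (B.im hG).Over m) :
    B.comb hG (Weil.pow σ) hm e =
      (B.isAddMap_map_lamMon hG _ (Weil.monPow σ none)).push hm (e (Weil.monPow σ none)) +
        ∑ i : σ, (B.isAddMap_map_lamMon hG _ (Weil.monPow σ (some i))).push hm
          (e (Weil.monPow σ (some i))) := by
  rw [comb, ← (Weil.monPow σ).sum_comp, Fintype.sum_option]

theorem monPow_ext {σ : Type} [Finite σ] {V : Type*} {e e' : (Weil.pow σ).Mon → V}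
    (h₀ : e (Weil.monPow σ none) = e' (Weil.monPow σ none))
    (h₁ : ∀ i, e (Weil.monPow σ (some i)) = e' (Weil.monPow σ (some i))) : e = e' := by
  funext s
  obtain ⟨_ | i, rfl⟩ := (Weil.monPow σ).surjective s
  · exact h₀
  · exact h₁ i

theorem lamMon_dual : B.lamMon Weil.W (Weil.monPow Unit (some ())) = B.liftW := by
  refine (B.lamEl_sq Weil.ex_mul_ex).trans ?_
  rw [Weil.sqHom_ex, id_actionHomLeft, Category.comp_id]

theorem lamMon_monOne (A : Weil) : B.lamMon A A.monOne = zeroAct A B.E := by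
  rw [lamMon, Weil.mon_monOne, lamEl_one]

/-- This is the universality of the lift in the definition of a differential bundle: a family over
the monomials `1`, `x` is a morphism into `G E₂`, and its combination is the composite with the top
of the pullback square. -/
theorem isUniversal_dual : B.IsUniversal Weil.W := by
  intro G hG Y m m' hm
  -- In the universality axiom the first coordinate carries the lift, that is the monomial `x`, and
  -- the second one the monomial `1`.
  let ν : (B.act Weil.W).Over (B.base 2 ≫ zeroAct Weil.W B.M) :=
    B.isAddMap_liftW.push rfl (B.projOver 2 0) +
      (B.isAddMap_zeroAct Weil.W).push rfl (B.projOver 2 1)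
  have sq : IsPullback (G.map ν.hom) (G.map (B.proj 2 0 ≫ B.q)) (G.map (Weil.W ⊴ₗ B.q))
      (G.map (zeroAct Weil.W B.M)) := by
    refine isPullback_map_of_isAction (fun n => ?_) hG
    have hν : ν.hom = B.tanMapPair B.preserves (B.proj 2 0 ≫ B.lam) (B.proj 2 1 ≫ tanZero B.E)
        _ ≫ (Tan X).map B.σ := B.image_add_hom _ _ _
    rw [hν]
    exact B.universal n
  have hbase {f : Y ⟶ G.obj (B.pow 2)} (hf : f ≫ G.map (B.proj 2 0 ≫ B.q) = m) (i : Fin 2) :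
      (f ≫ G.map (B.proj 2 i)) ≫ G.map B.q = m := by
    rw [Category.assoc, ← G.map_comp, B.proj_q' 2 i 0, hf]
  have hν {f : Y ⟶ G.obj (B.pow 2)} (hf : f ≫ G.map (B.proj 2 0 ≫ B.q) = m)
      {e : Weil.W.Mon → (B.im hG).Over m}
      (h₀ : f ≫ G.map (B.proj 2 0) = (e (Weil.monPow Unit (some ()))).hom)
      (h₁ : f ≫ G.map (B.proj 2 1) = (e (Weil.monPow Unit none)).hom) :
      f ≫ G.map ν.hom = (B.comb hG Weil.W hm e).hom := by
    have hp : f ≫ G.map (B.base 2 ≫ zeroAct Weil.W B.M) = m' := by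
      rw [← B.proj_q 2 0, G.map_comp, ← Category.assoc, hf, hm]
    refine congrArg Over.hom (a₁ := B.toAddBundle.mapImageOver (B.preservedBy (IsAction.action Weil.W))
      (B.preservedBy (hG.comp Weil.W)) f hp ν) ?_
    -- The combination lists the monomial `1` first, opposite to the order in `ν`.
    rw [comb_monPow, map_add, _root_.add_comm, Fintype.sum_unique]
    refine congrArg₂ (· + ·) (Over.ext' ?_) (Over.ext' ?_)
    · rw [mapImageOver_hom, IsAddMap.push_hom, IsAddMap.push_hom, ← h₁, Category.assoc, ← G.map_comp]
      exact congrArg (fun k => f ≫ G.map (B.proj 2 1 ≫ k)) (B.lamMon_monOne Weil.W).symm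
    · rw [mapImageOver_hom, IsAddMap.push_hom, IsAddMap.push_hom]
      refine Eq.trans ?_ (congrArg (· ≫ G.map _) h₀)
      rw [Category.assoc, ← G.map_comp]
      exact congrArg (fun k => f ≫ G.map (B.proj 2 0 ≫ k)) B.lamMon_dual.symm
  constructor
  · intro e e' h
    have hw (e : Weil.W.Mon → (B.im hG).Over m) :
        (e (Weil.monPow Unit (some ()))).hom ≫ G.map B.q =
          (e (Weil.monPow Unit none)).hom ≫ G.map B.q := (e _).w.trans (e _).w.symm
    have hf (e : Weil.W.Mon → (B.im hG).Over m) :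
        B.gPair (B.preservedBy hG) _ _ (hw e) ≫ G.map (B.proj 2 0 ≫ B.q) = m := by
      rw [B.proj_q 2 0, PowBundle.gPair_base]
      exact (e _).w
    have key : B.gPair (B.preservedBy hG) _ _ (hw e) = B.gPair (B.preservedBy hG) _ _ (hw e') := by
      refine sq.hom_ext ?_ ((hf e).trans (hf e').symm)
      rw [hν (hf e) (PowBundle.gPair_proj_zero _ _ _ _ _) (PowBundle.gPair_proj_one _ _ _ _ _),
        hν (hf e') (PowBundle.gPair_proj_zero _ _ _ _ _) (PowBundle.gPair_proj_one _ _ _ _ _), h]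
    refine monPow_ext (Over.ext' ?_) fun i => Over.ext' ?_
    · rw [← B.gPair_proj_one (B.preservedBy hG) _ _ (hw e), key, PowBundle.gPair_proj_one]
    · exact (B.gPair_proj_zero (B.preservedBy hG) _ _ (hw e)).symm.trans
        ((congrArg (· ≫ _) key).trans (PowBundle.gPair_proj_zero _ _ _ _ _))
  · intro y
    have hy : y.hom ≫ G.map (Weil.W ⊴ₗ B.q) = m ≫ G.map (zeroAct Weil.W B.M) :=
      y.w.trans hm.symm
    have hf := sq.lift_snd _ _ hy
    -- The two coordinates of the lift of `y` through the pullback: the second one for `1`, the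
    -- first one for `x`.
    refine ⟨fun s => ((Weil.monPow Unit).symm s).elim ⟨_, hbase hf 1⟩ fun _ => ⟨_, hbase hf 0⟩,
      Over.ext' ?_⟩
    rw [← hν hf, sq.lift_fst]
    · rw [Equiv.symm_apply_apply]; rfl
    · rw [Equiv.symm_apply_apply]; rfl

/-- Uniqueness and existence are applied twice, to `A'` with the functor `G ∘ T_A` and then to `A`
with `G`. This is why universality is asserted for all `G`. -/
theorem IsUniversal.tensor {A A' : Weil} (h : B.IsUniversal A) (h' : B.IsUniversal A') :
    B.IsUniversal (A ⊗ A') := by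
  intro G hG Y m m' hm
  have hz : m' ≫ G.map (αₗ A A' B.M).hom = (m ≫ G.map (zeroAct A B.M)) ≫
      (actFun X A ⋙ G).map (zeroAct A' B.M) := by
    rw [← hm, Category.assoc, Category.assoc, ← G.map_comp, zeroAct_tensor, G.map_comp]
    rfl
  have hp : Function.Bijective ((B.isAddMap_map_assoc hG A A').push hz) :=
    (B.isAddMap_map_assoc hG A A').push_bijective (B.isAddMap_map_assoc_inv hG A A')
      ((G.map_comp _ _).symm.trans (by simp)) ((G.map_comp _ _).symm.trans (by simp))
      ((G.map_comp _ _).symm.trans (by simp)) _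
  rw [← Function.Bijective.of_comp_iff' hp]
  have e : ((B.isAddMap_map_assoc hG A A').push hz) ∘ B.comb hG (A ⊗ A') hm =
      B.comb (hG.comp A) A' rfl ∘ (fun (f : A'.Mon → A.Mon → (B.im hG).Over m) t =>
        B.comb hG A rfl (f t)) ∘ fun e t s => e ((Weil.monTensor A A').symm (s, t)) :=
    funext fun e => B.push_assoc_comb hG A A' rfl rfl hm hz e
  rw [e]
  -- Three bijections remain: the outer combination, the inner ones taken pointwise, and currying of
  -- families on pairs of monomials.
  refine (h' _ rfl).comp (Function.Bijective.comp (Function.Bijective.piMap fun _ => h hG rfl) ?_)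
  refine Function.bijective_iff_has_inverse.2
    ⟨fun f d => f (Weil.monTensor A A' d).2 (Weil.monTensor A A' d).1, fun e => ?_, fun f => ?_⟩
  · funext d
    exact congrArg e ((Weil.monTensor A A').symm_apply_apply d)
  · funext t s
    simp

/-- The foundational pullback stays a pullback under `G`, so a morphism is given by its two legs.
Families on `{1} ⊔ σ ⊔ τ` are likewise pairs of families on `{1} ⊔ σ` and `{1} ⊔ τ` that agree at
`1`. -/
theorem IsUniversal.sum {σ τ : Type} [Finite σ] [Finite τ] (h : B.IsUniversal (Weil.pow σ))
    (h' : B.IsUniversal (Weil.pow τ)) : B.IsUniversal (Weil.pow (σ ⊕ τ)) := by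
  intro G hG Y m m' hm
  have fst (e : (Weil.pow (σ ⊕ τ)).Mon → (B.im hG).Over m) :
      (B.comb hG _ hm e).hom ≫ G.map (Weil.powFst σ τ ⊵ₗ B.E) =
        (B.comb hG _ rfl (matAct (Weil.mat (Weil.powFst σ τ)) e)).hom :=
    congrArg Over.hom (B.push_comb hG (Weil.powFst σ τ) hm rfl e)
  have snd (e : (Weil.pow (σ ⊕ τ)).Mon → (B.im hG).Over m) :
      (B.comb hG _ hm e).hom ≫ G.map (Weil.powSnd σ τ ⊵ₗ B.E) =
        (B.comb hG _ rfl (matAct (Weil.mat (Weil.powSnd σ τ)) e)).hom :=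
    congrArg Over.hom (B.push_comb hG (Weil.powSnd σ τ) hm rfl e)
  have sq := foundational_isAction hG σ τ B.E
  constructor
  · intro e e' he
    have h₁ := (h hG rfl).1 (Over.ext' ((fst e).symm.trans
      ((congrArg (fun a => a.hom ≫ _) he).trans (fst e'))))
    have h₂ := (h' hG rfl).1 (Over.ext' ((snd e).symm.trans
      ((congrArg (fun a => a.hom ≫ _) he).trans (snd e'))))
    refine monPow_ext ?_ ?_
    · rw [← matAct_powFst_none e, ← matAct_powFst_none e', h₁]
    · rintro (i | i)
      · rw [← matAct_powFst_some e, ← matAct_powFst_some e', h₁]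
      · rw [← matAct_powSnd_some e, ← matAct_powSnd_some e', h₂]
  · intro y
    obtain ⟨e₁, h₁⟩ := (h hG rfl).2 ((B.isAddMap_map_act hG (Weil.powFst σ τ)).push
      (B.zeroAct_comp_map (Weil.powFst σ τ) hm rfl) y)
    obtain ⟨e₂, h₂⟩ := (h' hG rfl).2 ((B.isAddMap_map_act hG (Weil.powSnd σ τ)).push
      (B.zeroAct_comp_map (Weil.powSnd σ τ) hm rfl) y)
    -- The constant terms agree: both legs of `y` have the same image over `ℕ`, where a combination
    -- determines its only coefficient.
    have h₀ : e₁ (Weil.monPow σ none) = e₂ (Weil.monPow τ none) := by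
      rw [← matAct_aug e₁, ← matAct_aug e₂]
      refine congrFun ((isUniversal_unit (B := B) hG (m := m) rfl).1 ?_) _
      rw [← B.push_comb hG (Weil.aug (Weil.pow σ)) rfl rfl,
        ← B.push_comb hG (Weil.aug (Weil.pow τ)) rfl rfl, h₁, h₂]
      refine Over.ext' ?_
      rw [IsAddMap.push_hom, IsAddMap.push_hom, IsAddMap.push_hom, IsAddMap.push_hom,
        Category.assoc, Category.assoc, sq.w]
    -- The glued family. Its constant term is taken from `e₁`, which `h₀` allows to be replaced by
    -- that of `e₂`.
    let e (s : (Weil.pow (σ ⊕ τ)).Mon) : (B.im hG).Over m :=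
      ((Weil.monPow (σ ⊕ τ)).symm s).elim (e₁ (Weil.monPow σ none))
        (Sum.elim (fun i => e₁ (Weil.monPow σ (some i))) fun i => e₂ (Weil.monPow τ (some i)))
    have he (o : Option (σ ⊕ τ)) : e (Weil.monPow (σ ⊕ τ) o) =
        o.elim (e₁ (Weil.monPow σ none)) (Sum.elim (fun i => e₁ (Weil.monPow σ (some i)))
          fun i => e₂ (Weil.monPow τ (some i))) :=
      congrArg (fun o : Option (σ ⊕ τ) => o.elim _ _) ((Weil.monPow (σ ⊕ τ)).symm_apply_apply o)
    have he₁ : matAct (Weil.mat (Weil.powFst σ τ)) e = e₁ := by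
      refine monPow_ext ?_ fun i => ?_
      · rw [matAct_powFst_none, he]; rfl
      · rw [matAct_powFst_some, he]; rfl
    have he₂ : matAct (Weil.mat (Weil.powSnd σ τ)) e = e₂ := by
      refine monPow_ext ?_ fun i => ?_
      · rw [matAct_powSnd_none, he]; exact h₀
      · rw [matAct_powSnd_some, he]; rfl
    refine ⟨e, Over.ext' (sq.hom_ext ?_ ?_)⟩
    · rw [fst, he₁, h₁]; rfl
    · rw [snd, he₂, h₂]; rfl

variable (B)

theorem isUniversal (A : Weil) : B.IsUniversal A := by
  induction A using Weil.induction with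
  | iso e h => exact h.of_iso e
  | unit => exact isUniversal_unit
  | dual => exact isUniversal_dual
  | sum σ τ h h' => exact h.sum h'
  | tensor A A' h h' => exact h.tensor h'

end DiffBundle

/-! ### The induced lineator and its coherence -/

namespace PowBundle

variable {X : Type u} [Category.{v} X] {Z : Type u'} [Category.{v'} Z] (B : PowBundle X)
  {G : X ⥤ Z} (hG : B.PreservedBy G)

/-- The morphism `⟨a₀, …, aₙ₋₁⟩ : Y ⟶ G Eₙ`. -/
noncomputable def gLift {n : ℕ} {Y : Z} (m : Y ⟶ G.obj B.M) (a : Fin n → (Y ⟶ G.obj B.E))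
    (h : ∀ i, a i ≫ G.map B.q = m) : Y ⟶ G.obj (B.pow n) :=
  haveI := hG n
  B.mapLift G m a h

theorem gLift_proj {n : ℕ} {Y : Z} (m : Y ⟶ G.obj B.M) (a : Fin n → (Y ⟶ G.obj B.E))
    (h : ∀ i, a i ≫ G.map B.q = m) (i : Fin n) :
    B.gLift hG m a h ≫ G.map (B.proj n i) = a i :=
  haveI := hG n
  B.mapLift_proj G m a h i

theorem gLift_base {n : ℕ} {Y : Z} (m : Y ⟶ G.obj B.M) (a : Fin n → (Y ⟶ G.obj B.E))
    (h : ∀ i, a i ≫ G.map B.q = m) : B.gLift hG m a h ≫ G.map (B.base n) = m :=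
  haveI := hG n
  B.mapLift_base G m a h

end PowBundle

namespace AddBundle

variable {X : Type u} [Category.{v} X] (B : AddBundle X)

theorem linComb_one_submatrix {m n : ℕ} (r : Fin n → Fin m) (i : Fin n) :
    B.linComb ((1 : Matrix (Fin m) (Fin m) ℕ).submatrix r id i) = B.projOver m (r i) := by
  rw [linComb, Finset.sum_eq_single (r i)]
  · rw [Matrix.submatrix_apply, id, Matrix.one_apply_eq, one_smul]
  · intro j _ hj
    rw [Matrix.submatrix_apply, id, Matrix.one_apply_ne hj.symm, zero_smul]
  · simp

theorem powMap_one_submatrix_proj {m n : ℕ} (r : Fin n → Fin m) (i : Fin n) :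
    B.powMap ((1 : Matrix (Fin m) (Fin m) ℕ).submatrix r id) ≫ B.proj n i = B.proj m (r i) := by
  rw [powMap_proj, linComb_one_submatrix]
  rfl

/-- The matrix sends the basis vector `j` to `e j`, so reading off the coordinate `i` of the output
involves the inverse permutation. -/
theorem powMap_perm_proj {m n : NBullet} (e : Fin m.dim ≃ Fin n.dim) (i : Fin n.dim) :
    B.powMap (NBullet.perm e).hom.mat ≫ B.proj n.dim i = B.proj m.dim (e.symm i) := by
  have h : (NBullet.perm e).hom.mat =
      (1 : Matrix (Fin m.dim) (Fin m.dim) ℕ).submatrix e.symm id := by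
    rw [NBullet.perm_hom_mat]
    ext i j
    simp [Matrix.one_apply, Equiv.symm_apply_eq]
  rw [h, powMap_one_submatrix_proj]

/-- The linear combinations with the coefficients of a tensor product. -/
theorem linComb_actHom {A A' : Weil} {k l : NBullet} (θ : A ⟶ A') (f : k ⟶ l) (t : A'.Mon)
    (i : Fin l.dim) :
    B.linComb ((NBullet.actHom θ f).mat (NBullet.idx A' l (t, i))) =
      ∑ s, Weil.mat θ t s • ∑ j, f.mat i j • B.projOver _ (NBullet.idx A k (s, j)) := by
  rw [linComb, ← (NBullet.idx A k).sum_comp, Fintype.sum_prod_type]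
  refine Finset.sum_congr rfl fun s _ => ?_
  rw [Finset.smul_sum]
  refine Finset.sum_congr rfl fun j _ => ?_
  rw [smul_smul, NBullet.actHom_mat]
  simp [Matrix.kronecker, Matrix.kroneckerMap]

end AddBundle

namespace DiffBundle

open AddBundle

variable {X : Type u} [Category.{v} X] [MonoidalLeftAction Weil X] [IsTangentActegory X]
variable (B : DiffBundle X)

/-- The linear combination of the morphisms `E ⟶ T_A E` of the monomials of `A`. -/
noncomputable def combHom (A : Weil) {Y : X} {m : Y ⟶ B.M} {m' : Y ⟶ A ⊙ₗ B.M}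
    (hm : m ≫ zeroAct A B.M = m') : (A.Mon → B.Over m) →+ (B.act A).Over m' where
  toFun e := ∑ s, (B.isAddMap_lamEl (A.mon s)).push hm (e s)
  map_zero' := by simp
  map_add' e e' := by simp [Finset.sum_add_distrib]

theorem combHom_apply (A : Weil) {Y : X} {m : Y ⟶ B.M} {m' : Y ⟶ A ⊙ₗ B.M}
    (hm : m ≫ zeroAct A B.M = m') (e : A.Mon → B.Over m) :
    B.combHom A hm e = ∑ s, (B.isAddMap_lamEl (A.mon s)).push hm (e s) := rfl

/-- A morphism over the base as a morphism over the image of the base under the identity. -/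
noncomputable def toId {Y : X} {m : Y ⟶ B.M} :
    B.Over m →+ (B.im (IsAction.id (X := X))).Over (Y := Y) m :=
  B.isAddMap_to_id.push (Category.comp_id m)

theorem toId_hom {Y : X} {m : Y ⟶ B.M} (a : B.Over m) : (B.toId a).hom = a.hom :=
  Category.comp_id _

theorem toId_bijective {Y : X} {m : Y ⟶ B.M} : Function.Bijective (B.toId (m := m)) :=
  B.isAddMap_to_id.push_bijective B.isAddMap_of_id (Category.comp_id _) (Category.comp_id _)
    (Category.comp_id _) _

/-- Gives access to the universality statement at the identity functor, while the lineator itself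
avoids images under that functor. -/
theorem combHom_eq_comb (A : Weil) {Y : X} {m : Y ⟶ B.M} {m' : Y ⟶ A ⊙ₗ B.M}
    (hm : m ≫ zeroAct A B.M = m') (e : A.Mon → B.Over m) :
    B.combHom A hm e = B.comb IsAction.id A hm fun s => B.toId (e s) := by
  refine Finset.sum_congr rfl fun s _ => Over.ext' ?_
  exact congrArg (· ≫ B.lamMon A s) (B.toId_hom (e s)).symm

theorem combHom_bijective (A : Weil) {Y : X} {m : Y ⟶ B.M} {m' : Y ⟶ A ⊙ₗ B.M}
    (hm : m ≫ zeroAct A B.M = m') : Function.Bijective (B.combHom A hm) := by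
  have h : ⇑(B.combHom A hm) = B.comb IsAction.id A hm ∘ fun e s => B.toId (e s) :=
    funext fun e => B.combHom_eq_comb A hm e
  rw [h]
  exact (B.isUniversal A IsAction.id hm).comp (Function.Bijective.piMap fun _ => B.toId_bijective)

theorem precomp_combHom (A : Weil) {Y Z : X} {m : Y ⟶ B.M} {m' : Y ⟶ A ⊙ₗ B.M}
    (hm : m ≫ zeroAct A B.M = m') (f : Z ⟶ Y) {n : Z ⟶ B.M} (hn : f ≫ m = n)
    {n' : Z ⟶ A ⊙ₗ B.M} (hn' : f ≫ m' = n') (h : n ≫ zeroAct A B.M = n') (e : A.Mon → B.Over m) :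
    (B.act A).precomp f hn' (B.combHom A hm e) =
      B.combHom A h fun s => B.precomp f hn (e s) := by
  rw [combHom_apply, combHom_apply, map_sum]
  exact Finset.sum_congr rfl fun s _ => Over.ext' (Category.assoc _ _ _).symm

theorem push_combHom {A A' : Weil} (θ : A ⟶ A') {Y : X} {m : Y ⟶ B.M} {m' : Y ⟶ A ⊙ₗ B.M}
    (hm : m ≫ zeroAct A B.M = m') {m'' : Y ⟶ A' ⊙ₗ B.M} (hm' : m ≫ zeroAct A' B.M = m'')
    (h : m' ≫ θ ⊵ₗ B.M = m'') (e : A.Mon → B.Over m) :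
    (B.isAddMap_act θ).push h (B.combHom A hm e) =
      B.combHom A' hm' (matAct (Weil.mat θ) e) := by
  rw [combHom_eq_comb, combHom_eq_comb]
  refine (B.push_comb IsAction.id θ hm hm' _).trans (congrArg _ (funext fun t => ?_))
  simp only [matAct, map_sum, map_nsmul]

/-- The lineator `E_n ⟶ T_A E_k` of the functor induced by a differential bundle. -/
noncomputable def lineator (A : Weil) (k : NBullet) :
    B.pow (NBullet.act A k).dim ⟶ A ⊙ₗ B.pow k.dim :=
  B.gLift (B.preservedBy (IsAction.action A)) (B.base _ ≫ zeroAct A B.M)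
    (fun j => (B.combHom A rfl fun s => B.projOver _ (NBullet.idx A k (s, j))).hom)
    (fun _ => Over.w _)

theorem lineator_proj (A : Weil) (k : NBullet) (j : Fin k.dim) :
    B.lineator A k ≫ A ⊴ₗ B.proj k.dim j =
      (B.combHom A rfl fun s => B.projOver _ (NBullet.idx A k (s, j))).hom :=
  B.gLift_proj (B.preservedBy (IsAction.action A)) _ _ _ j

theorem lineator_base (A : Weil) (k : NBullet) :
    B.lineator A k ≫ A ⊴ₗ B.base k.dim = B.base _ ≫ zeroAct A B.M :=
  B.gLift_base (B.preservedBy (IsAction.action A)) _ _ _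

theorem act_hom_ext {A : Weil} {n : ℕ} {Y : X} {f g : Y ⟶ A ⊙ₗ B.pow n}
    (hb : f ≫ A ⊴ₗ B.base n = g ≫ A ⊴ₗ B.base n)
    (h : ∀ i, f ≫ A ⊴ₗ B.proj n i = g ≫ A ⊴ₗ B.proj n i) : f = g :=
  B.map_hom_ext (B.preservedBy (IsAction.action A)) hb h

theorem comp_lineator_proj (A : Weil) (k : NBullet) (j : Fin k.dim) {Y : X}
    (f : Y ⟶ B.pow (NBullet.act A k).dim) {m : Y ⟶ B.M} (hf : f ≫ B.base _ = m)
    {m' : Y ⟶ A ⊙ₗ B.M} (hm : m ≫ zeroAct A B.M = m') :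
    (f ≫ B.lineator A k) ≫ A ⊴ₗ B.proj k.dim j =
      (B.combHom A hm fun s => B.precomp f hf (B.projOver _ (NBullet.idx A k (s, j)))).hom := by
  rw [Category.assoc, lineator_proj]
  exact congrArg Over.hom (B.precomp_combHom A rfl f hf
    (by rw [← Category.assoc, hf, hm]) hm _)

theorem comp_lineator_base (A : Weil) (k : NBullet) {Y : X}
    (f : Y ⟶ B.pow (NBullet.act A k).dim) :
    (f ≫ B.lineator A k) ≫ A ⊴ₗ B.base k.dim = (f ≫ B.base _) ≫ zeroAct A B.M := by
  rw [Category.assoc, lineator_base, Category.assoc]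

/-- Componentwise this is `push_combHom`. The identity matrix in the Kronecker product leaves only
the terms with the same index `j`, with the matrix of `θ` as coefficients. -/
theorem lineator_naturality_left {A A' : Weil} (θ : A ⟶ A') (k : NBullet) :
    B.powMap (NBullet.actHom θ (𝟙 k)).mat ≫ B.lineator A' k =
      B.lineator A k ≫ θ ⊵ₗ B.pow k.dim := by
  refine B.act_hom_ext ?_ fun j => ?_
  · rw [comp_lineator_base, powMap_base, Category.assoc, ← action_exchange, ← Category.assoc,
      lineator_base, Category.assoc, zeroAct_map]
  · rw [B.comp_lineator_proj A' k j _ (B.powMap_base _) rfl, Category.assoc, ← action_exchange,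
      ← Category.assoc, lineator_proj]
    refine Eq.trans ?_ (congrArg Over.hom
      (B.push_combHom θ rfl rfl (by rw [Category.assoc, zeroAct_map]) _)).symm
    refine congrArg (fun e => (B.combHom A' rfl e).hom) (funext fun t => ?_)
    rw [precomp_projOver, linComb_actHom, matAct]
    refine Finset.sum_congr rfl fun s _ => congrArg _ ?_
    rw [Finset.sum_eq_single j]
    · simp
    · intro i _ hi
      rw [NBullet.id_mat, Matrix.one_apply_ne hi.symm, zero_smul]
    · simp

/-- `T_A` maps sums over `M` to sums over `T_A M`, precomposition preserves sums, and a combination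
is additive in its family. So the rows of `f` can be moved through the lineator. -/
theorem lineator_naturality_right (A : Weil) {k l : NBullet} (f : k ⟶ l) :
    B.powMap (NBullet.actHom (𝟙 A) f).mat ≫ B.lineator A l =
      B.lineator A k ≫ A ⊴ₗ B.powMap f.mat := by
  refine B.act_hom_ext ?_ fun i => ?_
  · rw [comp_lineator_base, powMap_base, Category.assoc, ← actionHomRight_comp, powMap_base,
      lineator_base]
  · rw [B.comp_lineator_proj A l i _ (B.powMap_base _) rfl, Category.assoc, ← actionHomRight_comp,
      powMap_proj]
    have key := (congrArg ((B.act A).precomp (B.lineator A k) (B.lineator_base A k))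
      (map_sum (B.mapOver (B.preservedBy (IsAction.action A)) rfl)
        (fun j => f.mat i j • B.projOver k.dim j) Finset.univ)).trans (map_sum _ _ _)
    refine Eq.trans ?_ (congrArg Over.hom key).symm
    simp only [map_nsmul]
    refine congrArg Over.hom (?_ : _ = ∑ j, f.mat i j • (B.act A).precomp (B.lineator A k)
      (B.lineator_base A k) (B.mapOver (B.preservedBy (IsAction.action A)) rfl
        (B.projOver k.dim j)))
    have h (j : Fin k.dim) : (B.act A).precomp (B.lineator A k)
      (B.lineator_base A k) (B.mapOver (B.preservedBy (IsAction.action A)) rfl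
        (B.projOver k.dim j)) = B.combHom A rfl fun s => B.projOver _ (NBullet.idx A k (s, j)) :=
      Over.ext' (B.lineator_proj A k j)
    simp only [h, ← map_nsmul]
    rw [← map_sum]
    refine congrArg _ (funext fun s => ?_)
    rw [precomp_projOver, linComb_actHom, Finset.sum_eq_single s]
    · rw [Weil.mat_id, Matrix.one_apply_eq, one_smul, Finset.sum_apply]
      rfl
    · intro t _ ht
      rw [Weil.mat_id, Matrix.one_apply_ne ht.symm, zero_smul]
    · simp

/-- The left-hand components are rewritten as iterated combinations by `push_assoc_comb`. On the
right, the inner lineator is expanded first, and the permutation matches pairs of monomials with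
monomials of `A ⊗ A'`. -/
theorem lineator_assoc (A A' : Weil) (k : NBullet) :
    B.lineator (A ⊗ A') k ≫ (αₗ A A' (B.pow k.dim)).hom =
      B.powMap (NBullet.perm (NBullet.assocEquiv A A' k)).hom.mat ≫
        B.lineator A (NBullet.act A' k) ≫ A ⊴ₗ B.lineator A' k := by
  have hα {M N : X} (f : M ⟶ N) : (αₗ A A' M).hom ≫ A ⊴ₗ A' ⊴ₗ f =
      (A ⊗ A') ⊴ₗ f ≫ (αₗ A A' N).hom := by simp
  refine B.map_hom_ext (B.preservedBy ((IsAction.action A).comp A')) ?_ fun j => ?_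
  · change (_ ≫ _) ≫ A ⊴ₗ A' ⊴ₗ B.base k.dim = (_ ≫ _) ≫ A ⊴ₗ A' ⊴ₗ B.base k.dim
    rw [Category.assoc, hα, ← Category.assoc, lineator_base, Category.assoc, zeroAct_tensor,
      Category.assoc, Category.assoc, ← actionHomRight_comp, lineator_base, actionHomRight_comp,
      ← Category.assoc (B.lineator A _), lineator_base, Category.assoc]
    exact (congrArg (· ≫ _) (B.powMap_base _).symm).trans (Category.assoc _ _ _)
  · change (_ ≫ _) ≫ A ⊴ₗ A' ⊴ₗ B.proj k.dim j = (_ ≫ _) ≫ A ⊴ₗ A' ⊴ₗ B.proj k.dim j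
    rw [Category.assoc, hα, ← Category.assoc, lineator_proj, Category.assoc, Category.assoc,
      ← actionHomRight_comp, lineator_proj]
    let P := B.powMap (NBullet.perm (NBullet.assocEquiv A A' k)).hom.mat
    have hP : P ≫ B.base _ = B.base _ := B.powMap_base _
    have hf : (P ≫ B.lineator A (NBullet.act A' k)) ≫ A ⊴ₗ B.base _ =
        B.base _ ≫ zeroAct A B.M := by rw [comp_lineator_base, hP]
    have hz : (B.base (NBullet.act (A ⊗ A') k).dim ≫ zeroAct (A ⊗ A') B.M) ≫
        (αₗ A A' B.M).hom =
        (B.base (NBullet.act (A ⊗ A') k).dim ≫ zeroAct A B.M) ≫ A ⊴ₗ zeroAct A' B.M := by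
      rw [Category.assoc, Category.assoc, zeroAct_tensor]
    have hm : (P ≫ B.lineator A (NBullet.act A' k)) ≫ A ⊴ₗ (B.base _ ≫ zeroAct A' B.M) =
        (B.base (NBullet.act (A ⊗ A') k).dim ≫ zeroAct A B.M) ≫ A ⊴ₗ zeroAct A' B.M := by
      rw [actionHomRight_comp, ← Category.assoc, hf]
    have h₁ := congrArg Over.hom (B.push_assoc_comb IsAction.id A A' rfl rfl rfl hz
      fun d => B.toId (B.projOver (NBullet.act (A ⊗ A') k).dim (NBullet.idx (A ⊗ A') k (d, j))))
    -- Distributes the precomposed first lineator and `T_A` over the sum that defines the second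
    -- lineator.
    have h₂ := congrArg Over.hom (map_sum (B.toAddBundle.mapImageOver
      (B.preservedBy (IsAction.action A')) (B.preservedBy ((IsAction.action A).comp A')) _ hm)
      (fun t => (B.isAddMap_lamEl (A'.mon t)).push rfl
        (B.projOver _ (NBullet.idx A' k (t, j)))) Finset.univ)
    rw [combHom_eq_comb]
    refine h₁.trans (Eq.trans ?_ (h₂.symm.trans (Category.assoc _ _ _)))
    refine congrArg Over.hom (Finset.sum_congr rfl fun t _ => Over.ext' ?_)
    rw [mapImageOver_hom, IsAddMap.push_hom, IsAddMap.push_hom, (actFun X A).map_comp]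
    refine Eq.trans ?_ (Category.assoc _ _ _)
    refine congrArg (· ≫ A ⊴ₗ B.lamMon A' t) (Eq.trans ?_
      (B.comp_lineator_proj A (NBullet.act A' k) (NBullet.idx A' k (t, j)) P hP rfl).symm)
    rw [combHom_eq_comb]
    refine congrArg (fun e => (B.comb IsAction.id A rfl e).hom) (funext fun s => congrArg _ ?_)
    refine Over.ext' (Eq.trans ?_ (B.powMap_perm_proj _ _).symm)
    refine congrArg (B.proj _) ?_
    simp [NBullet.assocEquiv]

/-- The algebra `ℕ` has one monomial, so each component is a single term with `λ_1` the inverse unit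
isomorphism. -/
theorem lineator_unit (k : NBullet) :
    (λₗ (B.pow k.dim)).inv =
      B.powMap (NBullet.perm (NBullet.unitEquiv k)).inv.mat ≫ B.lineator (𝟙_ Weil) k := by
  have hinv : (NBullet.perm (NBullet.unitEquiv k)).inv =
    (NBullet.perm (NBullet.unitEquiv k).symm).hom := rfl
  rw [hinv]
  refine B.act_hom_ext ?_ fun j => ?_
  · rw [comp_lineator_base, powMap_base, zeroAct_unit]
    simp
  · rw [B.comp_lineator_proj _ k j _ (B.powMap_base _) rfl, combHom_apply]
    have := Weil.monUnit.unique
    rw [Fintype.sum_unique, IsAddMap.push_hom, precomp_hom]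
    have h : B.powMap (NBullet.perm (NBullet.unitEquiv k).symm).hom.mat ≫
        (B.projOver _ (NBullet.idx (𝟙_ Weil) k (default, j))).hom = B.proj k.dim j := by
      refine (B.powMap_perm_proj _ _).trans (congrArg (B.proj _) ?_)
      simp [NBullet.unitEquiv]
    rw [h, show B.lamEl ((𝟙_ Weil).mon default) = _ from B.lamMon_unit default]
    simp

end DiffBundle

/-! ### Products in the category of matrices -/

namespace NBullet

/-- The projections of the product `ℕᵐ⁺ⁿ`. -/
def prodFst (m n : NBullet) : (⟨m.dim + n.dim⟩ : NBullet) ⟶ m :=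
  ⟨(1 : Matrix (Fin (m.dim + n.dim)) (Fin (m.dim + n.dim)) ℕ).submatrix
    (Fin.castAdd n.dim) id⟩
def prodSnd (m n : NBullet) : (⟨m.dim + n.dim⟩ : NBullet) ⟶ n :=
  ⟨(1 : Matrix (Fin (m.dim + n.dim)) (Fin (m.dim + n.dim)) ℕ).submatrix
    (Fin.natAdd m.dim) id⟩

/-- The morphism into the product `ℕᵐ⁺ⁿ`. -/
def prodLift {l m n : NBullet} (a : l ⟶ m) (b : l ⟶ n) : l ⟶ (⟨m.dim + n.dim⟩ : NBullet) :=
  ⟨Matrix.of fun i j => Fin.addCases (fun i => a.mat i j) (fun i => b.mat i j) i⟩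

theorem one_submatrix_mul {l m n : ℕ} (N : Matrix (Fin m) (Fin l) ℕ) (r : Fin n → Fin m) :
    (1 : Matrix (Fin m) (Fin m) ℕ).submatrix r id * N = N.submatrix r id := by
  ext i j
  rw [Matrix.mul_apply, Finset.sum_eq_single (r i)]
  · rw [Matrix.submatrix_apply, id, Matrix.one_apply_eq, one_mul]
    rfl
  · intro k _ hk
    rw [Matrix.submatrix_apply, id, Matrix.one_apply_ne hk.symm, zero_mul]
  · simp

theorem comp_submatrix_mat {l m : NBullet} {n : ℕ} (f : l ⟶ m) (r : Fin n → Fin m.dim) :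
    (f ≫ (⟨(1 : Matrix (Fin m.dim) (Fin m.dim) ℕ).submatrix r id⟩ : m ⟶ ⟨n⟩)).mat =
      f.mat.submatrix r id :=
  one_submatrix_mul f.mat r

/-- Over a terminal object a pullback is a product, and a matrix into `ℕᵐ⁺ⁿ` is a matrix into `ℕᵐ`
stacked on one into `ℕⁿ`. -/
theorem isPullback_prod (m n : NBullet) {z : NBullet} (hz : IsTerminal z) (f : m ⟶ z)
    (g : n ⟶ z) : IsPullback (prodFst m n) (prodSnd m n) f g := by
  refine ⟨⟨hz.hom_ext _ _⟩, ⟨PullbackCone.IsLimit.mk _ (fun s => prodLift s.fst s.snd) ?_ ?_ ?_⟩⟩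
  · intro s
    refine hom_ext ((comp_submatrix_mat _ _).trans ?_)
    ext i j
    exact Fin.addCases_left (motive := fun _ => ℕ) (left := fun i => s.fst.mat i j)
      (right := fun i => s.snd.mat i j) i
  · intro s
    refine hom_ext ((comp_submatrix_mat _ _).trans ?_)
    ext i j
    exact Fin.addCases_right (motive := fun _ => ℕ) (left := fun i => s.fst.mat i j)
      (right := fun i => s.snd.mat i j) i
  · intro s l h₁ h₂
    refine hom_ext ?_
    have e₁ := (comp_submatrix_mat l (Fin.castAdd n.dim)).symm.trans (congrArg Hom.mat h₁)
    have e₂ := (comp_submatrix_mat l (Fin.natAdd m.dim)).symm.trans (congrArg Hom.mat h₂)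
    ext i j
    change l.mat i j = Fin.addCases (fun i => s.fst.mat i j) (fun i => s.snd.mat i j) i
    induction i using Fin.addCases with
    | left i => rw [Fin.addCases_left, ← e₁]; rfl
    | right i => rw [Fin.addCases_right, ← e₂]; rfl

end NBullet

/-! ### The induced functor is lax differential -/

namespace DiffBundle

open AddBundle

variable {X : Type u} [Category.{v} X] [MonoidalLeftAction Weil X] [IsTangentActegory X]
variable (B : DiffBundle X)

/-- The induced lineator. -/
@[reducible] noncomputable def indOplax : B.indFunctor.OplaxLeftLinear Weil where
  δₗ := B.lineator
  δₗ_naturality_left θ k := B.lineator_naturality_left θ k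
  δₗ_naturality_right A _ _ f := B.lineator_naturality_right A f
  δₗ_associativity A A' k := B.lineator_assoc A A' k
  δₗ_unitality_inv k := B.lineator_unit k

/-- The Cartesian condition relative to the base `M`. Component by component, it says that a
morphism into `T_A E` over a zero section is a unique combination of the `λ_s`, which is
`combHom_bijective`. -/
theorem isPullback_lineator (A : Weil) (k : NBullet) :
    IsPullback (B.lineator A k) (B.base _) (A ⊴ₗ B.base k.dim) (zeroAct A B.M) := by
  refine ⟨⟨B.lineator_base A k⟩, ?_⟩
  have inj {Y : X} {f g : Y ⟶ B.pow (NBullet.act A k).dim} (hb : f ≫ B.base _ = g ≫ B.base _)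
      (h : f ≫ B.lineator A k = g ≫ B.lineator A k) : f = g := by
    refine B.pow_hom_ext hb fun i => ?_
    obtain ⟨⟨s, j⟩, rfl⟩ := (NBullet.idx A k).surjective i
    have hj := ((B.comp_lineator_proj A k j g rfl rfl).symm.trans
      (congrArg (· ≫ _) h.symm)).trans (B.comp_lineator_proj A k j f hb rfl)
    exact congrArg Over.hom (congrFun ((B.combHom_bijective A rfl).1 (Over.ext' hj)) s).symm
  have surj {Y : X} (y : Y ⟶ A ⊙ₗ B.pow k.dim) (m : Y ⟶ B.M)
      (h : y ≫ A ⊴ₗ B.base k.dim = m ≫ zeroAct A B.M) :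
      ∃ f : Y ⟶ B.pow (NBullet.act A k).dim, f ≫ B.lineator A k = y ∧ f ≫ B.base _ = m := by
    have hy (j : Fin k.dim) : (y ≫ A ⊴ₗ B.proj k.dim j) ≫ A ⊴ₗ B.q = m ≫ zeroAct A B.M := by
      rw [Category.assoc, ← actionHomRight_comp, B.proj_q, h]
    -- For each component `j` of `y`, the unique family over the monomials of `A`. Together these
    -- families are the coordinates of `f`.
    choose e he using fun j => (B.combHom_bijective A rfl).2 ⟨_, hy j⟩
    let f := B.lift m (fun i => (e ((NBullet.idx A k).symm i).2 ((NBullet.idx A k).symm i).1).hom)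
      (fun i => Over.w _)
    have hf : f ≫ B.base _ = m := WidePullback.lift_base _ _ _ _
    have hp (s : A.Mon) (j : Fin k.dim) : B.precomp f hf
        (B.projOver _ (NBullet.idx A k (s, j))) = e j s := by
      refine Over.ext' ((WidePullback.lift_π _ _ _ _ _).trans ?_)
      rw [Equiv.symm_apply_apply]
    refine ⟨f, B.act_hom_ext ?_ fun j => ?_, hf⟩
    · rw [comp_lineator_base, hf, h]
    · rw [B.comp_lineator_proj A k j f hf rfl]
      simp only [hp]
      rw [he]
  choose l hl using fun s : PullbackCone (A ⊴ₗ B.base k.dim) (zeroAct A B.M) =>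
    surj s.fst s.snd s.condition
  exact ⟨PullbackCone.IsLimit.mk _ l (fun s => (hl s).1) (fun s => (hl s).2)
    fun s f h₁ h₂ => inj (h₂.trans (hl s).2.symm) (h₁.trans (hl s).1.symm)⟩

/-- Pasting: the square for `f` on top of the square for `l` over `M` gives the square for `k` over
`M`, and the latter two are pullbacks. -/
theorem isPullback_lineator_map (A : Weil) {k l : NBullet} (f : k ⟶ l) :
    IsPullback (B.lineator A k) (B.powMap (NBullet.actHom (𝟙 A) f).mat) (A ⊴ₗ B.powMap f.mat)
      (B.lineator A l) := by
  refine IsPullback.of_bot ?_ (B.lineator_naturality_right A f).symm (B.isPullback_lineator A l)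
  rw [powMap_base, ← actionHomRight_comp, powMap_base]
  exact B.isPullback_lineator A k

/-- Pullback powers satisfy `Eₘ₊ₙ = Eₘ ×_M Eₙ`, and `T_A` preserves them. -/
theorem isPullback_map_prod (A : Weil) {m n z : NBullet} (hz : IsTerminal z) (f : m ⟶ z)
    (g : n ⟶ z) : IsPullback (A ⊴ₗ B.powMap (NBullet.prodFst m n).mat)
      (A ⊴ₗ B.powMap (NBullet.prodSnd m n).mat) (A ⊴ₗ B.powMap f.mat) (A ⊴ₗ B.powMap g.mat) := by
  have hw {k : NBullet} (f : k ⟶ z) : A ⊴ₗ B.powMap f.mat ≫ A ⊴ₗ B.base z.dim =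
      A ⊴ₗ B.base k.dim := by rw [← actionHomRight_comp, powMap_base]
  have h₁ (i : Fin m.dim) : A ⊴ₗ B.powMap (NBullet.prodFst m n).mat ≫ A ⊴ₗ B.proj m.dim i =
      A ⊴ₗ B.proj (m.dim + n.dim) (Fin.castAdd n.dim i) := by
    rw [← actionHomRight_comp]
    exact congrArg (A ⊴ₗ ·) (B.powMap_one_submatrix_proj _ i)
  have h₂ (i : Fin n.dim) : A ⊴ₗ B.powMap (NBullet.prodSnd m n).mat ≫ A ⊴ₗ B.proj n.dim i =
      A ⊴ₗ B.proj (m.dim + n.dim) (Fin.natAdd m.dim i) := by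
    rw [← actionHomRight_comp]
    exact congrArg (A ⊴ₗ ·) (B.powMap_one_submatrix_proj _ i)
  have b₁ : A ⊴ₗ B.powMap (NBullet.prodFst m n).mat ≫ A ⊴ₗ B.base m.dim =
      A ⊴ₗ B.base (m.dim + n.dim) := by rw [← actionHomRight_comp, powMap_base]
  have b₂ : A ⊴ₗ B.powMap (NBullet.prodSnd m n).mat ≫ A ⊴ₗ B.base n.dim =
      A ⊴ₗ B.base (m.dim + n.dim) := by rw [← actionHomRight_comp, powMap_base]
  refine ⟨⟨?_⟩, ?_⟩
  · rw [← actionHomRight_comp, ← actionHomRight_comp, ← powMap_mul, ← powMap_mul]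
    exact congrArg (fun f : (⟨m.dim + n.dim⟩ : NBullet) ⟶ z => A ⊴ₗ B.powMap f.mat)
      (hz.hom_ext (NBullet.prodFst m n ≫ f) (NBullet.prodSnd m n ≫ g))
  have surj {Y : X} (a : Y ⟶ A ⊙ₗ B.pow m.dim) (b : Y ⟶ A ⊙ₗ B.pow n.dim)
      (h : a ≫ A ⊴ₗ B.powMap f.mat = b ≫ A ⊴ₗ B.powMap g.mat) :
      ∃ u : Y ⟶ A ⊙ₗ B.pow (m.dim + n.dim), u ≫ A ⊴ₗ B.powMap (NBullet.prodFst m n).mat = a ∧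
        u ≫ A ⊴ₗ B.powMap (NBullet.prodSnd m n).mat = b := by
    -- The morphisms in the image of `F_E` are morphisms over `M`, so agreement in the corner of the
    -- square forces equal base parts.
    have hb : b ≫ A ⊴ₗ B.base n.dim = a ≫ A ⊴ₗ B.base m.dim := by
      rw [← hw f, ← hw g, ← Category.assoc, ← h, Category.assoc]
    let c (i : Fin (m.dim + n.dim)) : Y ⟶ A ⊙ₗ B.E :=
      Fin.addCases (fun i => a ≫ A ⊴ₗ B.proj m.dim i) (fun i => b ≫ A ⊴ₗ B.proj n.dim i) i
    have hc (i : Fin (m.dim + n.dim)) : c i ≫ A ⊴ₗ B.q = a ≫ A ⊴ₗ B.base m.dim := by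
      induction i using Fin.addCases with
      | left i =>
        change Fin.addCases _ _ _ ≫ _ = _
        rw [Fin.addCases_left, Category.assoc, ← actionHomRight_comp, B.proj_q]
      | right i =>
        change Fin.addCases _ _ _ ≫ _ = _
        rw [Fin.addCases_right, Category.assoc, ← actionHomRight_comp, B.proj_q, hb]
    let u := B.gLift (B.preservedBy (IsAction.action A)) _ c hc
    have hu (i) : u ≫ A ⊴ₗ B.proj _ i = c i :=
      B.gLift_proj (B.preservedBy (IsAction.action A)) _ c hc i
    have hu' : u ≫ A ⊴ₗ B.base _ = a ≫ A ⊴ₗ B.base m.dim :=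
      B.gLift_base (B.preservedBy (IsAction.action A)) _ c hc
    refine ⟨u, B.act_hom_ext ?_ fun i => ?_, B.act_hom_ext ?_ fun i => ?_⟩
    · rw [Category.assoc, b₁, hu']
    · rw [Category.assoc, h₁, hu]
      exact Fin.addCases_left i
    · rw [Category.assoc, b₂, hu', hb]
    · rw [Category.assoc, h₂, hu]
      exact Fin.addCases_right i
  choose l hl using fun s : PullbackCone (A ⊴ₗ B.powMap f.mat) (A ⊴ₗ B.powMap g.mat) =>
    surj s.fst s.snd s.condition
  refine ⟨PullbackCone.IsLimit.mk _ l (fun s => (hl s).1) (fun s => (hl s).2)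
    fun s u e₁ e₂ => B.act_hom_ext ?_ fun i => ?_⟩
  · rw [← b₁, ← Category.assoc, ← Category.assoc, e₁, (hl s).1]
  · induction i using Fin.addCases with
    | left i => rw [← h₁, ← Category.assoc, ← Category.assoc, e₁, (hl s).1]
    | right i => rw [← h₂, ← Category.assoc, ← Category.assoc, e₂, (hl s).2]

theorem isLaxDifferential_ind :
    letI := B.indOplax
    IsLaxDifferential B.indFunctor := by
  let := B.indOplax
  refine ⟨?_, fun A _ _ f => B.isPullback_lineator_map A f⟩
  intro A P Q R Z hZ fst snd f g h
  have h' : IsPullback ((B.indFunctor ⋙ actFun X A).map (NBullet.prodFst Q R))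
      ((B.indFunctor ⋙ actFun X A).map (NBullet.prodSnd Q R))
      ((B.indFunctor ⋙ actFun X A).map f) ((B.indFunctor ⋙ actFun X A).map g) :=
    B.isPullback_map_prod A hZ f g
  -- An arbitrary pullback over the terminal object is isomorphic to the standard product, for which
  -- the claim is known.
  have h₀ := NBullet.isPullback_prod Q R hZ f g
  have e₁ := congrArg (B.indFunctor ⋙ actFun X A).map (h₀.isoIsPullback_hom_fst Q R h)
  have e₂ := congrArg (B.indFunctor ⋙ actFun X A).map (h₀.isoIsPullback_hom_snd Q R h)
  rw [Functor.map_comp] at e₁ e₂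
  exact h'.of_iso ((B.indFunctor ⋙ actFun X A).mapIso (h₀.isoIsPullback Q R h)) (Iso.refl _)
    (Iso.refl _) (Iso.refl _) ((Category.comp_id _).trans e₁.symm)
    ((Category.comp_id _).trans e₂.symm) ((Category.comp_id _).trans (Category.id_comp _).symm)
    ((Category.comp_id _).trans (Category.id_comp _).symm)

/-- For `A = W` the sum has two terms, with `λ_1 = 0` and `λ_x = λ`. -/
theorem isInducedLineator_ind :
    letI := B.indOplax
    B.IsInducedLineator := by
  let := B.indOplax
  refine ⟨?_, B.lineator_base Weil.W ⟨0⟩⟩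
  refine (B.lineator_proj Weil.W ⟨1⟩ 0).trans ?_
  rw [combHom_apply, ← (Weil.monPow Unit).sum_comp, Fintype.sum_option, Fintype.sum_unique]
  refine (B.image_add_hom (B.preservedBy (IsAction.action Weil.W)) _ _).trans ?_
  refine congrArg (· ≫ (Tan X).map B.σ) (B.gPair_congr _ _ ?_ ?_)
  · exact congrArg (_ ≫ ·) (B.lamMon_monOne Weil.W)
  · exact congrArg (_ ≫ ·) B.lamMon_dual

end DiffBundle

/-! ### Natural transformations induced by additive morphisms -/

namespace BundleHom

open AddBundle

variable {X : Type u} [Category.{v} X] [MonoidalLeftAction Weil X] [IsTangentActegory X]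
variable {B B' : DiffBundle X} (h : BundleHom B B')

theorem IsAdditive.isAddMap {h : BundleHom B B'} (ha : h.IsAdditive) :
    IsAddMap B.toAddBundle B'.toAddBundle h.f h.g :=
  ⟨h.w, ha.zero.symm, ha.add.symm⟩

/-- The morphism `fₖ : Eₖ ⟶ E'ₖ`. -/
noncomputable def powMap (k : ℕ) : B.pow k ⟶ B'.pow k :=
  B'.lift (B.base k ≫ h.g) (fun i => B.proj k i ≫ h.f) fun i => by
    rw [Category.assoc, h.w, ← Category.assoc, B.proj_q]

theorem powMap_proj (k : ℕ) (i : Fin k) : h.powMap k ≫ B'.proj k i = B.proj k i ≫ h.f :=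
  WidePullback.lift_π _ _ _ _ _

theorem powMap_base (k : ℕ) : h.powMap k ≫ B'.base k = B.base k ≫ h.g :=
  WidePullback.lift_base _ _ _ _

variable {h}

/-- The natural transformation induced by an additive morphism. -/
noncomputable def IsAdditive.trans (ha : h.IsAdditive) : B.indFunctor ⟶ B'.indFunctor where
  app k := h.powMap k.dim
  naturality k l N := by
    change B.powMap N.mat ≫ h.powMap l.dim = h.powMap k.dim ≫ B'.powMap N.mat
    refine B'.pow_hom_ext ?_ fun i => ?_
    · rw [Category.assoc, Category.assoc, powMap_base, AddBundle.powMap_base, powMap_base,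
        ← Category.assoc, AddBundle.powMap_base]
    · rw [Category.assoc, Category.assoc, powMap_proj, AddBundle.powMap_proj, ← Category.assoc,
        AddBundle.powMap_proj]
      -- Postcomposition with `f` and precomposition with `fₖ` are homomorphisms, so comparing
      -- linear combinations reduces to the projections.
      refine congrArg Over.hom (a₁ := ha.isAddMap.push rfl (B.linComb (N.mat i)))
        (a₂ := B'.precomp (h.powMap k.dim) (h.powMap_base k.dim) (B'.linComb (N.mat i))) ?_
      rw [linComb, linComb, map_sum, map_sum]
      refine Finset.sum_congr rfl fun j _ => ?_
      rw [map_nsmul, map_nsmul]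
      exact congrArg _ (Over.ext' (h.powMap_proj k.dim j).symm)

theorem IsAdditive.isInduced_trans (ha : h.IsAdditive) : h.IsInduced ha.trans :=
  fun k => ⟨h.powMap_base k.dim, h.powMap_proj k.dim⟩

/-- Functoriality of the induced transformations follows from this without computing any components.
-/
theorem IsInduced.unique {φ ψ : B.indFunctor ⟶ B'.indFunctor} (hφ : h.IsInduced φ)
    (hψ : h.IsInduced ψ) : φ = ψ := by
  refine NatTrans.ext (funext fun k => B'.pow_hom_ext ?_ fun i => ?_)
  · exact (hφ k).1.trans (hψ k).1.symm
  · exact ((hφ k).2 i).trans ((hψ k).2 i).symm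

theorem IsInduced.id (B : DiffBundle X) : (BundleHom.id B).IsInduced (𝟙 B.indFunctor) :=
  fun _ => ⟨(Category.id_comp _).trans (Category.comp_id _).symm,
    fun _ => (Category.id_comp _).trans (Category.comp_id _).symm⟩

theorem IsInduced.comp {B'' : DiffBundle X} {h' : BundleHom B' B''}
    {φ : B.indFunctor ⟶ B'.indFunctor} {ψ : B'.indFunctor ⟶ B''.indFunctor} (hφ : h.IsInduced φ)
    (hψ : h'.IsInduced ψ) : (h.comp h').IsInduced (φ ≫ ψ) := by
  refine fun k => ⟨?_, fun i => ?_⟩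
  · exact (Category.assoc _ _ _).trans ((congrArg (φ.app k ≫ ·) (hψ k).1).trans
      ((Category.assoc _ _ _).symm.trans ((congrArg (· ≫ h'.g) (hφ k).1).trans
        (Category.assoc _ _ _))))
  · exact (Category.assoc _ _ _).trans ((congrArg (φ.app k ≫ ·) ((hψ k).2 i)).trans
      ((Category.assoc _ _ _).symm.trans ((congrArg (· ≫ h'.f) ((hφ k).2 i)).trans
        (Category.assoc _ _ _))))

end BundleHom

/-! ### Linear morphisms are additive and induce linear transformations -/

namespace AddBundle

/-- The image of an additive morphism under a functor that preserves the pullback powers. -/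
theorem IsAddMap.image {X : Type u} [Category.{v} X] {Z : Type u'} [Category.{v'} Z]
    {B B' : AddBundle X} {f : B.E ⟶ B'.E} {g : B.M ⟶ B'.M} (h : IsAddMap B B' f g) {G : X ⥤ Z}
    (hG : B.PreservedBy G) (hG' : B'.PreservedBy G) :
    IsAddMap (B.image G hG) (B'.image G hG') (G.map f) (G.map g) := by
  refine of_over ?_ ?_ ?_
  · exact (G.map_comp _ _).symm.trans ((congrArg G.map h.w).trans (G.map_comp _ _))
  · exact (G.map_comp _ _).symm.trans ((congrArg G.map h.zero).trans (G.map_comp _ _))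
  · intro Y m a b a' b' ha hb
    rw [image_add_hom, image_add_hom, Category.assoc, ← G.map_comp, h.add,
      B'.comp_map_pair_comp hG']
    refine congrArg (· ≫ G.map B'.σ) (B'.gPair_congr hG' _ ?_ ?_)
    · rw [G.map_comp, ← Category.assoc, PowBundle.gPair_proj_zero, ha]
    · rw [G.map_comp, ← Category.assoc, PowBundle.gPair_proj_one, hb]

end AddBundle

section Tangent

variable {X : Type u} [Category.{v} X] [MonoidalLeftAction Weil X]

theorem tanProj_naturality {M N : X} (f : M ⟶ N) :
    (Tan X).map f ≫ tanProj N = tanProj M ≫ f := by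
  refine (Category.assoc _ _ _).symm.trans ?_
  refine (congrArg (· ≫ (λₗ N).hom) (action_exchange (Weil.aug Weil.W) f)).trans ?_
  exact (Category.assoc _ _ _).trans ((congrArg (Weil.aug Weil.W ⊵ₗ M ≫ ·)
    (actionUnitIso_hom_naturality f).symm).trans (Category.assoc _ _ _).symm)

/-- Naturality of the tangent addition, with both a precomposed `e` and a postcomposed `T(f)`, so
that it rewrites either side of the additivity equation for a linear morphism. -/
theorem comp_tanPair_comp [IsTangentActegory X] {Y Z M N : X} (e : Z ⟶ Y) (a b : Y ⟶ (Tan X).obj M)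
    (h : a ≫ tanProj M = b ≫ tanProj M) (f : M ⟶ N) (a' b' : Z ⟶ (Tan X).obj N)
    (h' : a' ≫ tanProj N = b' ≫ tanProj N) (ha : e ≫ a ≫ (Tan X).map f = a')
    (hb : e ≫ b ≫ (Tan X).map f = b') :
    (e ≫ tanPair a b h ≫ tanAdd M) ≫ (Tan X).map f = tanPair a' b' h' ≫ tanAdd N := by
  have key : e ≫ tanPair a b h ≫ Weil.pow (Unit ⊕ Unit) ⊴ₗ f = tanPair a' b' h' := by
    refine (IsTangentActegory.foundational 0 Unit Unit N).hom_ext ?_ ?_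
    · refine Eq.trans ?_ (((IsTangentActegory.foundational 0 Unit Unit N).lift_fst _ _ _).trans
        ha.symm).symm
      change (e ≫ tanPair a b h ≫ Weil.pow (Unit ⊕ Unit) ⊴ₗ f) ≫ Weil.powFst Unit Unit ⊵ₗ N = _
      rw [Category.assoc, Category.assoc, action_exchange, ← Category.assoc (tanPair a b h)]
      exact congrArg (fun k => e ≫ k ≫ Weil.W ⊴ₗ f)
        ((IsTangentActegory.foundational 0 Unit Unit M).lift_fst _ _ _)
    · refine Eq.trans ?_ (((IsTangentActegory.foundational 0 Unit Unit N).lift_snd _ _ _).trans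
        hb.symm).symm
      change (e ≫ tanPair a b h ≫ Weil.pow (Unit ⊕ Unit) ⊴ₗ f) ≫ Weil.powSnd Unit Unit ⊵ₗ N = _
      rw [Category.assoc, Category.assoc, action_exchange, ← Category.assoc (tanPair a b h)]
      exact congrArg (fun k => e ≫ k ≫ Weil.W ⊴ₗ f)
        ((IsTangentActegory.foundational 0 Unit Unit M).lift_snd _ _ _)
  rw [← key, Category.assoc, Category.assoc, Category.assoc, Category.assoc]
  exact congrArg (fun k => e ≫ tanPair a b h ≫ k) (action_exchange Weil.add f).symm

end Tangent

namespace DiffBundle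

open AddBundle

variable {X : Type u} [Category.{v} X] [MonoidalLeftAction Weil X] [IsTangentActegory X]
variable (B : DiffBundle X)

/-- If `λ ∘ a = λ ∘ b`, then `q ∘ a = q ∘ b`, because `q ∘ p ∘ λ = q`. Over this common base, `λ ∘
a` is the combination of the family with `a` at `x` and zero at `1`, and combinations determine
their families. -/
instance mono_lam : Mono B.lam where
  right_cancellation {Y} a b h := by
    classical
    have hq (c : Y ⟶ B.E) : ((c ≫ B.lam) ≫ tanProj B.E) ≫ B.q = c ≫ B.q := by
      rw [Category.assoc c, B.lam_p, Category.assoc, Category.assoc, B.ζ_q, Category.comp_id]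
    have hab : b ≫ B.q = a ≫ B.q := by rw [← hq a, ← hq b, h]
    have hs (c : B.Over (a ≫ B.q)) :
        (B.combHom Weil.W rfl (Pi.single (Weil.monPow Unit (some ())) c)).hom = c.hom ≫ B.lam := by
      rw [combHom_apply, Finset.sum_eq_single (Weil.monPow Unit (some ())), Pi.single_eq_same]
      · exact congrArg (c.hom ≫ ·) B.lamMon_dual
      · intro s _ hs
        rw [Pi.single_eq_of_ne hs, map_zero]
      · exact fun h => (h (Finset.mem_univ _)).elim
    exact congrArg Over.hom (Pi.single_injective (M := fun _ => B.Over (a ≫ B.q)) _ ((B.combHom_bijective Weil.W rfl).1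
      (Over.ext' ((hs ⟨a, rfl⟩).trans (h.trans (hs ⟨b, hab⟩).symm)))))

end DiffBundle

namespace BundleHom

open AddBundle

variable {X : Type u} [Category.{v} X] [MonoidalLeftAction Weil X] [IsTangentActegory X]
variable {B B' : DiffBundle X} {h : BundleHom B B'}

theorem two_proj_zero (h : BundleHom B B') : h.two ≫ B'.proj 2 0 = B.proj 2 0 ≫ h.f :=
  PowBundle.pair_proj_zero _ _ _ _

theorem two_proj_one (h : BundleHom B B') : h.two ≫ B'.proj 2 1 = B.proj 2 1 ≫ h.f :=
  PowBundle.pair_proj_one _ _ _ _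

/-- Linear morphisms are additive. -/
theorem IsLinear.isAdditive (hl : h.IsLinear) : h.IsAdditive where
  add := by
    -- After composing with the monic lift, linearity and compatibility of both lifts with the
    -- tangent addition turn each side into a tangent sum.
    rw [← cancel_mono B'.lam, Category.assoc, Category.assoc, hl, B'.σ_lam', ← Category.assoc B.σ,
      B.σ_lam']
    have hw : (h.two ≫ B'.proj 2 0 ≫ B'.lam) ≫ tanProj B'.E =
        (h.two ≫ B'.proj 2 1 ≫ B'.lam) ≫ tanProj B'.E := by
      rw [Category.assoc, Category.assoc, Category.assoc, Category.assoc, B'.lam_p,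
        ← Category.assoc (B'.proj 2 0), ← Category.assoc (B'.proj 2 1), B'.proj_q' 2 0 1]
    have h₁ := comp_tanPair_comp h.two (B'.proj 2 0 ≫ B'.lam) (B'.proj 2 1 ≫ B'.lam)
      (by rw [Category.assoc, Category.assoc, B'.lam_p, ← Category.assoc, ← Category.assoc,
        B'.proj_q' 2 0 1]) (𝟙 _) _ _ hw (by rw [CategoryTheory.Functor.map_id, Category.comp_id])
        (by rw [CategoryTheory.Functor.map_id, Category.comp_id])
    have h₂ := comp_tanPair_comp (𝟙 _) (B.proj 2 0 ≫ B.lam) (B.proj 2 1 ≫ B.lam)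
      (by rw [Category.assoc, Category.assoc, B.lam_p, ← Category.assoc, ← Category.assoc,
        B.proj_q' 2 0 1]) h.f _ _ hw
        (by rw [Category.id_comp, Category.assoc, ← hl, ← Category.assoc, ← two_proj_zero,
          Category.assoc])
        (by rw [Category.id_comp, Category.assoc, ← hl, ← Category.assoc, ← two_proj_one,
          Category.assoc])
    rw [CategoryTheory.Functor.map_id, Category.comp_id] at h₁
    rw [Category.id_comp] at h₂
    exact h₁.trans h₂.symm
  zero := by
    -- Linearity composed with `p`, as `p ∘ λ = ζ ∘ q`. Precomposing with the section `ζ` of `q`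
    -- then removes `q`.
    have h₁ : B.q ≫ h.g ≫ B'.ζ = B.q ≫ B.ζ ≫ h.f := by
      rw [← Category.assoc, ← h.w, Category.assoc, ← B'.lam_p, ← Category.assoc, hl,
        Category.assoc, tanProj_naturality, ← Category.assoc, B.lam_p, Category.assoc]
    have h₂ := congrArg (B.ζ ≫ ·) h₁
    simp only [← Category.assoc, B.ζ_q] at h₂
    simpa only [Category.id_comp] using h₂

/-- For `s ≠ 1` linearity passes through the map induced by `x ↦ s`. For `s = 1` it is naturality of
the zero section. -/
theorem IsLinear.f_lamEl (hl : h.IsLinear) (A : Weil) (s : A.Mon) :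
    h.f ≫ B'.lamMon A s = B.lamMon A s ≫ A ⊴ₗ h.f := by
  by_cases hs : s = A.monOne
  · rw [hs, DiffBundle.lamMon_monOne, DiffBundle.lamMon_monOne, zeroAct_naturality]
  · have hl' : h.f ≫ B'.liftW = B.liftW ≫ Weil.W ⊴ₗ h.f := hl
    rw [DiffBundle.lamMon, DiffBundle.lamMon, B.lamEl_sq (Weil.mon_mul_self hs),
      B'.lamEl_sq (Weil.mon_mul_self hs), ← Category.assoc, hl', Category.assoc, Category.assoc,
      action_exchange]

/-- `T_A f` is additive, hence passes through the sum over monomials, and linearity moves `f` past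
each `λ_s`. -/
theorem IsAdditive.lineator_powMap (ha : h.IsAdditive) (hl : h.IsLinear) (A : Weil)
    (k : NBullet) : B.lineator A k ≫ A ⊴ₗ h.powMap k.dim =
      h.powMap (NBullet.act A k).dim ≫ B'.lineator A k := by
  have hf := ha.isAddMap.image (B.preservedBy (IsAction.action A))
    (B'.preservedBy (IsAction.action A))
  refine B'.act_hom_ext ?_ fun j => ?_
  · rw [B'.comp_lineator_base, powMap_base, Category.assoc, ← actionHomRight_comp, powMap_base,
      actionHomRight_comp, ← Category.assoc, B.lineator_base, Category.assoc, Category.assoc,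
      zeroAct_naturality]
  · rw [B'.comp_lineator_proj A k j _ (h.powMap_base _) rfl, Category.assoc,
      ← actionHomRight_comp, powMap_proj, actionHomRight_comp, ← Category.assoc, B.lineator_proj]
    refine congrArg Over.hom ((map_sum (hf.push (by
      rw [Category.assoc, Category.assoc, zeroAct_naturality])) (fun s =>
        (B.isAddMap_lamEl (A.mon s)).push rfl (B.projOver _ (NBullet.idx A k (s, j))))
          Finset.univ).trans (Finset.sum_congr rfl fun s _ => Over.ext' ?_))
    refine (Category.assoc _ _ _).trans ((congrArg (B.proj _ _ ≫ ·) (hl.f_lamEl A s).symm).trans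
      ((Category.assoc _ _ _).symm.trans ?_))
    exact congrArg (· ≫ B'.lamMon A s) (h.powMap_proj _ _).symm

theorem IsLinear.isLinearTrans (hl : h.IsLinear) (ha : h.IsAdditive) :
    letI := B.indOplax
    letI := B'.indOplax
    IsLinearTrans ha.trans :=
  fun A k => ha.lineator_powMap hl A k

end BundleHom

/-! ### The two induction functors and the theorem -/

section Induction

variable {X : Type u} [Category.{v} X] [MonoidalLeftAction Weil X] [IsTangentActegory X]

theorem BundleHom.IsAdditive.trans_id {B : DiffBundle X} (ha : (BundleHom.id B).IsAdditive) :
    ha.trans = 𝟙 _ :=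
  ha.isInduced_trans.unique (.id B)

theorem BundleHom.IsAdditive.trans_comp {B B' B'' : DiffBundle X} {h : BundleHom B B'} {h' : BundleHom B' B''}
    (ha : h.IsAdditive) (ha' : h'.IsAdditive) (hc : (h.comp h').IsAdditive) :
    hc.trans = ha.trans ≫ ha'.trans :=
  hc.isInduced_trans.unique (ha.isInduced_trans.comp ha'.isInduced_trans)

/-- The lax differential functor induced by a differential bundle. -/
noncomputable abbrev DiffBundle.laxDiffFunctor (B : DiffBundle X) :
    LaxDiffFunctor NBullet X :=
  ⟨B.indFunctor, B.indOplax, B.isLaxDifferential_ind⟩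

variable (X)

/-- The induction functor on additive morphisms. -/
noncomputable def indAdd : DBunAdd X ⥤ DiffFun NBullet X where
  obj B := ⟨B.bundle.laxDiffFunctor⟩
  map h := ⟨h.additive.trans⟩
  map_id B := DiffFun.Hom.ext (BundleHom.IsAdditive.trans_id (.id B.bundle))
  map_comp h h' := DiffFun.Hom.ext (h.additive.trans_comp h'.additive (h ≫ h').additive)

/-- The induction functor on linear morphisms. -/
noncomputable def indLin : DBunLin X ⥤ DiffFunLin NBullet X where
  obj B := ⟨B.bundle.laxDiffFunctor⟩
  map h := ⟨h.linear.isAdditive.trans, h.linear.isLinearTrans h.linear.isAdditive⟩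
  map_id B := DiffFunLin.Hom.ext (BundleHom.IsAdditive.trans_id (.id B.bundle))
  map_comp h h' := DiffFunLin.Hom.ext
    (h.linear.isAdditive.trans_comp h'.linear.isAdditive (h ≫ h').linear.isAdditive)

end Induction

theorem mainTheorem5 {X : Type u} [Category.{v} X] [MonoidalLeftAction Weil X]
    [IsTangentActegory X] :
    ∃ (α : ∀ E : DiffBundle X, E.indFunctor.OplaxLeftLinear Weil)
      (hα : ∀ E : DiffBundle X, letI := α E; IsLaxDifferential E.indFunctor)
      (φ : ∀ {E E' : DiffBundle X} (h : BundleHom E E'),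
        h.IsAdditive → (E.indFunctor ⟶ E'.indFunctor))
      (hadd : ∀ {E E' : DiffBundle X} (h : BundleHom E E'), h.IsLinear → h.IsAdditive)
      (hlin : ∀ {E E' : DiffBundle X} (h : BundleHom E E') (hl : h.IsLinear),
        letI := α E; letI := α E'; IsLinearTrans (φ h (hadd h hl))),
      (∀ E : DiffBundle X, letI := α E; E.IsInducedLineator) ∧
      (∀ {E E' : DiffBundle X} (h : BundleHom E E') (ha : h.IsAdditive), h.IsInduced (φ h ha)) ∧
      (∃ Ind : DBunAdd X ⥤ DiffFun NBullet X, Ind.toPrefunctor =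
        { obj := fun E => ⟨⟨E.bundle.indFunctor, α E.bundle, hα E.bundle⟩⟩
          map := fun h => ⟨φ h.hom h.additive⟩ }) ∧
      (∃ Ind : DBunLin X ⥤ DiffFunLin NBullet X, Ind.toPrefunctor =
        { obj := fun E => ⟨⟨E.bundle.indFunctor, α E.bundle, hα E.bundle⟩⟩
          map := fun h => ⟨φ h.hom (hadd h.hom h.linear), hlin h.hom h.linear⟩ }) := by
  exact ⟨fun E => E.indOplax, fun E => E.isLaxDifferential_ind, fun _ ha => ha.trans,
    fun _ hl => hl.isAdditive, fun _ hl => hl.isLinearTrans hl.isAdditive,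
    fun E => E.isInducedLineator_ind, fun _ ha => ha.isInduced_trans, ⟨indAdd X, rfl⟩,
    ⟨indLin X, rfl⟩⟩
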